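/- Consider functions $R,W,q,a$ of $(t,x)\in[0,\infty)\times\mathbb R$ and the evolution system $$R_{xx}-R_{tt}=0,$$ $$W_{tt}-W_{xx}+\tfrac{R_t}{R}W_t-\tfrac{R_x}{R}W_x+\tfrac12(q_t^2-q_x^2)e^{-4W}=0,$$ $$q_{tt}-q_{xx}+\tfrac{R_t}{R}q_t-\tfrac{R_x}{R}q_x-4q_tW_t+4q_xW_x=0,$$ $$a_{tt}-a_{xx}+\tfrac{R_x^2-R_t^2}{4R^2}+W_t^2-W_x^2+\tfrac14(q_t^2-q_x^2)e^{-4W}=0,$$ together with the constraint equations $$a_t\tfrac{R_t}{R}+a_x\tfrac{R_x}{R}+\tfrac14\Big(\tfrac{R_x^2}{R^2}+\tfrac{R_t^2}{R^2}\Big)-\tfrac{R_{xx}}{R}-(W_x^2+W_t^2)-\tfrac14e^{-4W}(q_x^2+q_t^2)=0,$$ $$a_x\tfrac{R_t}{R}+a_t\tfrac{R_x}{R}-\tfrac{R_{tx}}{R}+\tfrac{R_xR_t}{2R^2}-2W_tW_x-\tfrac12e^{-4W}q_xq_t=0.$$ Let $R_0>0$ and $R_b(t,x)=R_0e^{2t}\cosh(2x)$.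 Let initial data at $t=0$ be given with $R(0,\cdot),W(0,\cdot),q(0,\cdot),a(0,\cdot)\in C^2(\mathbb R)$ and $R_t(0,\cdot),W_t(0,\cdot),q_t(0,\cdot),a_t(0,\cdot)\in C^1(\mathbb R)$, such that $$\|R(0,\cdot)-R_b(0,\cdot)\|_{C^0}+\|R_t(0,\cdot)-(R_b)_t(0,\cdot)\|_{C^0}<\tfrac23R_0$$ (supremum norms), and suppose that both constraint equations hold at $t=0$. Then there is a $C^2$ solution $(R,W,q,a)$ of the evolution system on $[0,\infty)\times\mathbb R$ with these initial data, and every $C^2$ solution with the same data on some $[0,T)\times\mathbb R$, $T>0$, coincides with it there. It satisfies $R>0$ and both constraint equations for all $t\ge0$. Moreover, the metric $$g=e^{2a}(-dt^2+dx^2)+R(e^{2W}+q^2e^{-2W})\,d\theta_1^2-2Rqe^{-2W}\,d\theta_1d\theta_2+Re^{-2W}\,d\theta_2^2$$ on $[0,\infty)\times\mathbb R\times\mathbb T^2$ is a Cauchy development of the data: it is a $C^2$ Lorentzian metric with $\mathrm{Ric}(g)=0$, it induces on $\{t=0\}$ the Riemannian metric $h$ and the second fundamental form $K$ determined by the initial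 data (that is, $h$ is the spatial part of $g$ at $t=0$ and $K=-\tfrac12e^{-a}\partial_th$, where $\partial_t h$ is computed from the data), and $\{t=0\}$ is a Cauchy hypersurface, i.e. every inextendible causal curve in $[0,\infty)\times\mathbb R\times\mathbb T^2$ meets it exactly once. -/

import Mathlib

noncomputable section

namespace TorusSymmetric

/-! ### Functions of (t, x) and the evolution and constraint equations -/

/-- Partial derivative in `t` of a function on `[0, ∞) × ℝ` (one-sided at `t = 0`). -/
def dt (f : ℝ → ℝ → ℝ) (t x : ℝ) : ℝ := derivWithin (fun s => f s x) (Set.Ici 0) t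

/-- Partial derivative in `x`. -/
def dx (f : ℝ → ℝ → ℝ) (t x : ℝ) : ℝ := deriv (fun y => f t y) x

/-- The four unknowns `R, W, q, a` as functions of `(t, x)`. -/
structure Fields where
  R : ℝ → ℝ → ℝ
  W : ℝ → ℝ → ℝ
  q : ℝ → ℝ → ℝ
  a : ℝ → ℝ → ℝ

/-- Values and first time derivatives of `R, W, q, a` on a slice of constant `t`. -/
structure SliceData where
  R : ℝ → ℝ
  Rt : ℝ → ℝ
  W : ℝ → ℝ
  Wt : ℝ → ℝ
  q : ℝ → ℝ
  qt : ℝ → ℝ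
  a : ℝ → ℝ
  a_t : ℝ → ℝ

/-- The data induced by `u` on the slice at time `t`. -/
def Fields.slice (u : Fields) (t : ℝ) : SliceData where
  R := u.R t
  Rt := dt u.R t
  W := u.W t
  Wt := dt u.W t
  q := u.q t
  qt := dt u.q t
  a := u.a t
  a_t := dt u.a t

/-- `u` is a `C²` solution, for times `t ∈ J` (an interval of `[0, ∞)` containing `0`), of
the wave equation for `R`, the wave map equations for `(W, q)` and the wave equation for `a`. -/
structure Fields.IsSolutionOn (u : Fields) (J : Set ℝ) : Prop where
  contDiff_R : ContDiffOn ℝ 2 (Function.uncurry u.R) (J ×ˢ Set.univ)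
  contDiff_W : ContDiffOn ℝ 2 (Function.uncurry u.W) (J ×ˢ Set.univ)
  contDiff_q : ContDiffOn ℝ 2 (Function.uncurry u.q) (J ×ˢ Set.univ)
  contDiff_a : ContDiffOn ℝ 2 (Function.uncurry u.a) (J ×ˢ Set.univ)
  eq_R : ∀ t ∈ J, ∀ x, dx (dx u.R) t x - dt (dt u.R) t x = 0
  eq_W : ∀ t ∈ J, ∀ x,
    dt (dt u.W) t x - dx (dx u.W) t x
      + dt u.R t x / u.R t x * dt u.W t x - dx u.R t x / u.R t x * dx u.W t x
      + (dt u.q t x ^ 2 - dx u.q t x ^ 2) / 2 * Real.exp (-4 * u.W t x) = 0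
  eq_q : ∀ t ∈ J, ∀ x,
    dt (dt u.q) t x - dx (dx u.q) t x
      + dt u.R t x / u.R t x * dt u.q t x - dx u.R t x / u.R t x * dx u.q t x
      - 4 * dt u.q t x * dt u.W t x + 4 * dx u.q t x * dx u.W t x = 0
  eq_a : ∀ t ∈ J, ∀ x,
    dt (dt u.a) t x - dx (dx u.a) t x
      + (dx u.R t x ^ 2 - dt u.R t x ^ 2) / (4 * u.R t x ^ 2)
      + dt u.W t x ^ 2 - dx u.W t x ^ 2
      + (1 / 4) * (dt u.q t x ^ 2 - dx u.q t x ^ 2) * Real.exp (-4 * u.W t x) = 0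

/-- The constraint equations on a slice (all spatial derivatives are derivatives of the
slice data; `R_{tx}` is the `x`-derivative of `Rt`). -/
def SliceData.Constraints (D : SliceData) : Prop :=
  ∀ x : ℝ,
    (D.a_t x * (D.Rt x / D.R x) + deriv D.a x * (deriv D.R x / D.R x)
      + (1 / 4) * (deriv D.R x ^ 2 / D.R x ^ 2 + D.Rt x ^ 2 / D.R x ^ 2)
      - deriv (deriv D.R) x / D.R x
      - (deriv D.W x ^ 2 + D.Wt x ^ 2)
      - (1 / 4) * Real.exp (-4 * D.W x) * (deriv D.q x ^ 2 + D.qt x ^ 2) = 0) ∧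
    (deriv D.a x * (D.Rt x / D.R x) + D.a_t x * (deriv D.R x / D.R x)
      - deriv D.Rt x / D.R x + deriv D.R x * D.Rt x / (2 * D.R x ^ 2)
      - 2 * D.Wt x * deriv D.W x
      - (1 / 2) * Real.exp (-4 * D.W x) * deriv D.q x * D.qt x = 0)

/-- The background `R_b(t, x) = R₀ e^{2t} cosh(2x)` of the double cusp. -/
def Rb (R₀ : ℝ) (t x : ℝ) : ℝ := R₀ * Real.exp (2 * t) * Real.cosh (2 * x)

/-- The `C⁰` (supremum) norm on `ℝ`, with value `∞` for unbounded functions. -/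
def C0norm (f : ℝ → ℝ) : ENNReal := ⨆ x, ENNReal.ofReal |f x|

/-- `m₀ = ‖R - R_b‖_{C⁰} + ‖R_t - (R_b)_t‖_{C⁰}` at `t = 0`. -/
def m0 (R₀ : ℝ) (D : SliceData) : ENNReal :=
  C0norm (fun x => D.R x - Rb R₀ 0 x) + C0norm (fun x => D.Rt x - dt (Rb R₀) 0 x)

/-! ### Lorentzian metrics on `[0, ∞) × ℝ × T²`

A tensor on `[0, ∞) × ℝ × T²` is given by its components in the coordinates
`(t, x, θ₁, θ₂) = (p 0, p 1, p 2, p 3)` of the universal cover `[0, ∞) × ℝ × ℝ²`,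
periodic with period `2π` in `θ₁` and `θ₂`. -/

/-- The universal cover `[0, ∞) × ℝ × ℝ²`. -/
def Cover : Set (Fin 4 → ℝ) := {p | 0 ≤ p 0}

/-- The `i`-th coordinate partial derivative on the cover (one-sided in `t` at `t = 0`). -/
def pd (i : Fin 4) (f : (Fin 4 → ℝ) → ℝ) (p : Fin 4 → ℝ) : ℝ :=
  derivWithin (fun s => f (Function.update p i s)) {s | Function.update p i s ∈ Cover} (p i)

/-- Christoffel symbols `Γ^k_{ij}` of the Levi-Civita connection of `g`. -/
def christoffel (g : (Fin 4 → ℝ) → Matrix (Fin 4) (Fin 4) ℝ) (k i j : Fin 4)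
    (p : Fin 4 → ℝ) : ℝ :=
  (1 / 2) * ∑ l, (g p)⁻¹ k l *
    (pd i (fun y => g y j l) p + pd j (fun y => g y i l) p - pd l (fun y => g y i j) p)

/-- Components `Ric_{ij}` of the Ricci tensor of `g`. -/
def ricci (g : (Fin 4 → ℝ) → Matrix (Fin 4) (Fin 4) ℝ) (i j : Fin 4) (p : Fin 4 → ℝ) : ℝ :=
  ∑ k, (pd k (christoffel g k i j) p - pd j (christoffel g k i k) p)
    + ∑ k, ∑ l, (christoffel g k k l p * christoffel g l i j p
        - christoffel g k j l p * christoffel g l i k p)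

/-- The point `(0, x, θ₁, θ₂)` of the initial slice. -/
def onSlice (y : Fin 3 → ℝ) : Fin 4 → ℝ := Fin.cons 0 y

/-- Second fundamental form `K(X, Y) = -g(∇_X n, Y) = g(n, ∇_X Y)` of the slice `t = 0`, with
`n` the future unit normal.  As `n_μ = -N δ⁰_μ` with `N = (-g⁰⁰)^{-1/2}`, one has
`K_{ij} = -N Γ⁰_{ij}`. -/
def secondForm (g : (Fin 4 → ℝ) → Matrix (Fin 4) (Fin 4) ℝ) (y : Fin 3 → ℝ) :
    Matrix (Fin 3) (Fin 3) ℝ :=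
  Matrix.of fun i j =>
    -(1 / Real.sqrt (-((g (onSlice y))⁻¹ 0 0))) * christoffel g 0 i.succ j.succ (onSlice y)

/-! ### Causal curves and Cauchy hypersurfaces -/

/-- The manifold with boundary `[0, ∞) × ℝ × T²`, with `T² = (ℝ / 2πℤ)²`. -/
abbrev Spacetime : Type :=
  Set.Ici (0 : ℝ) × ℝ × AddCircle (2 * Real.pi) × AddCircle (2 * Real.pi)

/-- The point `c` of the universal cover lies over the point `p` of the spacetime. -/
def LiesOver (c : Fin 4 → ℝ) (p : Spacetime) : Prop :=
  c 0 = (p.1 : ℝ) ∧ c 1 = p.2.1 ∧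
    ((c 2 : ℝ) : AddCircle (2 * Real.pi)) = p.2.2.1 ∧
    ((c 3 : ℝ) : AddCircle (2 * Real.pi)) = p.2.2.2

/-- `γ : I → [0, ∞) × ℝ × T²`, with `I` an interval, is a future-directed causal curve: it
has a continuous lift to the cover which, off a set of parameters that is finite in each
compact subinterval of `I`, is differentiable with velocity `v ≠ 0`, `g(v, v) ≤ 0`, `v⁰ > 0`
(the time orientation is that of `∂_t`). -/
def IsCausalCurve (g : (Fin 4 → ℝ) → Matrix (Fin 4) (Fin 4) ℝ) (I : Set ℝ)
    (γ : I → Spacetime) : Prop :=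
  I.OrdConnected ∧ ∃ c : ℝ → Fin 4 → ℝ,
    (∀ s : I, LiesOver (c s) (γ s)) ∧ ContinuousOn c I ∧
    ∃ P : Set ℝ, (∀ s₁ ∈ I, ∀ s₂ ∈ I, (P ∩ Set.Icc s₁ s₂).Finite) ∧
      ∀ s ∈ I, s ∉ P → ∃ v : Fin 4 → ℝ, HasDerivWithinAt c v I s ∧
        v ≠ 0 ∧ v ⬝ᵥ (g (c s)).mulVec v ≤ 0 ∧ 0 < v 0

/-- A future-directed causal curve is inextendible if it has no future endpoint, and its only
possible past endpoint is a point of the boundary `t = 0` at which the curve starts (such a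
curve cannot be prolonged to the past inside the manifold with boundary). -/
def IsInextendible {I : Set ℝ} (γ : I → Spacetime) : Prop :=
  (∀ p, ¬ Filter.Tendsto γ Filter.atTop (nhds p)) ∧
  (∀ p, Filter.Tendsto γ Filter.atBot (nhds p) → (p.1 : ℝ) = 0 ∧ ∃ s, γ s = p)

/-- `{t = 0}` is a Cauchy hypersurface: every inextendible causal curve meets it exactly
once. -/
def InitialSliceIsCauchy (g : (Fin 4 → ℝ) → Matrix (Fin 4) (Fin 4) ℝ) : Prop :=
  ∀ (I : Set ℝ) (γ : I → Spacetime), IsCausalCurve g I γ → IsInextendible γ →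
    ∃! s : I, ((γ s).1 : ℝ) = 0

/-- The metric `g` on `[0, ∞) × ℝ × T²` is a (future) Cauchy development of the vacuum
initial data set `(h, K)` on `ℝ × T²`: a `C²` Lorentzian metric, time-oriented by `∂_t`, with
`Ric = 0`, for which `{t = 0}` is a Cauchy hypersurface with induced Riemannian metric `h` and
second fundamental form `K`. -/
structure IsVacuumCauchyDevelopment (g : (Fin 4 → ℝ) → Matrix (Fin 4) (Fin 4) ℝ)
    (h K : (Fin 3 → ℝ) → Matrix (Fin 3) (Fin 3) ℝ) : Prop where
  contDiff : ∀ i j, ContDiffOn ℝ 2 (fun p => g p i j) Cover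
  periodic : ∀ p ∈ Cover, g (p + Pi.single 2 (2 * Real.pi)) = g p ∧
    g (p + Pi.single 3 (2 * Real.pi)) = g p
  lorentzian : ∀ p ∈ Cover, ∃ P : Matrix (Fin 4) (Fin 4) ℝ, IsUnit P.det ∧
    P.transpose * g p * P = Matrix.diagonal ![-1, 1, 1, 1]
  timeOriented : ∀ p ∈ Cover, g p 0 0 < 0
  vacuum : ∀ p ∈ Cover, ∀ i j, ricci g i j p = 0
  riemannian : ∀ y, (h y).PosDef
  induced_metric : ∀ y i j, g (onSlice y) (Fin.succ i) (Fin.succ j) = h y i j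
  induced_secondForm : ∀ y, secondForm g y = K y
  cauchy : InitialSliceIsCauchy g

/-! ### The `T²`-symmetric metric and its initial data -/

/-- The metric `e^{2a}(-dt² + dx²) + R(e^{2W} + q² e^{-2W}) dθ₁² - 2Rq e^{-2W} dθ₁dθ₂
+ R e^{-2W} dθ₂²`. -/
def Fields.metric (u : Fields) (p : Fin 4 → ℝ) : Matrix (Fin 4) (Fin 4) ℝ :=
  let R := u.R (p 0) (p 1)
  let W := u.W (p 0) (p 1)
  let q := u.q (p 0) (p 1)
  let a := u.a (p 0) (p 1)
  !![-Real.exp (2 * a), 0, 0, 0;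
     0, Real.exp (2 * a), 0, 0;
     0, 0, R * (Real.exp (2 * W) + q ^ 2 * Real.exp (-2 * W)), -(R * q * Real.exp (-2 * W));
     0, 0, -(R * q * Real.exp (-2 * W)), R * Real.exp (-2 * W)]

/-- The Riemannian metric on `ℝ × T²` determined by the data, at `(x, θ₁, θ₂) = y`. -/
def SliceData.firstForm (D : SliceData) (y : Fin 3 → ℝ) : Matrix (Fin 3) (Fin 3) ℝ :=
  let R := D.R (y 0)
  let W := D.W (y 0)
  let q := D.q (y 0)
  !![Real.exp (2 * D.a (y 0)), 0, 0;
     0, R * (Real.exp (2 * W) + q ^ 2 * Real.exp (-2 * W)), -(R * q * Real.exp (-2 * W));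
     0, -(R * q * Real.exp (-2 * W)), R * Real.exp (-2 * W)]

/-- The second fundamental form on `ℝ × T²` determined by the data, at `(x, θ₁, θ₂) = y`:
`-(1/2) e^{-a}` times the formal time derivative of the spatial metric. -/
def SliceData.secondForm (D : SliceData) (y : Fin 3 → ℝ) : Matrix (Fin 3) (Fin 3) ℝ :=
  let R := D.R (y 0)
  let W := D.W (y 0)
  let q := D.q (y 0)
  let Rt := D.Rt (y 0)
  let Wt := D.Wt (y 0)
  let qt := D.qt (y 0)
  let k₁₁ := Rt * (Real.exp (2 * W) + q ^ 2 * Real.exp (-2 * W))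
    + R * (2 * Wt * Real.exp (2 * W) + 2 * q * qt * Real.exp (-2 * W)
      - 2 * Wt * q ^ 2 * Real.exp (-2 * W))
  let k₁₂ := -(Rt * q + R * qt - 2 * R * q * Wt) * Real.exp (-2 * W)
  let k₂₂ := (Rt - 2 * R * Wt) * Real.exp (-2 * W)
  (-(1 / 2) * Real.exp (-D.a (y 0))) •
    !![2 * D.a_t (y 0) * Real.exp (2 * D.a (y 0)), 0, 0;
       0, k₁₁, k₁₂;
       0, k₁₂, k₂₂]

end TorusSymmetric

end

/-!
In the null coordinates `p = x + t`, `m = x - t` the equation for `R` reads `∂ₚ ∂ₘ R = 0`, so `R` is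
explicit. The assumption on the data gives `R ≥ R₀ / 3` and `R_t ≥ 0` at `t = 0`
(`bounds_of_m0_lt`), and then d'Alembert's formula gives `R ≥ R₀ / 3` for all `t ≥ 0`.

*Existence.* Given `R`, the equations for `(W, q)` are those of a wave map into the hyperbolic
plane, with damping coefficients `∂ log R` that are now known functions. Written in an orthonormal
frame of the target, with complex numbers `A`, `B` for the two null derivatives of the map, they
become a closed system of two transport equations (`NullSystem`), whose only nonlinear terms are
`-i (Im B) A` and `i (Im A) B`. A coefficient that is purely imaginary rotates the unknown and does
not change its modulus (`norm_le_exp_of_linear_ode`). Hence the iteration that solves, at each step,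
linear transport equations with the previous iterate in the coefficients preserves a linear
exponential bound, and it contracts a weighted sup norm on each square
(`NullSystem.Cont.exists_contraction`). Its limit is a global solution
(`NullSystem.exists_solution`), from which `W`, `q` are found by the Poincaré lemma
(`exists_primitive`, `exists_waveMap`). The equation for `a` is then a wave equation with a given
source (`exists_wave`). The sum and the difference of the constraint equations, multiplied by `R`,
are each constant along one family of null lines (`hasDerivAt_nullConstraint`), so they vanish if
they vanish at `t = 0`. All this is collected in `exists_global_solution`.

*Uniqueness.* The difference of two solutions satisfies linear differential inequalities along the
characteristics, with zero data. The maximum of a weighted norm over a backward characteristic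
triangle must then be zero (`eq_zero_of_char`). This applies first to `R`, then to the null
derivatives of the wave map, then to `a` (`solution_unique`).

*The metric.* The Christoffel symbols are computed in closed form (`Fields.christoffel_metric`), and
the components of the Ricci tensor are linear combinations of the evolution and constraint
equations (`Fields.ricci_eq_zero`). Along a causal curve `t` increases strictly, and `x` and the
angles are Lipschitz functions of `t` as long as `t` stays bounded, so the only way for a curve to
be inextendible to the past is to reach `t = 0` (`initialSliceIsCauchy`).
-/

noncomputable section

namespace TorusSymmetric

open Set Filter Topology MeasureTheory intervalIntegral
open scoped Interval

/-! ### Calculus of functions of two real variables -/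

section Calculus

variable {E : Type*} [NormedAddCommGroup E] [NormedSpace ℝ E]

/-- The linear map `(h, k) ↦ h • a + k • b` on `ℝ × ℝ`. -/
def grad (a b : E) : ℝ × ℝ →L[ℝ] E :=
  (ContinuousLinearMap.toSpanSingleton ℝ a).coprod (ContinuousLinearMap.toSpanSingleton ℝ b)

@[simp] lemma grad_apply (a b : E) (v : ℝ × ℝ) : grad a b v = v.1 • a + v.2 • b := by
  simp [grad]

/-- `f` has the partial derivatives `f₁`, `f₂`, which are continuous. -/
structure HasPartials (f f₁ f₂ : ℝ → ℝ → E) : Prop where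
  fst : ∀ p m, HasDerivAt (fun s => f s m) (f₁ p m) p
  snd : ∀ p m, HasDerivAt (fun s => f p s) (f₂ p m) m
  cont_fst : Continuous (Function.uncurry f₁)
  cont_snd : Continuous (Function.uncurry f₂)

lemma HasPartials.hasFDerivAt {f f₁ f₂ : ℝ → ℝ → E} (h : HasPartials f f₁ f₂) (v : ℝ × ℝ) :
    HasFDerivAt (Function.uncurry f) (grad (f₁ v.1 v.2) (f₂ v.1 v.2)) v := by
  have := hasStrictFDerivAt_uncurry_coprod (𝕜 := ℝ) (u := v) (f := f)
    (f₁ := fun p m => ContinuousLinearMap.toSpanSingleton ℝ (f₁ p m))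
    (f₂ := fun p m => ContinuousLinearMap.toSpanSingleton ℝ (f₂ p m))
    (Eventually.of_forall fun w => (h.fst w.1 w.2).hasFDerivAt)
    (Eventually.of_forall fun w => (h.snd w.1 w.2).hasFDerivAt)
    (((ContinuousLinearMap.toSpanSingletonCLE (𝕜 := ℝ) (E := E)).continuous.comp
      h.cont_fst).continuousAt)
    (((ContinuousLinearMap.toSpanSingletonCLE (𝕜 := ℝ) (E := E)).continuous.comp
      h.cont_snd).continuousAt)
  exact this.hasFDerivAt

lemma continuous_grad {X : Type*} [TopologicalSpace X] {a b : X → E} (ha : Continuous a)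
    (hb : Continuous b) : Continuous fun x => grad (a x) (b x) := by
  have h : (fun x => grad (a x) (b x)) = fun x =>
      (ContinuousLinearMap.toSpanSingletonCLE (𝕜 := ℝ) (E := E) (a x)).comp
        (ContinuousLinearMap.fst ℝ ℝ ℝ) +
      (ContinuousLinearMap.toSpanSingletonCLE (𝕜 := ℝ) (E := E) (b x)).comp
        (ContinuousLinearMap.snd ℝ ℝ ℝ) := by
    ext x <;> simp [grad]
  rw [h]
  fun_prop

lemma contDiff_grad {n : WithTop ℕ∞} {a b : ℝ × ℝ → E} (ha : ContDiff ℝ n a)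
    (hb : ContDiff ℝ n b) : ContDiff ℝ n fun x => grad (a x) (b x) := by
  have h : (fun x => grad (a x) (b x)) = fun x =>
      (ContinuousLinearMap.toSpanSingletonCLE (𝕜 := ℝ) (E := E) (a x)).comp
        (ContinuousLinearMap.fst ℝ ℝ ℝ) +
      (ContinuousLinearMap.toSpanSingletonCLE (𝕜 := ℝ) (E := E) (b x)).comp
        (ContinuousLinearMap.snd ℝ ℝ ℝ) := by
    ext x <;> simp [grad]
  rw [h]
  exact (((ContinuousLinearEquiv.contDiff _).comp ha).clm_comp contDiff_const).add
    (((ContinuousLinearEquiv.contDiff _).comp hb).clm_comp contDiff_const)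

lemma HasPartials.contDiff_one {f f₁ f₂ : ℝ → ℝ → E} (h : HasPartials f f₁ f₂) :
    ContDiff ℝ 1 (Function.uncurry f) :=
  contDiff_one_iff_hasFDerivAt.2 ⟨fun v => grad (f₁ v.1 v.2) (f₂ v.1 v.2),
    continuous_grad h.cont_fst h.cont_snd, h.hasFDerivAt⟩

lemma HasPartials.contDiff_two {f f₁ f₂ : ℝ → ℝ → E} (h : HasPartials f f₁ f₂)
    (h₁ : ContDiff ℝ 1 (Function.uncurry f₁)) (h₂ : ContDiff ℝ 1 (Function.uncurry f₂)) :
    ContDiff ℝ 2 (Function.uncurry f) :=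
  (contDiff_succ_iff_hasFDerivAt (n := 1)).2 ⟨fun v => grad (f₁ v.1 v.2) (f₂ v.1 v.2),
    contDiff_grad h₁ h₂, h.hasFDerivAt⟩

/-- The chain rule along a curve. -/
lemma HasPartials.comp {f f₁ f₂ : ℝ → ℝ → E} (h : HasPartials f f₁ f₂) {α β : ℝ → ℝ}
    {α' β' s : ℝ} (hα : HasDerivAt α α' s) (hβ : HasDerivAt β β' s) :
    HasDerivAt (fun r => f (α r) (β r))
      (α' • f₁ (α s) (β s) + β' • f₂ (α s) (β s)) s := by
  have := (h.hasFDerivAt (α s, β s)).comp_hasDerivAt s (hα.prodMk hβ)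
  simpa using! this

/-- Every `C¹` function has continuous partial derivatives. -/
lemma exists_hasPartials {f : ℝ → ℝ → E} (h : ContDiff ℝ 1 (Function.uncurry f)) :
    ∃ f₁ f₂, HasPartials f f₁ f₂ := by
  have hd : Differentiable ℝ (Function.uncurry f) := h.differentiable one_ne_zero
  have hc : Continuous (fderiv ℝ (Function.uncurry f)) := h.continuous_fderiv one_ne_zero
  refine ⟨fun p m => fderiv ℝ (Function.uncurry f) (p, m) (1, 0),
    fun p m => fderiv ℝ (Function.uncurry f) (p, m) (0, 1), ?_, ?_, ?_, ?_⟩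
  · intro p m
    exact (hd (p, m)).hasFDerivAt.comp_hasDerivAt p
      ((hasDerivAt_id p).prodMk (hasDerivAt_const p m))
  · intro p m
    exact (hd (p, m)).hasFDerivAt.comp_hasDerivAt m
      ((hasDerivAt_const m p).prodMk (hasDerivAt_id m))
  · exact hc.clm_apply continuous_const
  · exact hc.clm_apply continuous_const

lemma HasPartials.continuous {f f₁ f₂ : ℝ → ℝ → E} (h : HasPartials f f₁ f₂) :
    Continuous (Function.uncurry f) := h.contDiff_one.continuous

lemma HasPartials.swap {f f₁ f₂ : ℝ → ℝ → E} (h : HasPartials f f₁ f₂) :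
    HasPartials (fun p m => f m p) (fun p m => f₂ m p) (fun p m => f₁ m p) :=
  ⟨fun p m => h.snd m p, fun p m => h.fst m p, h.cont_snd.comp continuous_swap,
    h.cont_fst.comp continuous_swap⟩

/-- Differentiation under the integral sign. -/
lemma hasDerivAt_integral_fst {h h' : ℝ → ℝ → E} (hc : Continuous (Function.uncurry h))
    (hd : ∀ p s, HasDerivAt (fun p => h p s) (h' p s) p)
    (hc' : Continuous (Function.uncurry h')) (p a b : ℝ) :
    HasDerivAt (fun p => ∫ s in a..b, h p s) (∫ s in a..b, h' p s) p := by
  obtain ⟨C, hC⟩ := ((isCompact_Icc (a := p - 1) (b := p + 1)).prod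
    (isCompact_uIcc (a := a) (b := b))).exists_bound_of_continuousOn hc'.continuousOn
  refine (intervalIntegral.hasDerivAt_integral_of_dominated_loc_of_deriv_le (μ := volume)
    (bound := fun _ => C) (F := h) (F' := h') (s := Icc (p - 1) (p + 1))
    (Icc_mem_nhds (by linarith) (by linarith))
    ?_ ?_ ?_ ?_ ?_ ?_).2
  · exact Eventually.of_forall fun x =>
      (hc.comp (Continuous.prodMk_right x)).aestronglyMeasurable
  · exact (hc.comp (Continuous.prodMk_right p)).intervalIntegrable _ _
  · exact (hc'.comp (Continuous.prodMk_right p)).aestronglyMeasurable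
  · exact Eventually.of_forall fun s hs x hx => hC (x, s) ⟨hx, uIoc_subset_uIcc hs⟩
  · exact intervalIntegrable_const
  · exact Eventually.of_forall fun s _ x _ => hd x s

variable [CompleteSpace E]

lemma hasDerivAt_integral_snd {h : ℝ → ℝ → E} (hc : Continuous (Function.uncurry h)) (p c m : ℝ) :
    HasDerivAt (fun m => ∫ s in c..m, h p s) (h p m) m := by
  have hp : Continuous (h p) := hc.comp (Continuous.prodMk_right p)
  exact integral_hasDerivAt_right (hp.intervalIntegrable _ _)
    (hp.stronglyMeasurableAtFilter _ _) hp.continuousAt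

/-- The Leibniz rule for the integral from the diagonal along the second variable. -/
lemma hasPartials_integral {h h' : ℝ → ℝ → E} (hc : Continuous (Function.uncurry h))
    (hd : ∀ p s, HasDerivAt (fun p => h p s) (h' p s) p)
    (hc' : Continuous (Function.uncurry h')) :
    HasPartials (fun p m => ∫ s in p..m, h p s) (fun p m => (∫ s in p..m, h' p s) - h p p) h := by
  have key : HasPartials (fun p m => ∫ s in (0 : ℝ)..m, h p s)
      (fun p m => ∫ s in (0 : ℝ)..m, h' p s) h :=
    ⟨fun p m => hasDerivAt_integral_fst hc hd hc' p 0 m,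
      fun p m => hasDerivAt_integral_snd hc p 0 m,
      continuous_parametric_primitive_of_continuous (μ := volume) hc', hc⟩
  have int : ∀ (k : ℝ → ℝ → E), Continuous (Function.uncurry k) → ∀ p m,
      ∫ s in p..m, k p s = (∫ s in (0 : ℝ)..m, k p s) - ∫ s in (0 : ℝ)..p, k p s := by
    intro k hk p m
    have := hk.comp (Continuous.prodMk_right p)
    exact (integral_interval_sub_left (this.intervalIntegrable _ _)
      (this.intervalIntegrable _ _)).symm
  refine ⟨fun p m => ?_, fun p m => hasDerivAt_integral_snd hc p p m, ?_, hc⟩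
  · have h1 := (key.fst p m).sub (key.comp (hasDerivAt_id p) (hasDerivAt_id p))
    simp only [int h hc]
    refine (h1.congr_deriv ?_)
    simp only [int h' hc', id, one_smul]
    abel
  · have h1 : Continuous fun v : ℝ × ℝ => ∫ s in (0 : ℝ)..v.2, h' v.1 s :=
      continuous_parametric_primitive_of_continuous (μ := volume) hc'
    have h2 : Continuous fun v : ℝ × ℝ => ∫ s in (0 : ℝ)..v.1, h' v.1 s :=
      h1.comp (continuous_fst.prodMk continuous_fst)
    have h3 : Continuous fun v : ℝ × ℝ => h v.1 v.1 :=
      hc.comp (continuous_fst.prodMk continuous_fst)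
    refine ((h1.sub h2).sub h3).congr fun v => ?_
    simp [Function.uncurry, int h' hc']

/-- Poincaré lemma: a closed `C¹` form `P dp + Q dm` has a `C²` primitive with prescribed
compatible values on the diagonal. -/
lemma exists_primitive {P Q P₁ P₂ Q₁ : ℝ → ℝ → E} {Q₂ : ℝ → ℝ → E} {w₀ : ℝ → E}
    (hP : HasPartials P P₁ P₂) (hQ : HasPartials Q Q₁ Q₂) (hPQ : ∀ p m, P₂ p m = Q₁ p m)
    (hw : ∀ p, HasDerivAt w₀ (P p p + Q p p) p) :
    ∃ w : ℝ → ℝ → E, HasPartials w P Q ∧ ∀ p, w p p = w₀ p := by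
  have hI := hasPartials_integral hQ.continuous hQ.fst hQ.cont_fst
  refine ⟨fun p m => w₀ p + ∫ s in p..m, Q p s, ⟨fun p m => ?_, fun p m => ?_,
    hP.continuous, hQ.continuous⟩, fun p => by simp⟩
  · refine ((hw p).add (hI.fst p m)).congr_deriv ?_
    have : ∫ s in p..m, Q₁ p s = P p m - P p p := by
      simp only [← hPQ]
      exact integral_eq_sub_of_hasDerivAt (fun s _ => hP.snd p s)
        ((hP.cont_snd.comp (Continuous.prodMk_right p)).intervalIntegrable _ _)
    rw [this]; abel
  · exact (hI.snd p m).const_add _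

end Calculus

/-! ### A hyperbolic system in null coordinates -/

/-- The case `b ≤ m` of `norm_le_exp_of_linear_ode`. As `inner ℝ y (iω y) = 0`, the coefficient `ω`
drops out of the equation for `‖y‖ ^ 2`. -/
lemma norm_le_exp_of_linear_ode_forward {y : ℝ → ℂ} {k ω : ℝ → ℝ} {s : ℝ → ℂ} {b m C D N l : ℝ}
    (hbm : b ≤ m)
    (hy : ∀ τ, HasDerivAt y (((k τ : ℂ) + ω τ * Complex.I) * y τ + s τ) τ)
    (hk : ∀ τ ∈ Icc b m, |k τ| ≤ C) (hs : ∀ τ ∈ Icc b m, ‖s τ‖ ≤ D * Real.exp (l * (τ - b)))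
    (hN : 0 < N) (h0 : ‖y b‖ ≤ N) (hl : C * N + D < l * N) :
    ‖y m‖ ≤ N * Real.exp (l * (m - b)) := by
  have hd : ∀ τ, HasDerivAt (fun τ => ‖y τ‖ ^ 2)
      (2 * (k τ * ‖y τ‖ ^ 2 + inner ℝ (y τ) (s τ))) τ := by
    intro τ
    refine (hy τ).norm_sq.congr_deriv ?_
    rw [inner_add_right]
    congr 2
    rw [Complex.inner, ← Complex.normSq_eq_norm_sq, Complex.normSq_apply]
    simp
    ring
  have hB : ∀ τ, HasDerivAt (fun τ => (N * Real.exp (l * (τ - b))) ^ 2)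
      (2 * l * (N * Real.exp (l * (τ - b))) ^ 2) τ := by
    intro τ
    have h1 : HasDerivAt (fun τ => l * (τ - b)) l τ := by
      simpa using ((hasDerivAt_id τ).sub_const b).const_mul l
    refine ((h1.exp.const_mul N).pow 2).congr_deriv ?_
    push_cast
    ring
  have := image_le_of_deriv_right_lt_deriv_boundary (a := b) (b := m)
    (fun τ _ => (hd τ).continuousAt.continuousWithinAt) (fun τ _ => (hd τ).hasDerivWithinAt)
    (by simpa using pow_le_pow_left₀ (norm_nonneg _) h0 2) hB ?_ (right_mem_Icc.2 hbm)
  · exact (pow_le_pow_iff_left₀ (norm_nonneg _) (by positivity) two_ne_zero).1 this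
  · intro τ hτ he
    have hτ' : τ ∈ Icc b m := Ico_subset_Icc_self hτ
    have hyn : ‖y τ‖ = N * Real.exp (l * (τ - b)) :=
      (pow_left_inj₀ (norm_nonneg _) (by positivity) two_ne_zero).1 he
    set e := Real.exp (l * (τ - b)) with hedef
    have hepos : 0 < e := Real.exp_pos _
    have h1 : inner ℝ (y τ) (s τ) ≤ N * e * (D * e) := by
      refine (real_inner_le_norm _ _).trans ?_
      rw [hyn]
      exact mul_le_mul_of_nonneg_left (hs τ hτ') (by positivity)
    have h2 : k τ * (N * e) ^ 2 ≤ C * (N * e) ^ 2 :=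
      mul_le_mul_of_nonneg_right ((le_abs_self _).trans (hk τ hτ')) (by positivity)
    have h3 : (C * N + D) * (N * e ^ 2) < l * N * (N * e ^ 2) :=
      mul_lt_mul_of_pos_right hl (by positivity)
    rw [hyn]
    nlinarith [h1, h2, h3]

/-- Growth of a solution of the linear equation `y' = (k + iω) y + s`. The imaginary part `ω` of
the coefficient does not enter the bound, because it does not change `‖y‖`. -/
lemma norm_le_exp_of_linear_ode {y : ℝ → ℂ} {k ω : ℝ → ℝ} {s : ℝ → ℂ} {b m C D N l : ℝ}
    (hy : ∀ τ, HasDerivAt y (((k τ : ℂ) + ω τ * Complex.I) * y τ + s τ) τ)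
    (hk : ∀ τ ∈ uIcc b m, |k τ| ≤ C) (hs : ∀ τ ∈ uIcc b m, ‖s τ‖ ≤ D * Real.exp (l * |b - τ|))
    (hN : 0 < N) (h0 : ‖y b‖ ≤ N) (hl : C * N + D < l * N) :
    ‖y m‖ ≤ N * Real.exp (l * |b - m|) := by
  rcases le_total b m with hbm | hbm
  · rw [uIcc_of_le hbm] at hk hs
    rw [abs_sub_comm, abs_of_nonneg (by linarith)]
    refine norm_le_exp_of_linear_ode_forward hbm hy hk (fun τ hτ => ?_) hN h0 hl
    have := hs τ hτ
    rwa [abs_sub_comm, abs_of_nonneg (by linarith [hτ.1])] at this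
  · rw [uIcc_of_ge hbm] at hk hs
    rw [abs_of_nonneg (by linarith)]
    have hmem : ∀ τ ∈ Icc (-b) (-m), -τ ∈ Icc m b := fun τ hτ =>
      ⟨by linarith [hτ.2], by linarith [hτ.1]⟩
    have := norm_le_exp_of_linear_ode_forward (y := fun τ => y (-τ)) (k := fun τ => -k (-τ))
      (ω := fun τ => -ω (-τ)) (s := fun τ => -s (-τ)) (b := -b) (m := -m) (C := C) (D := D)
      (N := N) (l := l) (by linarith) ?_ ?_ ?_ hN (by simpa using h0) hl
    · simpa [sub_eq_add_neg, add_comm] using this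
    · intro τ
      refine ((hy (-τ)).scomp τ (hasDerivAt_neg τ)).congr_deriv ?_
      simp only [neg_smul, one_smul]
      push_cast
      ring
    · intro τ hτ
      rw [abs_neg]
      exact hk _ (hmem τ hτ)
    · intro τ hτ
      have h1 := hs _ (hmem τ hτ)
      rw [abs_of_nonneg (by linarith [hτ.1])] at h1
      rw [norm_neg]
      refine h1.trans_eq ?_
      ring_nf

/-- The exponent `∫ (κ + iσ Im Z)` along the second variable, from the diagonal. -/
def phase (κ : ℝ → ℝ → ℝ) (σ : ℝ) (Z : ℝ → ℝ → ℂ) (p m : ℝ) : ℂ :=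
  ∫ s in p..m, ((κ p s : ℂ) + (σ * (Z p s).im : ℝ) * Complex.I)

/-- The solution `Y` of the linear transport equation `∂ₘ Y = (κ + iσ Im Z) Y + ν Z` with value
`Y₀ p` at the diagonal point `(p, p)`, by variation of constants. -/
def transport (κ ν : ℝ → ℝ → ℝ) (σ : ℝ) (Y₀ : ℝ → ℂ) (Z : ℝ → ℝ → ℂ) (p m : ℝ) : ℂ :=
  Complex.exp (phase κ σ Z p m) *
    (Y₀ p + ∫ s in p..m, Complex.exp (-phase κ σ Z p s) * (ν p s * Z p s))

section Transport

variable {κ ν : ℝ → ℝ → ℝ} {σ : ℝ} {Y₀ : ℝ → ℂ} {Z : ℝ → ℝ → ℂ}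

lemma continuous_integral_diag {h : ℝ → ℝ → ℂ} (hc : Continuous (Function.uncurry h)) :
    Continuous (Function.uncurry fun p m => ∫ s in p..m, h p s) := by
  have h1 : Continuous fun v : ℝ × ℝ => ∫ s in (0 : ℝ)..v.2, h v.1 s :=
    continuous_parametric_primitive_of_continuous (μ := volume) hc
  refine (h1.sub (h1.comp (continuous_fst.prodMk continuous_fst))).congr fun v => ?_
  have := hc.comp (Continuous.prodMk_right v.1)
  exact integral_interval_sub_left (this.intervalIntegrable _ _) (this.intervalIntegrable _ _)

lemma continuous_phase_integrand (hκ : Continuous (Function.uncurry κ))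
    (hZ : Continuous (Function.uncurry Z)) :
    Continuous (Function.uncurry fun p s =>
      ((κ p s : ℂ) + (σ * (Z p s).im : ℝ) * Complex.I)) :=
  (Complex.continuous_ofReal.comp hκ).add ((Complex.continuous_ofReal.comp
    (continuous_const.mul (Complex.continuous_im.comp hZ))).mul continuous_const)

lemma continuous_phase (hκ : Continuous (Function.uncurry κ))
    (hZ : Continuous (Function.uncurry Z)) : Continuous (Function.uncurry (phase κ σ Z)) :=
  continuous_integral_diag (continuous_phase_integrand hκ hZ)

lemma continuous_transport_integrand (hκ : Continuous (Function.uncurry κ))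
    (hν : Continuous (Function.uncurry ν)) (hZ : Continuous (Function.uncurry Z)) :
    Continuous (Function.uncurry fun p s =>
      Complex.exp (-phase κ σ Z p s) * (ν p s * Z p s)) :=
  (Complex.continuous_exp.comp (continuous_phase hκ hZ).neg).mul
    ((Complex.continuous_ofReal.comp hν).mul hZ)

lemma continuous_transport (hκ : Continuous (Function.uncurry κ))
    (hν : Continuous (Function.uncurry ν)) (hY : Continuous Y₀)
    (hZ : Continuous (Function.uncurry Z)) :
    Continuous (Function.uncurry (transport κ ν σ Y₀ Z)) :=
  (Complex.continuous_exp.comp (continuous_phase hκ hZ)).mul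
    ((hY.comp continuous_fst).add
      (continuous_integral_diag (continuous_transport_integrand hκ hν hZ)))

@[simp] lemma transport_diag (p : ℝ) : transport κ ν σ Y₀ Z p p = Y₀ p := by
  simp [transport, phase]

lemma hasDerivAt_transport (hκ : Continuous (Function.uncurry κ))
    (hν : Continuous (Function.uncurry ν)) (hZ : Continuous (Function.uncurry Z)) (p m : ℝ) :
    HasDerivAt (fun m => transport κ ν σ Y₀ Z p m)
      (((κ p m : ℂ) + (σ * (Z p m).im : ℝ) * Complex.I) * transport κ ν σ Y₀ Z p m
        + ν p m * Z p m) m := by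
  have h1 := hasDerivAt_integral_snd (continuous_phase_integrand (σ := σ) hκ hZ) p p m
  have h2 := hasDerivAt_integral_snd (continuous_transport_integrand (σ := σ) hκ hν hZ) p p m
  refine (h1.cexp.mul (h2.const_add (Y₀ p))).congr_deriv ?_
  have h3 : Complex.exp (phase κ σ Z p m) * Complex.exp (-phase κ σ Z p m) = 1 := by
    rw [← Complex.exp_add]; simp
  change Complex.exp (phase κ σ Z p m) * _ * _ + Complex.exp (phase κ σ Z p m) * _ = _
  simp only [transport]
  linear_combination (ν p m * Z p m) * h3

/-- If `Z` is merely differentiable in the first variable, the explicit formula makes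
`transport κ ν σ Y₀ Z` a `C¹` function. -/
lemma contDiff_transport {Z' : ℝ → ℝ → ℂ} (hκ : ContDiff ℝ 1 (Function.uncurry κ))
    (hν : ContDiff ℝ 1 (Function.uncurry ν)) (hY : ContDiff ℝ 1 Y₀)
    (hZ : Continuous (Function.uncurry Z))
    (hd : ∀ p s, HasDerivAt (fun p => Z p s) (Z' p s) p)
    (hZ' : Continuous (Function.uncurry Z')) :
    ContDiff ℝ 1 (Function.uncurry (transport κ ν σ Y₀ Z)) := by
  obtain ⟨κ₁, κ₂, pκ⟩ := exists_hasPartials hκ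
  obtain ⟨ν₁, ν₂, pν⟩ := exists_hasPartials hν
  have hΦ := hasPartials_integral
    (h' := fun p s => ((κ₁ p s : ℂ) + (σ * (Z' p s).im : ℝ) * Complex.I))
    (continuous_phase_integrand (σ := σ) hκ.continuous hZ)
    (fun p s => by
      have him : HasDerivAt (fun p => (Z p s).im) (Z' p s).im p :=
        Complex.imCLM.hasFDerivAt.comp_hasDerivAt p (hd p s)
      exact (pκ.fst p s).ofReal_comp.add ((him.const_mul σ).ofReal_comp.mul_const _))
    (continuous_phase_integrand (σ := σ) pκ.cont_fst hZ')
  have hΦ₁ := hΦ.cont_fst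
  set Φ₁ : ℝ → ℝ → ℂ := fun p m => (∫ s in p..m, ((κ₁ p s : ℂ) +
    (σ * (Z' p s).im : ℝ) * Complex.I)) - ((κ p p : ℂ) + (σ * (Z p p).im : ℝ) * Complex.I)
  have hI := hasPartials_integral
    (h' := fun p s => Complex.exp (-phase κ σ Z p s) * -Φ₁ p s * (ν p s * Z p s)
      + Complex.exp (-phase κ σ Z p s) * (ν₁ p s * Z p s + ν p s * Z' p s))
    (continuous_transport_integrand (σ := σ) hκ.continuous hν.continuous hZ)
    (fun p s => ((hΦ.fst p s).neg.cexp).mul (((pν.fst p s).ofReal_comp).mul (hd p s)))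
    (by
      have e := Complex.continuous_exp.comp (continuous_phase (σ := σ) hκ.continuous hZ).neg
      have n := Complex.continuous_ofReal.comp hν.continuous
      have n₁ := Complex.continuous_ofReal.comp pν.cont_fst
      exact ((e.mul hΦ₁.neg).mul (n.mul hZ)).add (e.mul ((n₁.mul hZ).add (n.mul hZ'))))
  exact (Complex.contDiff_exp.comp hΦ.contDiff_one).mul
    ((hY.comp contDiff_fst).add hI.contDiff_one)

/-- Along the segment from `(p, p)` to `(p, m)`, transport does not leave a region
`‖Z‖ ≤ K exp (l |p - m|)` with `l` large. -/
lemma norm_transport_le (hκ : Continuous (Function.uncurry κ))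
    (hν : Continuous (Function.uncurry ν)) (hZ : Continuous (Function.uncurry Z))
    {p m C K l : ℝ} (hCκ : ∀ s ∈ uIcc p m, |κ p s| ≤ C) (hCν : ∀ s ∈ uIcc p m, |ν p s| ≤ C)
    (hZb : ∀ s ∈ uIcc p m, ‖Z p s‖ ≤ K * Real.exp (l * |p - s|)) (hK : 0 < K)
    (hY : ‖Y₀ p‖ ≤ K) (hl : 2 * C < l) :
    ‖transport κ ν σ Y₀ Z p m‖ ≤ K * Real.exp (l * |p - m|) := by
  refine norm_le_exp_of_linear_ode (hasDerivAt_transport hκ hν hZ p) hCκ (D := C * K)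
    (fun s hs => ?_) hK (by simpa using hY) (by nlinarith)
  rw [norm_mul, Complex.norm_real, mul_assoc]
  exact mul_le_mul (hCν s hs) (hZb s hs) (norm_nonneg _) ((abs_nonneg _).trans (hCν s hs))

/-- Transport halves distances in the norm weighted by `exp (-l |p - m|)` with `l` large. -/
lemma norm_transport_sub_le {Z' : ℝ → ℝ → ℂ} (hκ : Continuous (Function.uncurry κ))
    (hν : Continuous (Function.uncurry ν)) (hZ : Continuous (Function.uncurry Z))
    (hZ' : Continuous (Function.uncurry Z')) (hσ : |σ| ≤ 1)
    {p m C M ε l : ℝ} (hCκ : ∀ s ∈ uIcc p m, |κ p s| ≤ C) (hCν : ∀ s ∈ uIcc p m, |ν p s| ≤ C)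
    (hM : ∀ s ∈ uIcc p m, ‖transport κ ν σ Y₀ Z' p s‖ ≤ M)
    (hZZ : ∀ s ∈ uIcc p m, ‖Z p s - Z' p s‖ ≤ ε * Real.exp (l * |p - s|)) (hε : 0 < ε)
    (hl : 3 * C + 2 * M < l) :
    ‖transport κ ν σ Y₀ Z p m - transport κ ν σ Y₀ Z' p m‖ ≤
      ε / 2 * Real.exp (l * |p - m|) := by
  refine norm_le_exp_of_linear_ode (k := fun s => κ p s) (ω := fun s => σ * (Z p s).im)
    (y := fun s => transport κ ν σ Y₀ Z p s - transport κ ν σ Y₀ Z' p s)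
    (s := fun s => (σ * (Z p s - Z' p s).im : ℝ) * Complex.I * transport κ ν σ Y₀ Z' p s
      + ν p s * (Z p s - Z' p s)) (D := (M + C) * ε) (fun s => ?_) hCκ
    (fun s hs => ?_) (by positivity) (by simp; positivity) (by nlinarith)
  · refine ((hasDerivAt_transport hκ hν hZ p s).sub
      (hasDerivAt_transport hκ hν hZ' p s)).congr_deriv ?_
    rw [Complex.sub_im]
    push_cast
    ring
  · refine (norm_add_le _ _).trans ?_
    rw [norm_mul, norm_mul, norm_mul, Complex.norm_real, Complex.norm_real, Complex.norm_I, mul_one]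
    have h1 : ‖σ * (Z p s - Z' p s).im‖ ≤ ε * Real.exp (l * |p - s|) := by
      rw [norm_mul]
      calc ‖σ‖ * ‖(Z p s - Z' p s).im‖ ≤ 1 * ‖Z p s - Z' p s‖ :=
            mul_le_mul hσ (Complex.abs_im_le_norm _) (norm_nonneg _) zero_le_one
        _ ≤ _ := by rw [one_mul]; exact hZZ s hs
    have h2 := mul_le_mul h1 (hM s hs) (norm_nonneg _) (by positivity)
    have h3 := mul_le_mul (hCν s hs) (hZZ s hs) (norm_nonneg _)
      ((abs_nonneg _).trans (hCν s hs))
    refine (add_le_add h2 h3).trans_eq ?_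
    ring

end Transport

/-- The square `|p|, |m| ≤ L`, which contains with a point the two null segments that join it to
the diagonal. -/
def InSquare (L p m : ℝ) : Prop := |p| ≤ L ∧ |m| ≤ L

lemma InSquare.swap {L p m : ℝ} (h : InSquare L p m) : InSquare L m p := ⟨h.2, h.1⟩

lemma InSquare.of_mem_uIcc {L p m s : ℝ} (h : InSquare L p m) (hs : s ∈ uIcc p m) :
    InSquare L p s := by
  have h1 := abs_le.1 h.1
  have h2 := abs_le.1 h.2
  rcases mem_uIcc.1 hs with h3 | h3
  · exact ⟨h.1, abs_le.2 ⟨by linarith, by linarith⟩⟩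
  · exact ⟨h.1, abs_le.2 ⟨by linarith, by linarith⟩⟩

lemma exists_bound_inSquare {E : Type*} [NormedAddCommGroup E] {f : ℝ → ℝ → E}
    (hf : Continuous (Function.uncurry f)) (L : ℝ) : ∃ C, ∀ p m, InSquare L p m → ‖f p m‖ ≤ C := by
  obtain ⟨C, hC⟩ := ((isCompact_Icc (a := -L) (b := L)).prod
    (isCompact_Icc (a := -L) (b := L))).exists_bound_of_continuousOn hf.continuousOn
  exact ⟨C, fun p m h => hC (p, m) ⟨abs_le.1 h.1, abs_le.1 h.2⟩⟩

/-- The data of the semilinear system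
`∂ₘ A = (κ - i Im B) A + ν B`, `∂ₚ B = (κ' + i Im A) B + ν' A`, with `A = A₀` and `B = B₀` on the
diagonal `p = m`. -/
structure NullSystem where
  κ : ℝ → ℝ → ℝ
  ν : ℝ → ℝ → ℝ
  κ' : ℝ → ℝ → ℝ
  ν' : ℝ → ℝ → ℝ
  A₀ : ℝ → ℂ
  B₀ : ℝ → ℂ

namespace NullSystem

variable (S : NullSystem)

/-- The solution `A` of the first equation for a given `B`. -/
def solveA (B : ℝ → ℝ → ℂ) : ℝ → ℝ → ℂ := transport S.κ S.ν (-1) S.A₀ B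

/-- The solution `B` of the second equation for a given `A`. -/
def solveB (A : ℝ → ℝ → ℂ) : ℝ → ℝ → ℂ := fun p m =>
  transport (fun m p => S.κ' p m) (fun m p => S.ν' p m) 1 S.B₀ (fun m p => A p m) m p

/-- One step of the iteration for `B`. -/
def step (B : ℝ → ℝ → ℂ) : ℝ → ℝ → ℂ := S.solveB (S.solveA B)

/-- The coefficients and the data are continuous. -/
structure Cont : Prop where
  κ : Continuous (Function.uncurry S.κ)
  ν : Continuous (Function.uncurry S.ν)
  κ' : Continuous (Function.uncurry S.κ')
  ν' : Continuous (Function.uncurry S.ν')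
  A₀ : Continuous S.A₀
  B₀ : Continuous S.B₀

variable {S}

lemma Cont.solveA (h : S.Cont) {B : ℝ → ℝ → ℂ} (hB : Continuous (Function.uncurry B)) :
    Continuous (Function.uncurry (S.solveA B)) :=
  continuous_transport h.κ h.ν h.A₀ hB

lemma Cont.solveB (h : S.Cont) {A : ℝ → ℝ → ℂ} (hA : Continuous (Function.uncurry A)) :
    Continuous (Function.uncurry (S.solveB A)) :=
  (continuous_transport (κ := fun m p => S.κ' p m) (ν := fun m p => S.ν' p m)
    (Z := fun m p => A p m) (σ := 1) (h.κ'.comp continuous_swap)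
    (h.ν'.comp continuous_swap) h.B₀ (hA.comp continuous_swap)).comp continuous_swap

lemma Cont.step (h : S.Cont) {B : ℝ → ℝ → ℂ} (hB : Continuous (Function.uncurry B)) :
    Continuous (Function.uncurry (S.step B)) := h.solveB (h.solveA hB)

variable (S) in
/-- `C` bounds the coefficients on the square of size `L`, and `K > 0` bounds the data. -/
structure Bounds (L C K : ℝ) : Prop where
  κ : ∀ p m, InSquare L p m → |S.κ p m| ≤ C
  ν : ∀ p m, InSquare L p m → |S.ν p m| ≤ C
  κ' : ∀ p m, InSquare L p m → |S.κ' p m| ≤ C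
  ν' : ∀ p m, InSquare L p m → |S.ν' p m| ≤ C
  A₀ : ∀ p, |p| ≤ L → ‖S.A₀ p‖ ≤ K
  B₀ : ∀ p, |p| ≤ L → ‖S.B₀ p‖ ≤ K
  K_pos : 0 < K

lemma Cont.exists_bounds (h : S.Cont) (L : ℝ) : ∃ C K, S.Bounds L C K := by
  obtain ⟨C₁, h₁⟩ := exists_bound_inSquare h.κ L
  obtain ⟨C₂, h₂⟩ := exists_bound_inSquare h.ν L
  obtain ⟨C₃, h₃⟩ := exists_bound_inSquare h.κ' L
  obtain ⟨C₄, h₄⟩ := exists_bound_inSquare h.ν' L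
  obtain ⟨K₁, k₁⟩ := (isCompact_Icc (a := -L) (b := L)).exists_bound_of_continuousOn
    h.A₀.continuousOn
  obtain ⟨K₂, k₂⟩ := (isCompact_Icc (a := -L) (b := L)).exists_bound_of_continuousOn
    h.B₀.continuousOn
  have l₁ := le_max_left C₁ C₂
  have l₂ := le_max_right C₁ C₂
  have l₃ := le_max_left C₃ C₄
  have l₄ := le_max_right C₃ C₄
  have l₅ := le_max_left (max C₁ C₂) (max C₃ C₄)
  have l₆ := le_max_right (max C₁ C₂) (max C₃ C₄)
  refine ⟨max (max C₁ C₂) (max C₃ C₄), max 1 (max K₁ K₂), ?_, ?_, ?_, ?_, ?_, ?_, ?_⟩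
  · exact fun p m hp => (h₁ p m hp).trans (by linarith)
  · exact fun p m hp => (h₂ p m hp).trans (by linarith)
  · exact fun p m hp => (h₃ p m hp).trans (by linarith)
  · exact fun p m hp => (h₄ p m hp).trans (by linarith)
  · exact fun p hp => (k₁ p (abs_le.1 hp)).trans
      ((le_max_left _ _).trans (le_max_right _ _))
  · exact fun p hp => (k₂ p (abs_le.1 hp)).trans
      ((le_max_right _ _).trans (le_max_right _ _))
  · exact lt_of_lt_of_le one_pos (le_max_left _ _)

/-- `‖Z‖ ≤ N exp (l |p - m|)` on the square of size `L`. -/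
def ExpBound (L N l : ℝ) (Z : ℝ → ℝ → ℂ) : Prop :=
  ∀ p m, InSquare L p m → ‖Z p m‖ ≤ N * Real.exp (l * |p - m|)

lemma ExpBound.swap {L N l : ℝ} {Z : ℝ → ℝ → ℂ} (h : ExpBound L N l Z) :
    ExpBound L N l (fun m p => Z p m) := fun p m hp => by
  rw [abs_sub_comm]; exact h m p hp.swap

lemma ExpBound.norm_le {L N l : ℝ} {Z : ℝ → ℝ → ℂ} (h : ExpBound L N l Z) (hN : 0 < N)
    (hl : 0 ≤ l) {p m : ℝ} (hp : InSquare L p m) : ‖Z p m‖ ≤ N * Real.exp (l * (2 * L)) := by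
  refine (h p m hp).trans (mul_le_mul_of_nonneg_left (Real.exp_le_exp.2 ?_) hN.le)
  refine mul_le_mul_of_nonneg_left ((abs_sub _ _).trans ?_) hl
  linarith [hp.1, hp.2]

section Estimates

variable {L C K l : ℝ}

lemma Bounds.solveA (hb : S.Bounds L C K) (h : S.Cont) (hl : 2 * C < l) {B : ℝ → ℝ → ℂ}
    (hB : Continuous (Function.uncurry B)) (hBb : ExpBound L K l B) :
    ExpBound L K l (S.solveA B) := fun p _ hp =>
  norm_transport_le h.κ h.ν hB (fun s hs => hb.κ p s (hp.of_mem_uIcc hs))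
    (fun s hs => hb.ν p s (hp.of_mem_uIcc hs)) (fun s hs => hBb p s (hp.of_mem_uIcc hs))
    hb.K_pos (hb.A₀ p hp.1) hl

lemma Bounds.solveB (hb : S.Bounds L C K) (h : S.Cont) (hl : 2 * C < l) {A : ℝ → ℝ → ℂ}
    (hA : Continuous (Function.uncurry A)) (hAb : ExpBound L K l A) :
    ExpBound L K l (S.solveB A) := by
  refine ExpBound.swap (Z := fun m p => S.solveB A p m) fun m p hp => ?_
  exact norm_transport_le (κ := fun m p => S.κ' p m) (ν := fun m p => S.ν' p m)
    (Z := fun m p => A p m) (h.κ'.comp continuous_swap) (h.ν'.comp continuous_swap)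
    (hA.comp continuous_swap) (fun s hs => hb.κ' s m (hp.of_mem_uIcc hs).swap)
    (fun s hs => hb.ν' s m (hp.of_mem_uIcc hs).swap)
    (fun s hs => hAb.swap m s (hp.of_mem_uIcc hs)) hb.K_pos (hb.B₀ m hp.1) hl

lemma Bounds.solveA_sub (hb : S.Bounds L C K) (h : S.Cont) {M ε : ℝ} (hl : 3 * C + 2 * M < l)
    {B B' : ℝ → ℝ → ℂ} (hB : Continuous (Function.uncurry B))
    (hB' : Continuous (Function.uncurry B')) (hM : ∀ p m, InSquare L p m → ‖S.solveA B' p m‖ ≤ M)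
    (hε : 0 < ε) (hBB : ExpBound L ε l (B - B')) :
    ExpBound L (ε / 2) l (S.solveA B - S.solveA B') := fun p m hp =>
  norm_transport_sub_le h.κ h.ν hB hB' (by simp) (fun s hs => hb.κ p s (hp.of_mem_uIcc hs))
    (fun s hs => hb.ν p s (hp.of_mem_uIcc hs)) (fun s hs => hM p s (hp.of_mem_uIcc hs))
    (fun s hs => hBB p s (hp.of_mem_uIcc hs)) hε hl

lemma Bounds.solveB_sub (hb : S.Bounds L C K) (h : S.Cont) {M ε : ℝ} (hl : 3 * C + 2 * M < l)
    {A A' : ℝ → ℝ → ℂ} (hA : Continuous (Function.uncurry A))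
    (hA' : Continuous (Function.uncurry A')) (hM : ∀ p m, InSquare L p m → ‖S.solveB A' p m‖ ≤ M)
    (hε : 0 < ε) (hAA : ExpBound L ε l (A - A')) :
    ExpBound L (ε / 2) l (S.solveB A - S.solveB A') := by
  refine ExpBound.swap (Z := fun m p => (S.solveB A - S.solveB A') p m) fun m p hp => ?_
  exact norm_transport_sub_le (κ := fun m p => S.κ' p m) (ν := fun m p => S.ν' p m)
    (Z := fun m p => A p m) (Z' := fun m p => A' p m)
    (h.κ'.comp continuous_swap) (h.ν'.comp continuous_swap)
    (hA.comp continuous_swap) (hA'.comp continuous_swap) (by simp)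
    (fun s hs => hb.κ' s m (hp.of_mem_uIcc hs).swap)
    (fun s hs => hb.ν' s m (hp.of_mem_uIcc hs).swap)
    (fun s hs => hM s m (hp.of_mem_uIcc hs).swap)
    (fun s hs => hAA.swap m s (hp.of_mem_uIcc hs)) hε hl

/-- On a square, one step of the iteration preserves an exponential bound, and it contracts a
weighted sup norm on the functions that satisfy this bound. -/
lemma Cont.exists_contraction (h : S.Cont) {L : ℝ} (hL : 0 ≤ L) :
    ∃ K l₀ l : ℝ, 0 < K ∧ 0 ≤ l₀ ∧ 0 ≤ l ∧
      (∀ B, Continuous (Function.uncurry B) → ExpBound L K l₀ B → ExpBound L K l₀ (S.step B)) ∧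
      ∀ B B' ε, Continuous (Function.uncurry B) → Continuous (Function.uncurry B') →
        ExpBound L K l₀ B' → 0 < ε → ExpBound L ε l (B - B') →
        ExpBound L (ε / 2) l (S.step B - S.step B') := by
  obtain ⟨C, K, hb⟩ := h.exists_bounds L
  have hC : 0 ≤ C := (abs_nonneg _).trans (hb.κ 0 0 ⟨by simpa, by simpa⟩)
  have hK := hb.K_pos
  set l₀ := 2 * C + 1 with hl₀
  set M := K * Real.exp (l₀ * (2 * L)) with hM
  have hMpos : 0 < M := by positivity
  refine ⟨K, l₀, 3 * C + 2 * M + 1, hK, by positivity, by positivity, ?_, ?_⟩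
  · exact fun B hB hBb => hb.solveB h (by linarith) (h.solveA hB)
      (hb.solveA h (by linarith) hB hBb)
  · intro B B' ε hB hB' hBb hε hBB
    have hA' := hb.solveA h (by linarith) hB' hBb
    have hS' := hb.solveB h (by linarith) (h.solveA hB') hA'
    have h1 := hb.solveA_sub h (M := M) (by linarith) hB hB'
      (fun p m hp => hA'.norm_le hK (by positivity) hp) hε hBB
    have h2 := hb.solveB_sub h (M := M) (by linarith) (h.solveA hB) (h.solveA hB')
      (fun p m hp => hS'.norm_le hK (by positivity) hp) (by positivity) h1
    refine fun p m hp => (h2 p m hp).trans ?_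
    exact mul_le_mul_of_nonneg_right (by linarith) (Real.exp_pos _).le

end Estimates

/-- The iterates of `step` converge locally uniformly, to a fixed point. -/
theorem Cont.exists_fixedPoint (h : S.Cont) :
    ∃ B, Continuous (Function.uncurry B) ∧ S.step B = B := by
  set Z : ℕ → ℝ → ℝ → ℂ := fun n => S.step^[n] 0 with hZ
  have hsucc : ∀ n, Z (n + 1) = S.step (Z n) := fun n => Function.iterate_succ_apply' _ _ _
  have hcont : ∀ n, Continuous (Function.uncurry (Z n)) := by
    intro n
    induction n with
    | zero => exact continuous_const
    | succ n ih => rw [hsucc]; exact h.step ih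
  have hbound : ∀ L K l₀ : ℝ, 0 < K → (∀ B, Continuous (Function.uncurry B) →
      ExpBound L K l₀ B → ExpBound L K l₀ (S.step B)) → ∀ n, ExpBound L K l₀ (Z n) := by
    intro L K l₀ hK h1 n
    induction n with
    | zero =>
      intro p m _
      simp only [hZ, Function.iterate_zero, id, Pi.zero_apply, norm_zero]
      positivity
    | succ n ih => rw [hsucc]; exact h1 _ (hcont n) ih
  -- On each square the distances between consecutive iterates decay geometrically.
  have key : ∀ L : ℝ, 0 ≤ L → ∃ D : ℝ,
      ∀ n p m, InSquare L p m → dist (Z n p m) (Z (n + 1) p m) ≤ D / 2 / 2 ^ n := by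
    intro L hL
    obtain ⟨K, l₀, l, hK, hl₀, hl, h1, h2⟩ := h.exists_contraction hL
    have hb := hbound L K l₀ hK h1
    set M := K * Real.exp (l₀ * (2 * L)) with hM
    have hMpos : 0 < M := by positivity
    have hd : ∀ n : ℕ, ExpBound L (2 * M / 2 ^ n) l (Z (n + 1) - Z n) := by
      intro n
      induction n with
      | zero =>
        intro p m hp
        refine (norm_sub_le _ _).trans ?_
        have e1 := (hb 1).norm_le hK hl₀ hp
        have e2 := (hb 0).norm_le hK hl₀ hp
        have e3 : 1 ≤ Real.exp (l * |p - m|) := Real.one_le_exp (by positivity)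
        simp only [zero_add, pow_zero, div_one] at *
        nlinarith
      | succ n ih =>
        rw [hsucc (n + 1), hsucc n]
        have := h2 _ _ _ (hcont (n + 1)) (hcont n) (hb n) (by positivity) ih
        rw [hsucc n] at this
        convert this using 1
        rw [pow_succ]; field_simp
    refine ⟨2 * (2 * M * Real.exp (l * (2 * L))), fun n p m hp => ?_⟩
    rw [dist_comm, dist_eq_norm]
    refine ((hd n).norm_le (by positivity) hl hp).trans_eq ?_
    field_simp
  have hsq : ∀ p m : ℝ, InSquare (max |p| |m|) p m := fun p m =>
    ⟨le_max_left _ _, le_max_right _ _⟩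
  have hlim : ∀ p m, ∃ z, Tendsto (fun n => Z n p m) atTop (𝓝 z) := by
    intro p m
    obtain ⟨D, hD⟩ := key (max |p| |m|) (le_max_of_le_left (abs_nonneg p))
    exact cauchySeq_tendsto_of_complete
      (cauchySeq_of_le_geometric_two fun n => hD n p m (hsq p m))
  choose B hB using hlim
  have hunif : ∀ L : ℝ, 0 ≤ L → ∃ D : ℝ, 0 < D ∧ ∀ n p m, InSquare L p m →
      dist (Z n p m) (B p m) ≤ D / 2 ^ n := by
    intro L hL
    obtain ⟨D, hD⟩ := key L hL
    refine ⟨max D 1, lt_of_lt_of_le one_pos (le_max_right _ _), fun n p m hp => ?_⟩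
    refine (dist_le_of_le_geometric_two_of_tendsto (fun n => hD n p m hp) (hB p m) n).trans ?_
    gcongr
    exact le_max_left _ _
  have hBc : Continuous (Function.uncurry B) := by
    refine TendstoLocallyUniformly.continuous (F := fun n => Function.uncurry (Z n)) (p := atTop)
      ?_ (Frequently.of_forall hcont)
    rw [Metric.tendstoLocallyUniformly_iff]
    rintro ε hε ⟨p, m⟩
    set L := max |p| |m| + 1
    obtain ⟨D, hD, hDb⟩ := hunif L (by positivity)
    refine ⟨Metric.ball (p, m) 1, Metric.ball_mem_nhds _ one_pos, ?_⟩
    have ht : Tendsto (fun n : ℕ => D / 2 ^ n) atTop (𝓝 0) :=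
      tendsto_const_nhds.div_atTop (tendsto_pow_atTop_atTop_of_one_lt one_lt_two)
    filter_upwards [ht.eventually (gt_mem_nhds hε)] with n hn
    rintro ⟨p', m'⟩ hp'
    rw [Metric.mem_ball, Prod.dist_eq, max_lt_iff, Real.dist_eq, Real.dist_eq] at hp'
    rw [dist_comm]
    refine (hDb n p' m' ⟨?_, ?_⟩).trans_lt hn
    · have := abs_sub_abs_le_abs_sub p' p
      have := le_max_left |p| |m|
      simp only [L]
      linarith [hp'.1]
    · have := abs_sub_abs_le_abs_sub m' m
      have := le_max_right |p| |m|
      simp only [L]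
      linarith [hp'.2]
  refine ⟨B, hBc, ?_⟩
  funext p m
  set L := max |p| |m| with hLdef
  have hL : 0 ≤ L := le_max_of_le_left (abs_nonneg p)
  obtain ⟨K, l₀, l, hK, hl₀, hl, h1, h2⟩ := h.exists_contraction hL
  obtain ⟨D, hD, hDb⟩ := hunif L hL
  have hb := hbound L K l₀ hK h1
  have hBb : ExpBound L K l₀ B := fun p m hp =>
    le_of_tendsto (hB p m).norm (Eventually.of_forall fun n => hb n p m hp)
  have hstep : Tendsto (fun n => Z (n + 1) p m) atTop (𝓝 (S.step B p m)) := by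
    rw [tendsto_iff_norm_sub_tendsto_zero]
    have ht : Tendsto (fun n : ℕ => D / 2 ^ n * Real.exp (l * (2 * L))) atTop (𝓝 0) := by
      have h0 : Tendsto (fun n : ℕ => D / 2 ^ n) atTop (𝓝 0) :=
        tendsto_const_nhds.div_atTop (tendsto_pow_atTop_atTop_of_one_lt one_lt_two)
      simpa using h0.mul_const (Real.exp (l * (2 * L)))
    refine squeeze_zero (fun n => norm_nonneg _) (fun n => ?_) ht
    rw [hsucc]
    have := h2 (Z n) B (D / 2 ^ n) (hcont n) hBc hBb (by positivity) (fun p m hp => ?_)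
    · refine (this.norm_le (by positivity) hl (hsq p m)).trans ?_
      exact mul_le_mul_of_nonneg_right (half_le_self (show 0 ≤ D / 2 ^ n by positivity))
        (Real.exp_pos _).le
    · rw [Pi.sub_apply, Pi.sub_apply, ← dist_eq_norm]
      refine (hDb n p m hp).trans (le_mul_of_one_le_right (by positivity) ?_)
      exact Real.one_le_exp (by positivity)
  exact tendsto_nhds_unique hstep ((hB p m).comp (tendsto_add_atTop_nat 1))

/-- Global existence of a `C¹` solution of the semilinear system. -/
theorem exists_solution (S : NullSystem) (hκ : ContDiff ℝ 1 (Function.uncurry S.κ))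
    (hν : ContDiff ℝ 1 (Function.uncurry S.ν)) (hκ' : ContDiff ℝ 1 (Function.uncurry S.κ'))
    (hν' : ContDiff ℝ 1 (Function.uncurry S.ν')) (hA₀ : ContDiff ℝ 1 S.A₀)
    (hB₀ : ContDiff ℝ 1 S.B₀) :
    ∃ A B A₁ B₂ : ℝ → ℝ → ℂ,
      HasPartials A A₁ (fun p m =>
        ((S.κ p m : ℂ) - (B p m).im * Complex.I) * A p m + S.ν p m * B p m) ∧
      HasPartials B (fun p m =>
        ((S.κ' p m : ℂ) + (A p m).im * Complex.I) * B p m + S.ν' p m * A p m) B₂ ∧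
      (∀ p, A p p = S.A₀ p) ∧ ∀ p, B p p = S.B₀ p := by
  have h : S.Cont := ⟨hκ.continuous, hν.continuous, hκ'.continuous, hν'.continuous,
    hA₀.continuous, hB₀.continuous⟩
  obtain ⟨B, hB, hfix⟩ := h.exists_fixedPoint
  set A := S.solveA B with hAdef
  have hA : Continuous (Function.uncurry A) := h.solveA hB
  have hfix' : S.solveB A = B := hfix
  have dA : ∀ p m, HasDerivAt (fun m => A p m)
      (((S.κ p m : ℂ) - (B p m).im * Complex.I) * A p m + S.ν p m * B p m) m := by
    intro p m
    refine (hasDerivAt_transport (σ := -1) h.κ h.ν hB p m).congr_deriv ?_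
    simp only [hAdef, solveA]
    push_cast
    ring
  have hs : ContDiff ℝ 1 (Prod.swap : ℝ × ℝ → ℝ × ℝ) := contDiff_snd.prodMk contDiff_fst
  have dB : ∀ p m, HasDerivAt (fun p => B p m)
      (((S.κ' p m : ℂ) + (A p m).im * Complex.I) * B p m + S.ν' p m * A p m) p := by
    intro p m
    have := hasDerivAt_transport (κ := fun m p => S.κ' p m) (ν := fun m p => S.ν' p m)
      (Y₀ := S.B₀) (Z := fun m p => A p m) (σ := 1) (h.κ'.comp continuous_swap)
      (h.ν'.comp continuous_swap) (hA.comp continuous_swap) m p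
    have e : ∀ p, transport (fun m p => S.κ' p m) (fun m p => S.ν' p m) 1 S.B₀
        (fun m p => A p m) m p = B p m := fun p => congrFun (congrFun hfix' p) m
    simp only [e, one_mul] at this
    exact this
  have cA : Continuous (Function.uncurry fun p m =>
      ((S.κ p m : ℂ) - (B p m).im * Complex.I) * A p m + S.ν p m * B p m) :=
    (((Complex.continuous_ofReal.comp h.κ).sub ((Complex.continuous_ofReal.comp
      (Complex.continuous_im.comp hB)).mul continuous_const)).mul hA).add
      ((Complex.continuous_ofReal.comp h.ν).mul hB)
  have cB : Continuous (Function.uncurry fun p m =>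
      ((S.κ' p m : ℂ) + (A p m).im * Complex.I) * B p m + S.ν' p m * A p m) :=
    (((Complex.continuous_ofReal.comp h.κ').add ((Complex.continuous_ofReal.comp
      (Complex.continuous_im.comp hA)).mul continuous_const)).mul hB).add
      ((Complex.continuous_ofReal.comp h.ν').mul hA)
  have A1 : ContDiff ℝ 1 (Function.uncurry A) := contDiff_transport hκ hν hA₀ hB dB cB
  have B1 : ContDiff ℝ 1 (Function.uncurry B) := by
    have : ContDiff ℝ 1 (Function.uncurry fun m p => S.solveB A p m) :=
      contDiff_transport (κ := fun m p => S.κ' p m) (ν := fun m p => S.ν' p m)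
        (Z := fun m p => A p m) (hκ'.comp hs) (hν'.comp hs) hB₀ (hA.comp continuous_swap)
        (fun m p => dA p m) (cA.comp continuous_swap)
    rw [hfix'] at this
    exact this.comp hs
  obtain ⟨A₁, A₂, pA⟩ := exists_hasPartials A1
  obtain ⟨B₁, B₂, pB⟩ := exists_hasPartials B1
  refine ⟨A, B, A₁, B₂, ⟨pA.fst, dA, pA.cont_fst, cA⟩, ⟨dB, pB.snd, cB, pB.cont_snd⟩,
    fun p => transport_diag p, fun p => ?_⟩
  rw [← hfix']
  exact transport_diag p

end NullSystem

/-! ### Wave equations in null coordinates -/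

lemma HasPartials.add {f f₁ f₂ g g₁ g₂ : ℝ → ℝ → ℝ} (hf : HasPartials f f₁ f₂)
    (hg : HasPartials g g₁ g₂) :
    HasPartials (fun p m => f p m + g p m) (fun p m => f₁ p m + g₁ p m)
      (fun p m => f₂ p m + g₂ p m) :=
  ⟨fun p m => (hf.fst p m).add (hg.fst p m), fun p m => (hf.snd p m).add (hg.snd p m),
    hf.cont_fst.add hg.cont_fst, hf.cont_snd.add hg.cont_snd⟩

lemma HasPartials.sub {f f₁ f₂ g g₁ g₂ : ℝ → ℝ → ℝ} (hf : HasPartials f f₁ f₂)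
    (hg : HasPartials g g₁ g₂) :
    HasPartials (fun p m => f p m - g p m) (fun p m => f₁ p m - g₁ p m)
      (fun p m => f₂ p m - g₂ p m) :=
  ⟨fun p m => (hf.fst p m).sub (hg.fst p m), fun p m => (hf.snd p m).sub (hg.snd p m),
    hf.cont_fst.sub hg.cont_fst, hf.cont_snd.sub hg.cont_snd⟩

lemma HasPartials.mul {f f₁ f₂ g g₁ g₂ : ℝ → ℝ → ℝ} (hf : HasPartials f f₁ f₂)
    (hg : HasPartials g g₁ g₂) :
    HasPartials (fun p m => f p m * g p m) (fun p m => f₁ p m * g p m + f p m * g₁ p m)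
      (fun p m => f₂ p m * g p m + f p m * g₂ p m) :=
  ⟨fun p m => (hf.fst p m).mul (hg.fst p m), fun p m => (hf.snd p m).mul (hg.snd p m),
    (hf.cont_fst.mul hg.continuous).add (hf.continuous.mul hg.cont_fst),
    (hf.cont_snd.mul hg.continuous).add (hf.continuous.mul hg.cont_snd)⟩

lemma HasPartials.const_mul {f f₁ f₂ : ℝ → ℝ → ℝ} (hf : HasPartials f f₁ f₂) (c : ℝ) :
    HasPartials (fun p m => c * f p m) (fun p m => c * f₁ p m) (fun p m => c * f₂ p m) :=
  ⟨fun p m => (hf.fst p m).const_mul c, fun p m => (hf.snd p m).const_mul c,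
    continuous_const.mul hf.cont_fst, continuous_const.mul hf.cont_snd⟩

lemma HasPartials.exp {f f₁ f₂ : ℝ → ℝ → ℝ} (hf : HasPartials f f₁ f₂) :
    HasPartials (fun p m => Real.exp (f p m)) (fun p m => Real.exp (f p m) * f₁ p m)
      (fun p m => Real.exp (f p m) * f₂ p m) :=
  ⟨fun p m => (hf.fst p m).exp, fun p m => (hf.snd p m).exp,
    (Real.continuous_exp.comp hf.continuous).mul hf.cont_fst,
    (Real.continuous_exp.comp hf.continuous).mul hf.cont_snd⟩

lemma HasPartials.re {f f₁ f₂ : ℝ → ℝ → ℂ} (hf : HasPartials f f₁ f₂) :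
    HasPartials (fun p m => (f p m).re) (fun p m => (f₁ p m).re) (fun p m => (f₂ p m).re) :=
  ⟨fun p m => Complex.reCLM.hasFDerivAt.comp_hasDerivAt p (hf.fst p m),
    fun p m => Complex.reCLM.hasFDerivAt.comp_hasDerivAt m (hf.snd p m),
    Complex.continuous_re.comp hf.cont_fst, Complex.continuous_re.comp hf.cont_snd⟩

lemma HasPartials.im {f f₁ f₂ : ℝ → ℝ → ℂ} (hf : HasPartials f f₁ f₂) :
    HasPartials (fun p m => (f p m).im) (fun p m => (f₁ p m).im) (fun p m => (f₂ p m).im) :=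
  ⟨fun p m => Complex.imCLM.hasFDerivAt.comp_hasDerivAt p (hf.fst p m),
    fun p m => Complex.imCLM.hasFDerivAt.comp_hasDerivAt m (hf.snd p m),
    Complex.continuous_im.comp hf.cont_fst, Complex.continuous_im.comp hf.cont_snd⟩

lemma HasPartials.congr {f g f₁ f₂ g₁ g₂ : ℝ → ℝ → ℝ} (hf : HasPartials f f₁ f₂)
    (h : ∀ p m, f p m = g p m) (h₁ : ∀ p m, f₁ p m = g₁ p m) (h₂ : ∀ p m, f₂ p m = g₂ p m) :
    HasPartials g g₁ g₂ := by
  have e : f = g := funext₂ h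
  have e₁ : f₁ = g₁ := funext₂ h₁
  have e₂ : f₂ = g₂ := funext₂ h₂
  rwa [← e, ← e₁, ← e₂]

/-- `F` is `C²` with first partial derivatives `P`, `Q`, and second partial derivatives `P₁`, `S`
(mixed) and `Q₂`. -/
structure HasPartials2 (F P Q P₁ S Q₂ : ℝ → ℝ → ℝ) : Prop where
  self : HasPartials F P Q
  fst : HasPartials P P₁ S
  snd : HasPartials Q S Q₂

/-- The first derivative of a `C²` function of one variable is `C¹`. -/
lemma contDiff_one_deriv {w : ℝ → ℝ} (hw : ContDiff ℝ 2 w) : ContDiff ℝ 1 (deriv w) :=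
  (contDiff_succ_iff_deriv.1 (show ContDiff ℝ (1 + 1) w by exact_mod_cast hw)).2.2

/-- The Cauchy problem for the inhomogeneous wave equation `∂ₚ ∂ₘ F = s`, with `F = F₀` and
`F_t = F₁` on the diagonal `t = 0`, where `∂ₚ + ∂ₘ = ∂_x` and `∂ₚ - ∂ₘ = ∂_t`. -/
lemma exists_wave {s : ℝ → ℝ → ℝ} (hs : ContDiff ℝ 1 (Function.uncurry s)) {F₀ F₁ : ℝ → ℝ}
    (h₀ : ContDiff ℝ 2 F₀) (h₁ : ContDiff ℝ 1 F₁) :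
    ∃ F P Q P₁ Q₂ : ℝ → ℝ → ℝ, HasPartials2 F P Q P₁ s Q₂ ∧ (∀ p, F p p = F₀ p) ∧
      (∀ p, P p p = (deriv F₀ p + F₁ p) / 2) ∧ ∀ p, Q p p = (deriv F₀ p - F₁ p) / 2 := by
  obtain ⟨s₁, s₂, ps⟩ := exists_hasPartials hs
  have hd := contDiff_one_deriv h₀
  have hI := hasPartials_integral ps.continuous ps.fst ps.cont_fst
  have hJ := (hasPartials_integral ps.swap.continuous ps.swap.fst ps.swap.cont_fst).swap
  have hP : ContDiff ℝ 1 (Function.uncurry fun p m : ℝ =>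
      (deriv F₀ p + F₁ p) / 2 + ∫ r in p..m, s p r) :=
    (((hd.add h₁).div_const 2).comp contDiff_fst).add hI.contDiff_one
  have hQ : ContDiff ℝ 1 (Function.uncurry fun p m : ℝ =>
      (deriv F₀ m - F₁ m) / 2 + ∫ r in m..p, s r m) :=
    (((hd.sub h₁).div_const 2).comp contDiff_snd).add hJ.contDiff_one
  obtain ⟨P₁, P₂, pP⟩ := exists_hasPartials hP
  obtain ⟨Q₁, Q₂, pQ⟩ := exists_hasPartials hQ
  have eP : P₂ = s := funext₂ fun p m =>
    (pP.snd p m).unique ((hI.snd p m).const_add _)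
  have eQ : Q₁ = s := funext₂ fun p m =>
    (pQ.fst p m).unique ((hJ.fst p m).const_add _)
  rw [eP] at pP
  rw [eQ] at pQ
  obtain ⟨F, pF, hF⟩ := exists_primitive (w₀ := F₀) pP pQ (fun _ _ => rfl) (fun p => by
    refine ((h₀.differentiable two_ne_zero) p).hasDerivAt.congr_deriv ?_
    simp only [integral_same]
    ring)
  exact ⟨F, _, _, P₁, Q₂, ⟨pF, pP, pQ⟩, hF, fun p => by simp, fun p => by simp⟩

/-- The Cauchy problem for the wave map equations in null coordinates, with arbitrary `C¹`
functions `r₁`, `r₂` in the place of `∂ₚ log R`, `∂ₘ log R`. In the orthonormal frame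
`A = 2 ∂ₚ W + i e^{-2W} ∂ₚ q`, `B = -2 ∂ₘ W - i e^{-2W} ∂ₘ q` of the target the equations become a
closed `NullSystem` for `(A, B)`, from which `W` and then `q` are recovered by integration. -/
theorem exists_waveMap {r₁ r₂ : ℝ → ℝ → ℝ} (hr₁ : ContDiff ℝ 1 (Function.uncurry r₁))
    (hr₂ : ContDiff ℝ 1 (Function.uncurry r₂)) {W₀ W₁ q₀ q₁ : ℝ → ℝ}
    (hW₀ : ContDiff ℝ 2 W₀) (hW₁ : ContDiff ℝ 1 W₁) (hq₀ : ContDiff ℝ 2 q₀)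
    (hq₁ : ContDiff ℝ 1 q₁) :
    ∃ W Wp Wm Wpp Wmm q qp qm qpp qmm : ℝ → ℝ → ℝ,
      HasPartials2 W Wp Wm Wpp (fun p m => -(1 / 2) * (r₁ p m * Wm p m + r₂ p m * Wp p m)
        - 1 / 2 * Real.exp (-4 * W p m) * qp p m * qm p m) Wmm ∧
      HasPartials2 q qp qm qpp (fun p m => -(1 / 2) * (r₁ p m * qm p m + r₂ p m * qp p m)
        + 2 * (qp p m * Wm p m + qm p m * Wp p m)) qmm ∧
      (∀ p, W p p = W₀ p) ∧ (∀ p, Wp p p = (deriv W₀ p + W₁ p) / 2) ∧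
      (∀ p, Wm p p = (deriv W₀ p - W₁ p) / 2) ∧
      (∀ p, q p p = q₀ p) ∧ (∀ p, qp p p = (deriv q₀ p + q₁ p) / 2) ∧
      ∀ p, qm p p = (deriv q₀ p - q₁ p) / 2 := by
  have hdW := contDiff_one_deriv hW₀
  have hdq := contDiff_one_deriv hq₀
  -- `E = ½ e^{-2W₀}`; only its product with `e^{2W₀}` matters.
  obtain ⟨E, hE, hE₁⟩ : ∃ E : ℝ → ℝ, ContDiff ℝ 1 E ∧ ∀ p, Real.exp (2 * W₀ p) * E p = 1 / 2 := by
    refine ⟨fun p => Real.exp (-2 * W₀ p) / 2,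
      (Real.contDiff_exp.comp (contDiff_const.mul (hW₀.of_le one_le_two))).div_const 2,
      fun p => ?_⟩
    rw [mul_div_assoc', ← Real.exp_add]
    simp
  have hofReal : ContDiff ℝ 1 (fun x : ℝ => (x : ℂ)) := Complex.ofRealCLM.contDiff
  obtain ⟨A, B, A₁, B₂, pA, pB, hA, hB⟩ := NullSystem.exists_solution
    { κ := fun p m => -(1 / 2) * r₂ p m
      ν := fun p m => 1 / 2 * r₁ p m
      κ' := fun p m => -(1 / 2) * r₁ p m
      ν' := fun p m => 1 / 2 * r₂ p m
      A₀ := fun p => ((W₁ p + deriv W₀ p : ℝ) : ℂ)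
        + ((E p * (q₁ p + deriv q₀ p) : ℝ) : ℂ) * Complex.I
      B₀ := fun p => ((W₁ p - deriv W₀ p : ℝ) : ℂ)
        + ((E p * (q₁ p - deriv q₀ p) : ℝ) : ℂ) * Complex.I }
    (contDiff_const.mul hr₂) (contDiff_const.mul hr₁) (contDiff_const.mul hr₁)
    (contDiff_const.mul hr₂)
    ((hofReal.comp (hW₁.add hdW)).add ((hofReal.comp (hE.mul (hq₁.add hdq))).mul contDiff_const))
    ((hofReal.comp (hW₁.sub hdW)).add ((hofReal.comp (hE.mul (hq₁.sub hdq))).mul contDiff_const))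
  -- `W` is the primitive of `½ Re A dp - ½ Re B dm`.
  obtain ⟨W, pW, hW⟩ := exists_primitive (w₀ := W₀) (pA.re.const_mul (1 / 2))
    (pB.re.const_mul (-(1 / 2)))
    (fun p m => by
      simp
      ring)
    (fun p => by
      refine ((hW₀.differentiable two_ne_zero) p).hasDerivAt.congr_deriv ?_
      simp only [hA, hB]
      simp
      ring)
  have pE := (pW.const_mul 2).exp
  -- `q` is the primitive of `e^{2W} (Im A dp - Im B dm)`.
  obtain ⟨q, pq, hq⟩ := exists_primitive (w₀ := q₀) (pE.mul pA.im)
    ((pE.mul pB.im).const_mul (-1))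
    (fun p m => by
      simp
      ring)
    (fun p => by
      refine ((hq₀.differentiable two_ne_zero) p).hasDerivAt.congr_deriv ?_
      simp only [hA, hB, hW]
      simp
      linear_combination (-2 * deriv q₀ p) * hE₁ p)
  refine ⟨W, _, _, _, _, q, _, _, _, _,
    ⟨pW, (pA.re.const_mul (1 / 2)).congr (fun _ _ => rfl) (fun _ _ => rfl) fun p m => ?_,
      (pB.re.const_mul (-(1 / 2))).congr (fun _ _ => rfl) (fun p m => ?_) fun _ _ => rfl⟩,
    ⟨pq, (pE.mul pA.im).congr (fun _ _ => rfl) (fun _ _ => rfl) fun p m => ?_,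
      ((pE.mul pB.im).const_mul (-1)).congr (fun _ _ => rfl) (fun p m => ?_) fun _ _ => rfl⟩,
    hW, fun p => ?_, fun p => ?_, hq, fun p => ?_, fun p => ?_⟩
  · have he : Real.exp (-(4 * W p m)) * Real.exp (2 * W p m) * Real.exp (2 * W p m) = 1 := by
      rw [← Real.exp_add, ← Real.exp_add, ← Real.exp_zero]; ring_nf
    simp
    linear_combination (-(1 / 2) * (A p m).im * (B p m).im) * he
  · have he : Real.exp (-(4 * W p m)) * Real.exp (2 * W p m) * Real.exp (2 * W p m) = 1 := by
      rw [← Real.exp_add, ← Real.exp_add, ← Real.exp_zero]; ring_nf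
    simp
    linear_combination (-(1 / 2) * (A p m).im * (B p m).im) * he
  · simp
    ring
  · simp
    ring
  · simp only [hA]
    simp
    ring
  · simp only [hB]
    simp
    ring
  · simp only [hA, hW]
    simp
    linear_combination (q₁ p + deriv q₀ p) * hE₁ p
  · simp only [hB, hW]
    simp
    linear_combination (-(q₁ p - deriv q₀ p)) * hE₁ p

/-! ### Construction of the solution -/

/-- The function of `(t, x)` that is given by `F` in the null coordinates `(x + t, x - t)`. -/
def ofNull (F : ℝ → ℝ → ℝ) (t x : ℝ) : ℝ := F (x + t) (x - t)

section OfNull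

variable {F P Q P₁ S Q₂ : ℝ → ℝ → ℝ}

lemma HasPartials.hasDerivAt_time (h : HasPartials F P Q) (t x : ℝ) :
    HasDerivAt (fun s => ofNull F s x) (ofNull P t x - ofNull Q t x) t := by
  have := h.comp ((hasDerivAt_id t).const_add x) ((hasDerivAt_id t).const_sub x)
  simpa [ofNull, sub_eq_add_neg] using! this

lemma HasPartials.hasDerivAt_space (h : HasPartials F P Q) (t x : ℝ) :
    HasDerivAt (fun y => ofNull F t y) (ofNull P t x + ofNull Q t x) x := by
  have := h.comp ((hasDerivAt_id x).add_const t) ((hasDerivAt_id x).sub_const t)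
  simpa [ofNull] using! this

lemma HasPartials.dt_ofNull (h : HasPartials F P Q) {t : ℝ} (ht : 0 ≤ t) (x : ℝ) :
    dt (ofNull F) t x = ofNull P t x - ofNull Q t x :=
  (h.hasDerivAt_time t x).hasDerivWithinAt.derivWithin (uniqueDiffOn_Ici 0 t ht)

lemma HasPartials.dx_ofNull (h : HasPartials F P Q) (t x : ℝ) :
    dx (ofNull F) t x = ofNull P t x + ofNull Q t x :=
  (h.hasDerivAt_space t x).deriv

lemma HasPartials2.dt_dt (h : HasPartials2 F P Q P₁ S Q₂) {t : ℝ} (ht : 0 ≤ t) (x : ℝ) :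
    dt (dt (ofNull F)) t x = ofNull P₁ t x - 2 * ofNull S t x + ofNull Q₂ t x := by
  have e : dt (dt (ofNull F)) t x = dt (ofNull fun p m => P p m - Q p m) t x :=
    derivWithin_congr (fun s hs => h.self.dt_ofNull hs x) (h.self.dt_ofNull ht x)
  rw [e, (h.fst.sub h.snd).dt_ofNull ht]
  simp only [ofNull]
  ring

lemma HasPartials2.dx_dx (h : HasPartials2 F P Q P₁ S Q₂) (t x : ℝ) :
    dx (dx (ofNull F)) t x = ofNull P₁ t x + 2 * ofNull S t x + ofNull Q₂ t x := by
  have e : dx (ofNull F) = ofNull fun p m => P p m + Q p m :=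
    funext₂ fun t x => h.self.dx_ofNull t x
  rw [e, (h.fst.add h.snd).dx_ofNull]
  simp only [ofNull]
  ring

lemma HasPartials2.dx_dt (h : HasPartials2 F P Q P₁ S Q₂) {t : ℝ} (ht : 0 ≤ t) (x : ℝ) :
    dx (dt (ofNull F)) t x = ofNull P₁ t x - ofNull Q₂ t x := by
  have e : dx (dt (ofNull F)) t x = dx (ofNull fun p m => P p m - Q p m) t x :=
    congrArg (deriv · x) (funext fun y => h.self.dt_ofNull ht y)
  rw [e, (h.fst.sub h.snd).dx_ofNull]
  simp only [ofNull]
  ring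

lemma HasPartials2.contDiff_ofNull (h : HasPartials2 F P Q P₁ S Q₂) :
    ContDiff ℝ 2 (Function.uncurry (ofNull F)) :=
  (h.self.contDiff_two h.fst.contDiff_one h.snd.contDiff_one).comp
    ((contDiff_snd.add contDiff_fst).prodMk (contDiff_snd.sub contDiff_fst))

/-- The data of `ofNull F` on `{t = 0}`, when `F` has been constructed from Cauchy data on the
diagonal. -/
lemma HasPartials2.data_ofNull (h : HasPartials2 F P Q P₁ S Q₂) {F₀ F₁ : ℝ → ℝ}
    (h₀ : ∀ p, F p p = F₀ p) (hP : ∀ p, P p p = (deriv F₀ p + F₁ p) / 2)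
    (hQ : ∀ p, Q p p = (deriv F₀ p - F₁ p) / 2) :
    ofNull F 0 = F₀ ∧ dt (ofNull F) 0 = F₁ := by
  refine ⟨funext fun x => by simp [ofNull, h₀], funext fun x => ?_⟩
  rw [h.self.dt_ofNull le_rfl]
  simp only [ofNull, add_zero, sub_zero, hP, hQ]
  ring

end OfNull

/-- The assumption on `m₀` gives pointwise lower bounds for `R` and `R_t` at `t = 0`. -/
lemma bounds_of_m0_lt {R₀ : ℝ} (hR₀ : 0 < R₀) {D : SliceData}
    (h : m0 R₀ D < ENNReal.ofReal (2 * R₀ / 3)) (x : ℝ) : R₀ / 3 ≤ D.R x ∧ 0 ≤ D.Rt x := by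
  have hcosh : 1 ≤ Real.cosh (2 * x) := Real.one_le_cosh _
  have hdt : dt (Rb R₀) 0 x = 2 * R₀ * Real.cosh (2 * x) := by
    have h1 : HasDerivAt (fun t : ℝ => R₀ * Real.exp (2 * t) * Real.cosh (2 * x))
        (R₀ * (Real.exp (2 * 0) * 2) * Real.cosh (2 * x)) 0 := by
      have h2 : HasDerivAt (fun t : ℝ => 2 * t) 2 0 := by
        simpa using (hasDerivAt_id (0 : ℝ)).const_mul 2
      exact (h2.exp.const_mul R₀).mul_const _
    have := h1.hasDerivWithinAt.derivWithin (uniqueDiffOn_Ici (0 : ℝ) 0 self_mem_Ici)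
    rw [dt]
    refine this.trans ?_
    rw [mul_zero, Real.exp_zero]
    ring
  have hlt : ∀ f : ℝ → ℝ, C0norm f < ENNReal.ofReal (2 * R₀ / 3) → |f x| ≤ 2 * R₀ / 3 := by
    intro f hf
    have := ((le_iSup (fun x => ENNReal.ofReal |f x|) x).trans_lt hf).le
    exact (ENNReal.ofReal_le_ofReal_iff (by positivity)).1 this
  have h1 := abs_le.1 (hlt _ (le_self_add.trans_lt h))
  have h2 := abs_le.1 (hlt _ (le_add_self.trans_lt h))
  simp only [hdt] at h2
  have hb : Rb R₀ 0 x = R₀ * Real.cosh (2 * x) := by simp [Rb]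
  simp only [hb] at h1
  constructor
  · nlinarith [h1.1]
  · nlinarith [h2.1]

/-- There is a positive `C²` function that is the identity on `[κ, ∞)`. -/
lemma exists_positive_extension {κ : ℝ} (hκ : 0 < κ) :
    ∃ φ : ℝ → ℝ, ContDiff ℝ 2 φ ∧ (∀ r, 0 < φ r) ∧ ∀ r, κ ≤ r → φ r = r := by
  set θ : ℝ → ℝ := fun r => Real.smoothTransition (2 * r / κ - 1) with hθ
  have hθc : ContDiff ℝ 2 θ := Real.smoothTransition.contDiff.comp
    (((contDiff_const.mul contDiff_id).div_const κ).sub contDiff_const)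
  refine ⟨fun r => θ r * r + (1 - θ r), (hθc.mul contDiff_id).add (contDiff_const.sub hθc),
    fun r => ?_, fun r hr => ?_⟩
  · have h0 : 0 ≤ θ r := Real.smoothTransition.nonneg _
    have h1 : θ r ≤ 1 := Real.smoothTransition.le_one _
    rcases le_or_gt r 0 with hr | hr
    · have : θ r = 0 := Real.smoothTransition.zero_of_nonpos (by
        have : 2 * r / κ ≤ 0 := div_nonpos_of_nonpos_of_nonneg (by linarith) hκ.le
        linarith)
      simp [this]
    · rcases h1.lt_or_eq with h | h
      · nlinarith
      · simp [h, hr]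
  · have : θ r = 1 := Real.smoothTransition.one_of_one_le (by
      have : 2 ≤ 2 * r / κ := by rw [le_div_iff₀ hκ]; linarith
      linarith)
    simp [this]

lemma eq_of_hasDerivAt_zero {f : ℝ → ℝ} {a b : ℝ} (hab : a ≤ b)
    (h : ∀ s ∈ Icc a b, HasDerivAt f 0 s) : f b = f a :=
  constant_of_has_deriv_right_zero (fun s hs => (h s hs).continuousAt.continuousWithinAt)
    (fun s hs => (h s (Ico_subset_Icc_self hs)).hasDerivWithinAt) b (right_mem_Icc.2 hab)

section Constraints

variable {R Rp Rm Rpp W Wp Wm qp qm ap : ℝ → ℝ → ℝ}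

/-- `R` times the sum of the two constraints, in null coordinates. With the roles of the null
coordinates exchanged the same expression is `R` times the difference of the constraints. -/
def nullConstraint (R Rp Rpp W Wp qp ap : ℝ → ℝ → ℝ) (p m : ℝ) : ℝ :=
  4 * ap p m * Rp p m + Rp p m ^ 2 / R p m - 2 * Rpp p m
    - R p m * (4 * Wp p m ^ 2 + Real.exp (-4 * W p m) * qp p m ^ 2)

/-- The evolution equations make `nullConstraint` constant in the variable `m`. The second
derivative `Rpp` need not be differentiated, as it depends on `p` only. -/
lemma hasDerivAt_nullConstraint {p m : ℝ}
    (dR : HasDerivAt (fun s => R p s) (Rm p m) m) (dRp : HasDerivAt (fun s => Rp p s) 0 m)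
    (dRpp : HasDerivAt (fun s => Rpp p s) 0 m)
    (dW : HasDerivAt (fun s => W p s) (Wm p m) m)
    (dWp : HasDerivAt (fun s => Wp p s) (-(1 / 2) * (Rp p m / R p m * Wm p m
      + Rm p m / R p m * Wp p m) - 1 / 2 * Real.exp (-4 * W p m) * qp p m * qm p m) m)
    (dqp : HasDerivAt (fun s => qp p s) (-(1 / 2) * (Rp p m / R p m * qm p m
      + Rm p m / R p m * qp p m) + 2 * (qp p m * Wm p m + qm p m * Wp p m)) m)
    (dap : HasDerivAt (fun s => ap p s) (Rp p m * Rm p m / (4 * R p m ^ 2)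
      - Wp p m * Wm p m - 1 / 4 * Real.exp (-4 * W p m) * qp p m * qm p m) m)
    (hR : 0 < R p m) :
    HasDerivAt (fun s => nullConstraint R Rp Rpp W Wp qp ap p s) 0 m := by
  refine HasDerivAt.congr_deriv ((((((dap.const_mul 4).mul dRp).add
    ((dRp.pow 2).div dR hR.ne')).sub (dRpp.const_mul 2)).sub
    (dR.mul (((dWp.pow 2).const_mul 4).add
      (((dW.const_mul (-4)).exp).mul (dqp.pow 2)))))) ?_
  have := hR.ne'
  simp only [Pi.pow_apply]
  field_simp
  ring

/-- The two constraints are equivalent to the vanishing of `nullConstraint` along both families of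
null lines. -/
lemma constraints_iff_null {R Rp Rm Rpp Rmm Wp Wm qp qm ap am e : ℝ} (hR : R ≠ 0) :
    ((ap - am) * ((Rp - Rm) / R) + (ap + am) * ((Rp + Rm) / R)
      + (1 / 4) * ((Rp + Rm) ^ 2 / R ^ 2 + (Rp - Rm) ^ 2 / R ^ 2)
      - (Rpp + 2 * 0 + Rmm) / R - ((Wp + Wm) ^ 2 + (Wp - Wm) ^ 2)
      - (1 / 4) * e * ((qp + qm) ^ 2 + (qp - qm) ^ 2) = 0 ∧
    (ap + am) * ((Rp - Rm) / R) + (ap - am) * ((Rp + Rm) / R)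
      - (Rpp - Rmm) / R + (Rp + Rm) * (Rp - Rm) / (2 * R ^ 2)
      - 2 * (Wp - Wm) * (Wp + Wm) - (1 / 2) * e * (qp + qm) * (qp - qm) = 0) ↔
    4 * ap * Rp + Rp ^ 2 / R - 2 * Rpp - R * (4 * Wp ^ 2 + e * qp ^ 2) = 0 ∧
      4 * am * Rm + Rm ^ 2 / R - 2 * Rmm - R * (4 * Wm ^ 2 + e * qm ^ 2) = 0 := by
  set C₁ := (ap - am) * ((Rp - Rm) / R) + (ap + am) * ((Rp + Rm) / R)
      + (1 / 4) * ((Rp + Rm) ^ 2 / R ^ 2 + (Rp - Rm) ^ 2 / R ^ 2)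
      - (Rpp + 2 * 0 + Rmm) / R - ((Wp + Wm) ^ 2 + (Wp - Wm) ^ 2)
      - (1 / 4) * e * ((qp + qm) ^ 2 + (qp - qm) ^ 2) with h₁
  set C₂ := (ap + am) * ((Rp - Rm) / R) + (ap - am) * ((Rp + Rm) / R)
      - (Rpp - Rmm) / R + (Rp + Rm) * (Rp - Rm) / (2 * R ^ 2)
      - 2 * (Wp - Wm) * (Wp + Wm) - (1 / 2) * e * (qp + qm) * (qp - qm) with h₂
  have e₁ : 4 * ap * Rp + Rp ^ 2 / R - 2 * Rpp - R * (4 * Wp ^ 2 + e * qp ^ 2)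
      = R * (C₁ + C₂) := by
    rw [h₁, h₂]; field_simp; ring
  have e₂ : 4 * am * Rm + Rm ^ 2 / R - 2 * Rmm - R * (4 * Wm ^ 2 + e * qm ^ 2)
      = R * (C₁ - C₂) := by
    rw [h₁, h₂]; field_simp; ring
  rw [e₁, e₂, mul_eq_zero, mul_eq_zero, or_iff_right hR, or_iff_right hR]
  constructor
  · rintro ⟨h, h'⟩
    constructor <;> linarith
  · rintro ⟨h, h'⟩
    constructor <;> linarith

end Constraints

/-- Global existence, positivity of `R` and propagation of the constraints. -/
theorem exists_global_solution {R₀ : ℝ} (hR₀ : 0 < R₀) {D : SliceData}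
    (hm0 : m0 R₀ D < ENNReal.ofReal (2 * R₀ / 3))
    (hR : ContDiff ℝ 2 D.R) (hRt : ContDiff ℝ 1 D.Rt)
    (hW : ContDiff ℝ 2 D.W) (hWt : ContDiff ℝ 1 D.Wt)
    (hq : ContDiff ℝ 2 D.q) (hqt : ContDiff ℝ 1 D.qt)
    (ha : ContDiff ℝ 2 D.a) (hat : ContDiff ℝ 1 D.a_t)
    (hconstr : D.Constraints) :
    ∃ u : Fields, u.IsSolutionOn (Ici 0) ∧ u.slice 0 = D ∧
      (∀ t, 0 ≤ t → ∀ x, 0 < u.R t x) ∧ ∀ t, 0 ≤ t → (u.slice t).Constraints := by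
  have hb := bounds_of_m0_lt hR₀ hm0
  obtain ⟨R, Rp, Rm, Rpp, Rmm, pR, R_diag, Rp_diag, Rm_diag⟩ :=
    exists_wave (s := fun _ _ => 0) contDiff_const hR hRt
  -- `Rp` is a function of `p` only, and `Rm` is a function of `m` only.
  have Rp_const : ∀ p m m', Rp p m = Rp p m' := fun p m m' =>
    is_const_of_deriv_eq_zero (fun s => (pR.fst.snd p s).differentiableAt)
      (fun s => (pR.fst.snd p s).deriv) m m'
  have Rm_const : ∀ p p' m, Rm p m = Rm p' m := fun p p' m =>
    is_const_of_deriv_eq_zero (f := fun s => Rm s m)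
      (fun s => (pR.snd.fst s m).differentiableAt) (fun s => (pR.snd.fst s m).deriv) p p'
  have Rpp_const : ∀ p m m', Rpp p m = Rpp p m' := fun p m m' =>
    (pR.fst.fst p m).unique
      ((pR.fst.fst p m').congr_of_eventuallyEq (Eventually.of_forall fun s => Rp_const s m m'))
  have Rmm_const : ∀ p p' m, Rmm p m = Rmm p' m := fun p p' m =>
    (pR.snd.snd p m).unique
      ((pR.snd.snd p' m).congr_of_eventuallyEq (Eventually.of_forall fun s => Rm_const p p' s))
  -- As `R_t ≥ 0` initially, `R` is bounded below by the mean of its values at the two points of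
  -- the diagonal on the same null lines.
  have R_lower : ∀ p m, m ≤ p → R₀ / 3 ≤ R p m := by
    intro p m hmp
    have hd : ∀ s, HasDerivAt (fun s => R s m - 1 / 2 * D.R s) (1 / 2 * D.Rt s) s := by
      intro s
      refine ((pR.self.fst s m).sub
        (((hR.differentiable two_ne_zero) s).hasDerivAt.const_mul (1 / 2))).congr_deriv ?_
      rw [Rp_const s m s, Rp_diag]
      ring
    have hmono : Monotone fun s => R s m - 1 / 2 * D.R s :=
      monotone_of_deriv_nonneg (fun s => (hd s).differentiableAt) fun s => by
        rw [(hd s).deriv]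
        linarith [(hb s).2]
    have := hmono hmp
    simp only [R_diag] at this
    linarith [(hb p).1, (hb m).1]
  have R_pos : ∀ p m, m ≤ p → 0 < R p m := fun p m h =>
    lt_of_lt_of_le (by positivity) (R_lower p m h)
  -- For `t < 0`, that is `p < m`, `R` may vanish. Replacing `R` by `φ(R)` in the denominators does
  -- not change the equations for `t ≥ 0`, and gives coefficients that are `C¹` on the whole plane.
  obtain ⟨φ, hφ, φ_pos, φ_id⟩ := exists_positive_extension (show 0 < R₀ / 3 by positivity)
  have hφR : ContDiff ℝ 1 (Function.uncurry fun p m => φ (R p m)) :=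
    (hφ.of_le one_le_two).comp pR.self.contDiff_one
  have hφ0 : ∀ v : ℝ × ℝ, Function.uncurry (fun p m => φ (R p m)) v ≠ 0 := fun v =>
    (φ_pos _).ne'
  obtain ⟨W, Wp, Wm, Wpp, Wmm, q, qp, qm, qpp, qmm, pW, pq, W_diag, Wp_diag, Wm_diag, q_diag,
    qp_diag, qm_diag⟩ := exists_waveMap (r₁ := fun p m => Rp p m / φ (R p m))
      (r₂ := fun p m => Rm p m / φ (R p m)) (pR.fst.contDiff_one.div hφR hφ0)
      (pR.snd.contDiff_one.div hφR hφ0) hW hWt hq hqt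
  obtain ⟨a, ap, am, app, amm, pa, a_diag, ap_diag, am_diag⟩ :=
    exists_wave (s := fun p m => Rp p m * Rm p m / (4 * φ (R p m) ^ 2) - Wp p m * Wm p m
      - 1 / 4 * Real.exp (-4 * W p m) * qp p m * qm p m)
      ((((pR.fst.contDiff_one.mul pR.snd.contDiff_one).div (contDiff_const.mul (hφR.pow 2))
        (fun v => mul_ne_zero four_ne_zero (pow_ne_zero 2 (hφ0 v)))).sub
        (pW.fst.contDiff_one.mul pW.snd.contDiff_one)).sub
        (((contDiff_const.mul ((pW.self.const_mul (-4)).exp.contDiff_one)).mul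
          pq.fst.contDiff_one).mul pq.snd.contDiff_one)) ha hat
  obtain ⟨R0, R1⟩ := pR.data_ofNull R_diag Rp_diag Rm_diag
  obtain ⟨W0, W1⟩ := pW.data_ofNull W_diag Wp_diag Wm_diag
  obtain ⟨q0, q1⟩ := pq.data_ofNull q_diag qp_diag qm_diag
  obtain ⟨a0, a1⟩ := pa.data_ofNull a_diag ap_diag am_diag
  set u : Fields := ⟨ofNull R, ofNull W, ofNull q, ofNull a⟩ with hu
  have hslice : u.slice 0 = D := by
    simp only [hu, Fields.slice, R0, R1, W0, W1, q0, q1, a0, a1]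
  have hiff : ∀ t, 0 ≤ t → ((u.slice t).Constraints ↔ ∀ x,
      nullConstraint R Rp Rpp W Wp qp ap (x + t) (x - t) = 0 ∧
      nullConstraint (fun m p => R p m) (fun m p => Rm p m) (fun m p => Rmm p m)
        (fun m p => W p m) (fun m p => Wm p m) (fun m p => qm p m) (fun m p => am p m)
        (x - t) (x + t) = 0) := by
    intro t ht
    refine forall_congr' fun x => ?_
    change (dt (ofNull a) t x * (dt (ofNull R) t x / ofNull R t x)
      + dx (ofNull a) t x * (dx (ofNull R) t x / ofNull R t x)
      + (1 / 4) * (dx (ofNull R) t x ^ 2 / ofNull R t x ^ 2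
        + dt (ofNull R) t x ^ 2 / ofNull R t x ^ 2)
      - dx (dx (ofNull R)) t x / ofNull R t x
      - (dx (ofNull W) t x ^ 2 + dt (ofNull W) t x ^ 2)
      - (1 / 4) * Real.exp (-4 * ofNull W t x)
        * (dx (ofNull q) t x ^ 2 + dt (ofNull q) t x ^ 2) = 0) ∧
      (dx (ofNull a) t x * (dt (ofNull R) t x / ofNull R t x)
        + dt (ofNull a) t x * (dx (ofNull R) t x / ofNull R t x)
        - dx (dt (ofNull R)) t x / ofNull R t x
        + dx (ofNull R) t x * dt (ofNull R) t x / (2 * ofNull R t x ^ 2)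
        - 2 * dt (ofNull W) t x * dx (ofNull W) t x
        - (1 / 2) * Real.exp (-4 * ofNull W t x) * dx (ofNull q) t x * dt (ofNull q) t x = 0)
      ↔ _
    simp only [pR.dx_dx, pR.dx_dt ht, pR.self.dt_ofNull ht, pR.self.dx_ofNull,
      pW.self.dt_ofNull ht, pW.self.dx_ofNull, pq.self.dt_ofNull ht, pq.self.dx_ofNull,
      pa.self.dt_ofNull ht, pa.self.dx_ofNull]
    exact constraints_iff_null (R_pos _ _ (by linarith)).ne'
  have hdiag := (hiff 0 le_rfl).1 (hslice ▸ hconstr)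
  simp only [add_zero, sub_zero] at hdiag
  -- The combinations of the constraints vanish on the diagonal, hence everywhere.
  have N₁ : ∀ p m, m ≤ p → nullConstraint R Rp Rpp W Wp qp ap p m = 0 := by
    intro p m hmp
    rw [← (hdiag p).1]
    refine (eq_of_hasDerivAt_zero hmp fun s hs => ?_).symm
    have hRs := R_lower p s hs.2
    refine hasDerivAt_nullConstraint (qm := qm) (pR.self.snd p s) (pR.fst.snd p s) ?_
      (pW.self.snd p s) ?_ ?_ ?_ (R_pos p s hs.2)
    · exact (hasDerivAt_const s (Rpp p 0)).congr_of_eventuallyEq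
        (Eventually.of_forall fun r => Rpp_const p r 0)
    · simpa only [φ_id _ hRs] using pW.fst.snd p s
    · simpa only [φ_id _ hRs] using pq.fst.snd p s
    · simpa only [φ_id _ hRs] using pa.fst.snd p s
  have N₂ : ∀ p m, m ≤ p → nullConstraint (fun m p => R p m) (fun m p => Rm p m)
      (fun m p => Rmm p m) (fun m p => W p m) (fun m p => Wm p m) (fun m p => qm p m)
      (fun m p => am p m) m p = 0 := by
    intro p m hmp
    rw [← (hdiag m).2]
    refine eq_of_hasDerivAt_zero hmp fun s hs => ?_
    have hRs := R_lower s m hs.1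
    refine hasDerivAt_nullConstraint (Rm := fun m p => Rp p m) (Wm := fun m p => Wp p m)
      (qm := fun m p => qp p m) (pR.self.fst s m) (pR.snd.fst s m) ?_ (pW.self.fst s m)
      ?_ ?_ ?_ (R_pos s m hs.1)
    · exact (hasDerivAt_const s (Rmm 0 m)).congr_of_eventuallyEq
        (Eventually.of_forall fun r => Rmm_const r 0 m)
    · refine (pW.snd.fst s m).congr_deriv ?_
      rw [φ_id _ hRs]
      ring
    · refine (pq.snd.fst s m).congr_deriv ?_
      rw [φ_id _ hRs]
      ring
    · refine (pa.snd.fst s m).congr_deriv ?_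
      rw [φ_id _ hRs]
      ring
  refine ⟨u, ⟨pR.contDiff_ofNull.contDiffOn,
    pW.contDiff_ofNull.contDiffOn, pq.contDiff_ofNull.contDiffOn, pa.contDiff_ofNull.contDiffOn,
    fun t ht x => ?_, fun t ht x => ?_, fun t ht x => ?_, fun t ht x => ?_⟩, hslice,
    fun t ht x => R_pos _ _ (by linarith),
    fun t ht => (hiff t ht).2 fun x => ⟨N₁ _ _ (by linarith), N₂ _ _ (by linarith)⟩⟩
  · rw [pR.dx_dx, pR.dt_dt ht]
    simp [ofNull]
  · have hpm : x - t ≤ x + t := by linarith [mem_Ici.1 ht]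
    have h1 := (R_pos _ _ hpm).ne'
    simp only [hu, pW.dt_dt ht, pW.dx_dx, pR.self.dt_ofNull ht, pR.self.dx_ofNull,
      pW.self.dt_ofNull ht, pW.self.dx_ofNull, pq.self.dt_ofNull ht, pq.self.dx_ofNull]
    simp only [ofNull, φ_id _ (R_lower _ _ hpm)]
    field_simp
    ring
  · have hpm : x - t ≤ x + t := by linarith [mem_Ici.1 ht]
    have h1 := (R_pos _ _ hpm).ne'
    simp only [hu, pq.dt_dt ht, pq.dx_dx, pR.self.dt_ofNull ht, pR.self.dx_ofNull,
      pW.self.dt_ofNull ht, pW.self.dx_ofNull, pq.self.dt_ofNull ht, pq.self.dx_ofNull]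
    simp only [ofNull, φ_id _ (R_lower _ _ hpm)]
    field_simp
    ring
  · have hpm : x - t ≤ x + t := by linarith [mem_Ici.1 ht]
    have h1 := (R_pos _ _ hpm).ne'
    simp only [hu, pa.dt_dt ht, pa.dx_dx, pR.self.dt_ofNull ht, pR.self.dx_ofNull,
      pW.self.dt_ofNull ht, pW.self.dx_ofNull, pq.self.dt_ofNull ht, pq.self.dx_ofNull]
    simp only [ofNull, φ_id _ (R_lower _ _ hpm)]
    field_simp
    ring

/-! ### Functions on a strip -/

/-- The strip `[0, T) × ℝ`. -/
def Strip (T : ℝ) : Set (ℝ × ℝ) := Ico 0 T ×ˢ univ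

lemma mem_strip {T t x : ℝ} : (t, x) ∈ Strip T ↔ t ∈ Ico 0 T := by simp [Strip]

lemma uniqueDiffOn_strip (T : ℝ) : UniqueDiffOn ℝ (Strip T) :=
  (uniqueDiffOn_Ico 0 T).prod uniqueDiffOn_univ

lemma Ico_mem_nhdsWithin_Ici_zero {T t : ℝ} (ht : t ∈ Ico 0 T) : Ico 0 T ∈ 𝓝[Ici 0] t := by
  rw [← Ici_inter_Iio]
  exact inter_mem_nhdsWithin _ (Iio_mem_nhds ht.2)

section Strip

variable {T : ℝ} {f : ℝ → ℝ → ℝ}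

lemma hasDerivWithinAt_line {D : ℝ × ℝ →L[ℝ] ℝ} {t x c : ℝ} (ht : t ∈ Ico 0 T)
    {F : ℝ × ℝ → ℝ} (h : HasFDerivWithinAt F D (Strip T) (t, x)) :
    HasDerivWithinAt (fun s => F (s, x + c * (s - t))) (D (1, c)) (Ici 0) t := by
  have h1 : HasDerivAt (fun s => (s, x + c * (s - t))) ((1 : ℝ), c) t := by
    refine (hasDerivAt_id t).prodMk ?_
    simpa using ((((hasDerivAt_id t).sub_const t).const_mul c).const_add x)
  have h2 : HasFDerivWithinAt F D (Strip T) (t, x + c * (t - t)) := by simpa using h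
  have h3 := h2.comp_hasDerivWithinAt (s := Ico 0 T) t h1.hasDerivWithinAt
    (fun s hs => mem_strip.2 hs)
  exact h3.mono_of_mem_nhdsWithin (Ico_mem_nhdsWithin_Ici_zero ht)

lemma dt_eq_of_hasFDerivWithinAt {D : ℝ × ℝ →L[ℝ] ℝ} {t x : ℝ} (ht : t ∈ Ico 0 T)
    (h : HasFDerivWithinAt (Function.uncurry f) D (Strip T) (t, x)) : dt f t x = D (1, 0) := by
  have := (hasDerivWithinAt_line (c := 0) ht h).derivWithin (uniqueDiffOn_Ici 0 t ht.1)
  simpa using! this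

lemma hasDerivAt_space_of_hasFDerivWithinAt {D : ℝ × ℝ →L[ℝ] ℝ} {t x : ℝ} (ht : t ∈ Ico 0 T)
    (h : HasFDerivWithinAt (Function.uncurry f) D (Strip T) (t, x)) :
    HasDerivAt (fun y => f t y) (D (0, 1)) x := by
  have h1 : HasDerivAt (fun y => (t, y)) ((0 : ℝ), (1 : ℝ)) x :=
    (hasDerivAt_const x t).prodMk (hasDerivAt_id x)
  have h3 := h.comp_hasDerivWithinAt (s := univ) x h1.hasDerivWithinAt
    (fun s _ => mem_strip.2 ht)
  exact hasDerivWithinAt_univ.1 h3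

lemma dx_eq_of_hasFDerivWithinAt {D : ℝ × ℝ →L[ℝ] ℝ} {t x : ℝ} (ht : t ∈ Ico 0 T)
    (h : HasFDerivWithinAt (Function.uncurry f) D (Strip T) (t, x)) : dx f t x = D (0, 1) :=
  (hasDerivAt_space_of_hasFDerivWithinAt ht h).deriv

lemma hasFDerivWithinAt_fderivWithin (hf : ContDiffOn ℝ 1 (Function.uncurry f) (Strip T))
    {t : ℝ} (ht : t ∈ Ico 0 T) (x : ℝ) :
    HasFDerivWithinAt (Function.uncurry f)
      (fderivWithin ℝ (Function.uncurry f) (Strip T) (t, x)) (Strip T) (t, x) :=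
  ((hf.differentiableOn one_ne_zero) (t, x) (mem_strip.2 ht)).hasFDerivWithinAt

/-- On a strip, the derivative of a `C¹` function is given by `dt` and `dx`. -/
lemma hasFDerivWithinAt_strip (hf : ContDiffOn ℝ 1 (Function.uncurry f) (Strip T))
    {t : ℝ} (ht : t ∈ Ico 0 T) (x : ℝ) :
    HasFDerivWithinAt (Function.uncurry f) (grad (dt f t x) (dx f t x)) (Strip T) (t, x) := by
  have h := hasFDerivWithinAt_fderivWithin hf ht x
  refine h.congr_fderiv ?_
  rw [dt_eq_of_hasFDerivWithinAt ht h, dx_eq_of_hasFDerivWithinAt ht h]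
  ext <;> simp

lemma hasDerivWithinAt_dt (hf : ContDiffOn ℝ 1 (Function.uncurry f) (Strip T))
    {t : ℝ} (ht : t ∈ Ico 0 T) (x : ℝ) :
    HasDerivWithinAt (fun s => f s x) (dt f t x) (Ici 0) t := by
  simpa using! hasDerivWithinAt_line (c := 0) ht (hasFDerivWithinAt_strip hf ht x)

lemma hasDerivAt_dx (hf : ContDiffOn ℝ 1 (Function.uncurry f) (Strip T))
    {t : ℝ} (ht : t ∈ Ico 0 T) (x : ℝ) : HasDerivAt (fun y => f t y) (dx f t x) x := by
  simpa using! hasDerivAt_space_of_hasFDerivWithinAt ht (hasFDerivWithinAt_strip hf ht x)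

/-- The chain rule along the line `s ↦ (s, y + c s)`, which is characteristic for `c = ±1`. -/
lemma hasDerivWithinAt_char (hf : ContDiffOn ℝ 1 (Function.uncurry f) (Strip T))
    {t : ℝ} (ht : t ∈ Ico 0 T) (y c : ℝ) :
    HasDerivWithinAt (fun s => f s (y + c * s)) (dt f t (y + c * t) + c * dx f t (y + c * t))
      (Ici t) t := by
  have h := hasDerivWithinAt_line (c := c) ht (hasFDerivWithinAt_strip hf ht (y + c * t))
  have e : (fun s => Function.uncurry f (s, y + c * t + c * (s - t)))
      = fun s => f s (y + c * s) := by
    funext s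
    simp only [Function.uncurry]
    ring_nf
  rw [e] at h
  simpa using h.mono (Ici_subset_Ici.2 ht.1)

lemma contDiffOn_fderivWithin_apply (hf : ContDiffOn ℝ 2 (Function.uncurry f) (Strip T))
    (v : ℝ × ℝ) :
    ContDiffOn ℝ 1 (fun z => fderivWithin ℝ (Function.uncurry f) (Strip T) z v) (Strip T) :=
  (hf.fderivWithin (uniqueDiffOn_strip T) (m := 1) (by norm_num)).clm_apply contDiffOn_const

lemma contDiffOn_dt (hf : ContDiffOn ℝ 2 (Function.uncurry f) (Strip T)) :
    ContDiffOn ℝ 1 (Function.uncurry (dt f)) (Strip T) :=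
  (contDiffOn_fderivWithin_apply hf (1, 0)).congr fun z hz =>
    dt_eq_of_hasFDerivWithinAt (mem_strip.1 hz)
      (hasFDerivWithinAt_fderivWithin (hf.of_le one_le_two) (mem_strip.1 hz) z.2)

lemma contDiffOn_dx (hf : ContDiffOn ℝ 2 (Function.uncurry f) (Strip T)) :
    ContDiffOn ℝ 1 (Function.uncurry (dx f)) (Strip T) :=
  (contDiffOn_fderivWithin_apply hf (0, 1)).congr fun z hz =>
    dx_eq_of_hasFDerivWithinAt (mem_strip.1 hz)
      (hasFDerivWithinAt_fderivWithin (hf.of_le one_le_two) (mem_strip.1 hz) z.2)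

/-- Mixed second derivatives of a `C²` function commute, also at `t = 0`. -/
lemma dx_dt_comm (hf : ContDiffOn ℝ 2 (Function.uncurry f) (Strip T)) {t : ℝ}
    (ht : t ∈ Ico 0 T) (x : ℝ) : dx (dt f) t x = dt (dx f) t x := by
  set F := Function.uncurry f
  have hd : DifferentiableWithinAt ℝ (fderivWithin ℝ F (Strip T)) (Strip T) (t, x) :=
    ((hf.fderivWithin (uniqueDiffOn_strip T) (m := 1) (by norm_num)).differentiableOn
      one_ne_zero) (t, x) (mem_strip.2 ht)
  have hv : ∀ v, HasFDerivWithinAt (fun z => fderivWithin ℝ F (Strip T) z v)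
      ((ContinuousLinearMap.apply ℝ ℝ v).comp
        (fderivWithin ℝ (fderivWithin ℝ F (Strip T)) (Strip T) (t, x))) (Strip T) (t, x) :=
    fun v => (ContinuousLinearMap.apply ℝ ℝ v).hasFDerivAt.comp_hasFDerivWithinAt _
      hd.hasFDerivWithinAt
  have h1 : HasFDerivWithinAt (Function.uncurry (dt f)) _ (Strip T) (t, x) :=
    (hv (1, 0)).congr (fun z hz => dt_eq_of_hasFDerivWithinAt (mem_strip.1 hz)
      (hasFDerivWithinAt_fderivWithin (hf.of_le one_le_two) (mem_strip.1 hz) z.2))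
      (dt_eq_of_hasFDerivWithinAt ht
        (hasFDerivWithinAt_fderivWithin (hf.of_le one_le_two) ht x))
  have h2 : HasFDerivWithinAt (Function.uncurry (dx f)) _ (Strip T) (t, x) :=
    (hv (0, 1)).congr (fun z hz => dx_eq_of_hasFDerivWithinAt (mem_strip.1 hz)
      (hasFDerivWithinAt_fderivWithin (hf.of_le one_le_two) (mem_strip.1 hz) z.2))
      (dx_eq_of_hasFDerivWithinAt ht
        (hasFDerivWithinAt_fderivWithin (hf.of_le one_le_two) ht x))
  rw [dx_eq_of_hasFDerivWithinAt ht h1, dt_eq_of_hasFDerivWithinAt ht h2]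
  refine (ContDiffWithinAt.isSymmSndFDerivWithinAt (hf (t, x) (mem_strip.2 ht)) (by simp)
    (uniqueDiffOn_strip T) ?_ (mem_strip.2 ht)) (0, 1) (1, 0)
  rw [Strip, interior_prod_eq, interior_Ico, interior_univ, closure_prod_eq, closure_univ,
    closure_Ioo (ht.1.trans_lt ht.2).ne]
  exact ⟨Ico_subset_Icc_self ht, mem_univ _⟩

/-- For a `C²` function, `(∂_t - ∂_x) (∂_t + ∂_x) f = f_tt - f_xx`. -/
lemma hasDerivWithinAt_char_neg (hf : ContDiffOn ℝ 2 (Function.uncurry f) (Strip T)) {t : ℝ}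
    (ht : t ∈ Ico 0 T) (y : ℝ) :
    HasDerivWithinAt (fun s => dt f s (y + (-1) * s) + dx f s (y + (-1) * s))
      (dt (dt f) t (y + (-1) * t) - dx (dx f) t (y + (-1) * t)) (Ici t) t := by
  refine ((hasDerivWithinAt_char (contDiffOn_dt hf) ht y (-1)).add
    (hasDerivWithinAt_char (contDiffOn_dx hf) ht y (-1))).congr_deriv ?_
  rw [dx_dt_comm hf ht]
  ring

/-- For a `C²` function, `(∂_t + ∂_x) (∂_t - ∂_x) f = f_tt - f_xx`. -/
lemma hasDerivWithinAt_char_pos (hf : ContDiffOn ℝ 2 (Function.uncurry f) (Strip T)) {t : ℝ}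
    (ht : t ∈ Ico 0 T) (y : ℝ) :
    HasDerivWithinAt (fun s => dt f s (y + 1 * s) - dx f s (y + 1 * s))
      (dt (dt f) t (y + 1 * t) - dx (dx f) t (y + 1 * t)) (Ici t) t := by
  refine ((hasDerivWithinAt_char (contDiffOn_dt hf) ht y 1).sub
    (hasDerivWithinAt_char (contDiffOn_dx hf) ht y 1)).congr_deriv ?_
  rw [dx_dt_comm hf ht]
  ring

/-- Two `C¹` functions with the same time derivative and the same initial values agree. -/
lemma eq_of_dt_eq {g : ℝ → ℝ → ℝ} (hf : ContDiffOn ℝ 1 (Function.uncurry f) (Strip T))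
    (hg : ContDiffOn ℝ 1 (Function.uncurry g) (Strip T)) (x : ℝ) (h0 : f 0 x = g 0 x)
    (h : ∀ t ∈ Ico 0 T, dt f t x = dt g t x) {t : ℝ} (ht : t ∈ Ico 0 T) : f t x = g t x := by
  have hsub : Icc 0 t ⊆ Ico 0 T := fun s hs => ⟨hs.1, hs.2.trans_lt ht.2⟩
  have hd : ∀ s ∈ Icc 0 t, HasDerivWithinAt (fun s => f s x - g s x) 0 (Ici 0) s := by
    intro s hs
    refine ((hasDerivWithinAt_dt hf (hsub hs) x).sub
      (hasDerivWithinAt_dt hg (hsub hs) x)).congr_deriv ?_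
    rw [h s (hsub hs), sub_self]
  have := constant_of_has_deriv_right_zero
    (fun s hs => (hd s hs).continuousWithinAt.mono Icc_subset_Ici_self)
    (fun s hs => (hd s (Ico_subset_Icc_self hs)).mono (Ici_subset_Ici.2 hs.1)) t
    (right_mem_Icc.2 ht.1)
  linarith

end Strip

/-! ### Uniqueness -/

/-- The backward characteristic triangle with apex `(t₀, x₀)`. -/
def Triangle (t₀ x₀ : ℝ) : Set (ℝ × ℝ) := {z | 0 ≤ z.1 ∧ |z.2 - x₀| ≤ t₀ - z.1}

lemma isCompact_triangle (t₀ x₀ : ℝ) : IsCompact (Triangle t₀ x₀) := by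
  refine IsCompact.of_isClosed_subset
    ((isCompact_Icc (a := 0) (b := t₀)).prod (isCompact_Icc (a := x₀ - t₀) (b := x₀ + t₀))) ?_ ?_
  · exact (isClosed_le continuous_const continuous_fst).inter
      (isClosed_le (continuous_snd.sub continuous_const).abs
        (continuous_const.sub continuous_fst))
  · rintro ⟨t, x⟩ ⟨h1, h2⟩
    have h3 := abs_le.1 h2
    have h4 := abs_nonneg (x - x₀)
    simp only at h1 h2 h3
    exact ⟨⟨h1, by linarith⟩, ⟨by linarith, by linarith⟩⟩

lemma triangle_subset_strip {T t₀ x₀ : ℝ} (h : t₀ < T) : Triangle t₀ x₀ ⊆ Strip T := by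
  rintro ⟨t, x⟩ ⟨h1, h2⟩
  have := abs_nonneg (x - x₀)
  simp only at h1 h2
  exact mem_strip.2 ⟨h1, by linarith⟩

lemma triangle_line {t₀ x₀ t x c s : ℝ} (h : (t, x) ∈ Triangle t₀ x₀) (hc : |c| = 1)
    (hs : s ∈ Icc 0 t) : (s, x - c * t + c * s) ∈ Triangle t₀ x₀ := by
  refine ⟨hs.1, ?_⟩
  have h2 : |x - x₀| ≤ t₀ - t := h.2
  have e : x - c * t + c * s - x₀ = (x - x₀) + -(c * (t - s)) := by ring
  simp only [e]
  refine (abs_add_le _ _).trans ?_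
  rw [abs_neg, abs_mul, hc, abs_of_nonneg (sub_nonneg.2 hs.2)]
  linarith

/-- A linear differential inequality along both families of characteristics has, with zero initial
values, only the zero solution in a characteristic triangle. -/
lemma eq_zero_of_char {t₀ x₀ C : ℝ} {f g F G : ℝ → ℝ → ℂ} (hC : 0 ≤ C)
    (hf : ContinuousOn (Function.uncurry f) (Triangle t₀ x₀))
    (hg : ContinuousOn (Function.uncurry g) (Triangle t₀ x₀))
    (hf0 : ∀ x, f 0 x = 0) (hg0 : ∀ x, g 0 x = 0)
    (hfd : ∀ s y, (s, y + (-1) * s) ∈ Triangle t₀ x₀ →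
      HasDerivWithinAt (fun s => f s (y + (-1) * s)) (F s (y + (-1) * s)) (Ici s) s)
    (hgd : ∀ s y, (s, y + 1 * s) ∈ Triangle t₀ x₀ →
      HasDerivWithinAt (fun s => g s (y + 1 * s)) (G s (y + 1 * s)) (Ici s) s)
    (hF : ∀ s x, (s, x) ∈ Triangle t₀ x₀ → ‖F s x‖ ≤ C * (‖f s x‖ + ‖g s x‖))
    (hG : ∀ s x, (s, x) ∈ Triangle t₀ x₀ → ‖G s x‖ ≤ C * (‖f s x‖ + ‖g s x‖)) :
    ∀ t x, (t, x) ∈ Triangle t₀ x₀ → f t x = 0 ∧ g t x = 0 := by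
  rcases (Triangle t₀ x₀).eq_empty_or_nonempty with hemp | hne
  · intro t x h
    simp [hemp] at h
  -- The maximum `S` of `e^{-l t} (‖f‖ + ‖g‖)` satisfies `S ≤ (2C / l) S`, and `l > 2C`.
  set l := 2 * C + 1 with hl
  have hlpos : 0 < l := by positivity
  obtain ⟨z, hz, hmax⟩ := (isCompact_triangle t₀ x₀).exists_isMaxOn hne
    (f := fun z => Real.exp (-l * z.1) * (‖f z.1 z.2‖ + ‖g z.1 z.2‖))
    ((Real.continuous_exp.comp (continuous_const.mul continuous_fst)).continuousOn.mul
      (hf.norm.add hg.norm))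
  set S := Real.exp (-l * z.1) * (‖f z.1 z.2‖ + ‖g z.1 z.2‖) with hS
  have hS0 : 0 ≤ S := by positivity
  have hb : ∀ t x, (t, x) ∈ Triangle t₀ x₀ → ‖f t x‖ + ‖g t x‖ ≤ S * Real.exp (l * t) := by
    intro t x h
    have h1 : Real.exp (-l * t) * (‖f t x‖ + ‖g t x‖) ≤ S := hmax h
    have h2 : Real.exp (-l * t) * Real.exp (l * t) = 1 := by
      rw [← Real.exp_add]; simp
    calc ‖f t x‖ + ‖g t x‖ = (Real.exp (-l * t) * (‖f t x‖ + ‖g t x‖)) * Real.exp (l * t) := by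
          linear_combination (-(‖f t x‖ + ‖g t x‖)) * h2
      _ ≤ _ := mul_le_mul_of_nonneg_right h1 (Real.exp_pos _).le
  have hB : ∀ s, HasDerivAt (fun s => C * S / l * Real.exp (l * s))
      (C * (S * Real.exp (l * s))) s := by
    intro s
    have h1 : HasDerivAt (fun s => l * s) l s := by simpa using (hasDerivAt_id s).const_mul l
    refine (h1.exp.const_mul _).congr_deriv ?_
    field_simp
  -- Integration of the inequality along one family of characteristics.
  have half : ∀ (c : ℝ) (φ Φ : ℝ → ℝ → ℂ), |c| = 1 →
      ContinuousOn (Function.uncurry φ) (Triangle t₀ x₀) → (∀ x, φ 0 x = 0) →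
      (∀ s y, (s, y + c * s) ∈ Triangle t₀ x₀ →
        HasDerivWithinAt (fun s => φ s (y + c * s)) (Φ s (y + c * s)) (Ici s) s) →
      (∀ s x, (s, x) ∈ Triangle t₀ x₀ → ‖Φ s x‖ ≤ C * (‖f s x‖ + ‖g s x‖)) →
      ∀ t x, (t, x) ∈ Triangle t₀ x₀ → ‖φ t x‖ ≤ C * S / l * Real.exp (l * t) := by
    intro c φ Φ hc hφ hφ0 hd hΦ t x h
    have hmem := fun s (hs : s ∈ Icc 0 t) => triangle_line h hc hs
    have := image_norm_le_of_norm_deriv_right_le_deriv_boundary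
      (f := fun s => φ s (x - c * t + c * s)) (f' := fun s => Φ s (x - c * t + c * s))
      (a := 0) (b := t) ?_ (fun s hs => hd s _ (hmem s (Ico_subset_Icc_self hs))) ?_ hB
      (fun s hs => (hΦ s _ (hmem s (Ico_subset_Icc_self hs))).trans
        (mul_le_mul_of_nonneg_left (hb s _ (hmem s (Ico_subset_Icc_self hs))) hC))
      (right_mem_Icc.2 h.1)
    · simpa using this
    · exact hφ.comp (f := fun s : ℝ => (s, x - c * t + c * s)) (by fun_prop) hmem
    · rw [hφ0, norm_zero]; positivity
  have hSle : S ≤ 0 := by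
    have h1 := half (-1) f F (by simp) hf hf0 hfd hF z.1 z.2 hz
    have h2 := half 1 g G (by simp) hg hg0 hgd hG z.1 z.2 hz
    have h3 : Real.exp (-l * z.1) * Real.exp (l * z.1) = 1 := by
      rw [← Real.exp_add]; simp
    have h4 : S ≤ 2 * (C * S / l) := by
      calc S ≤ Real.exp (-l * z.1) * (C * S / l * Real.exp (l * z.1)
            + C * S / l * Real.exp (l * z.1)) :=
            mul_le_mul_of_nonneg_left (add_le_add h1 h2) (Real.exp_pos _).le
        _ = 2 * (C * S / l) := by linear_combination (2 * (C * S / l)) * h3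
    have h5 : l * S ≤ 2 * C * S := by
      calc l * S ≤ l * (2 * (C * S / l)) := mul_le_mul_of_nonneg_left h4 hlpos.le
        _ = 2 * C * S := by field_simp
    rw [hl] at h5
    linarith
  intro t x h
  have h1 := hb t x h
  rw [le_antisymm hSle hS0, zero_mul] at h1
  constructor
  · exact norm_eq_zero.1 (le_antisymm (by linarith [norm_nonneg (g t x)]) (norm_nonneg _))
  · exact norm_eq_zero.1 (le_antisymm (by linarith [norm_nonneg (f t x)]) (norm_nonneg _))

lemma apex_mem_triangle {t x : ℝ} (ht : 0 ≤ t) : (t, x) ∈ Triangle t x := by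
  simp [Triangle, ht]

section Uniqueness

variable {T : ℝ}

lemma dt_eq_of_eqOn {f g : ℝ → ℝ → ℝ} {t x : ℝ} (h : ∀ s ∈ Ico 0 T, f s x = g s x)
    (ht : t ∈ Ico 0 T) : dt f t x = dt g t x :=
  EventuallyEq.derivWithin_eq
    (Filter.eventuallyEq_of_mem (Ico_mem_nhdsWithin_Ici_zero ht) h) (h t ht)

lemma dx_eq_of_eq {f g : ℝ → ℝ → ℝ} {t x : ℝ} (h : ∀ y, f t y = g t y) : dx f t x = dx g t x :=
  congrArg (deriv · x) (funext h)

/-- Uniqueness for the linear wave equation with a given source. -/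
lemma wave_unique {f g : ℝ → ℝ → ℝ} (hf : ContDiffOn ℝ 2 (Function.uncurry f) (Strip T))
    (hg : ContDiffOn ℝ 2 (Function.uncurry g) (Strip T))
    (h : ∀ t ∈ Ico 0 T, ∀ x,
      dt (dt f) t x - dx (dx f) t x = dt (dt g) t x - dx (dx g) t x)
    (h0 : f 0 = g 0) (h1 : dt f 0 = dt g 0) {t : ℝ} (ht : t ∈ Ico 0 T) (x : ℝ) :
    f t x = g t x := by
  have hx0 : ∀ x, dx f 0 x = dx g 0 x := fun x => dx_eq_of_eq (congrFun h0)
  refine eq_of_dt_eq (hf.of_le one_le_two) (hg.of_le one_le_two) x (congrFun h0 x) ?_ ht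
  intro t ht
  have hsub := triangle_subset_strip (x₀ := x) ht.2
  have cf := (contDiffOn_dt hf).continuousOn.mono hsub
  have cf' := (contDiffOn_dx hf).continuousOn.mono hsub
  have cg := (contDiffOn_dt hg).continuousOn.mono hsub
  have cg' := (contDiffOn_dx hg).continuousOn.mono hsub
  have key := eq_zero_of_char (t₀ := t) (x₀ := x) (C := 0) le_rfl
    (f := fun s y => (((dt f s y + dx f s y) - (dt g s y + dx g s y) : ℝ) : ℂ))
    (g := fun s y => (((dt f s y - dx f s y) - (dt g s y - dx g s y) : ℝ) : ℂ))
    (F := 0) (G := 0)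
    (Complex.continuous_ofReal.comp_continuousOn ((cf.add cf').sub (cg.add cg')))
    (Complex.continuous_ofReal.comp_continuousOn ((cf.sub cf').sub (cg.sub cg')))
    (fun y => by simp [h1, hx0]) (fun y => by simp [h1, hx0])
    (fun s y hs => by
      have hs' := mem_strip.1 (hsub hs)
      refine ((hasDerivWithinAt_char_neg hf hs' y).sub
        (hasDerivWithinAt_char_neg hg hs' y)).ofReal_comp.congr_deriv ?_
      rw [h s hs']
      simp)
    (fun s y hs => by
      have hs' := mem_strip.1 (hsub hs)
      refine ((hasDerivWithinAt_char_pos hf hs' y).sub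
        (hasDerivWithinAt_char_pos hg hs' y)).ofReal_comp.congr_deriv ?_
      rw [h s hs']
      simp)
    (by simp) (by simp) t x (apex_mem_triangle ht.1)
  have k1 := Complex.ofReal_eq_zero.1 key.1
  have k2 := Complex.ofReal_eq_zero.1 key.2
  linarith

/-- The derivative of the map `(W, q)` into the hyperbolic plane along `∂_t + c ∂_x`, in the
orthonormal frame dual to `dW`, `½ e^{-2W} dq`. -/
def Fields.frame (u : Fields) (c : ℝ) (t x : ℝ) : ℂ :=
  ((dt u.W t x + c * dx u.W t x : ℝ) : ℂ)
    + ((1 / 2 * Real.exp (-2 * u.W t x) * (dt u.q t x + c * dx u.q t x) : ℝ) : ℂ) * Complex.I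

/-- The right-hand side of the transport equation for one of the two null derivatives `A`, `B` of
the wave map; `r`, `r'` are the null derivatives of `log R`. -/
def frameRhs (r r' : ℝ) (A B : ℂ) : ℂ :=
  -(1 / 2) * (r * A + r' * B) + 2 * (B.im * Complex.I) * A

lemma frameRhs_mk (r r' a b c d : ℝ) :
    frameRhs r r' ((a : ℂ) + (b : ℂ) * Complex.I) ((c : ℂ) + (d : ℂ) * Complex.I) =
      ((-(1 / 2) * (r * a + r' * c) - 2 * d * b : ℝ) : ℂ)
        + ((-(1 / 2) * (r * b + r' * d) + 2 * d * a : ℝ) : ℂ) * Complex.I := by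
  apply Complex.ext
  · simp [frameRhs]
    ring
  · simp [frameRhs]

lemma frame_one (u : Fields) (t x : ℝ) :
    u.frame 1 t x = ((dt u.W t x + dx u.W t x : ℝ) : ℂ)
      + ((1 / 2 * Real.exp (-2 * u.W t x) * (dt u.q t x + dx u.q t x) : ℝ) : ℂ) * Complex.I := by
  simp only [Fields.frame, one_mul]

lemma frame_neg_one (u : Fields) (t x : ℝ) :
    u.frame (-1) t x = ((dt u.W t x - dx u.W t x : ℝ) : ℂ)
      + ((1 / 2 * Real.exp (-2 * u.W t x) * (dt u.q t x - dx u.q t x) : ℝ) : ℂ) * Complex.I := by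
  simp only [Fields.frame, neg_one_mul, ← sub_eq_add_neg]

lemma frame_re (u : Fields) (c t x : ℝ) :
    (u.frame c t x).re = dt u.W t x + c * dx u.W t x := by
  simp only [Fields.frame, Complex.add_re, Complex.ofReal_re, Complex.mul_re, Complex.ofReal_im,
    Complex.I_re, Complex.I_im]
  ring

lemma frame_im (u : Fields) (c t x : ℝ) :
    (u.frame c t x).im = 1 / 2 * Real.exp (-2 * u.W t x) * (dt u.q t x + c * dx u.q t x) := by
  simp only [Fields.frame, Complex.add_im, Complex.ofReal_re, Complex.mul_im, Complex.ofReal_im,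
    Complex.I_re, Complex.I_im]
  ring

lemma norm_frameRhs_sub_le {r r' M : ℝ} {A A' B B' : ℂ} (hr : |r| ≤ M) (hr' : |r'| ≤ M)
    (hB : ‖B‖ ≤ M) (hA' : ‖A'‖ ≤ M) :
    ‖frameRhs r r' A B - frameRhs r r' A' B'‖ ≤ 3 * M * (‖A - A'‖ + ‖B - B'‖) := by
  have e : frameRhs r r' A B - frameRhs r r' A' B' =
      (((-(1 / 2) * r : ℝ) : ℂ) * (A - A') + ((-(1 / 2) * r' : ℝ) : ℂ) * (B - B'))
      + (((2 * B.im : ℝ) : ℂ) * Complex.I * (A - A')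
        + ((2 * (B - B').im : ℝ) : ℂ) * Complex.I * A') := by
    simp only [frameRhs, Complex.sub_im]
    push_cast
    ring
  have hM : 0 ≤ M := (abs_nonneg r).trans hr
  have h1 : |B.im| ≤ M := (Complex.abs_im_le_norm B).trans hB
  have h2 : |(B - B').im| ≤ ‖B - B'‖ := Complex.abs_im_le_norm _
  have n1 := norm_nonneg (A - A')
  have n2 := norm_nonneg (B - B')
  rw [e]
  refine (norm_add_le _ _).trans ((add_le_add (norm_add_le _ _) (norm_add_le _ _)).trans ?_)
  simp only [norm_mul, Complex.norm_real, Complex.norm_I, mul_one, Real.norm_eq_abs]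
  norm_num
  have i1 := mul_le_mul_of_nonneg_right hr n1
  have i2 := mul_le_mul_of_nonneg_right hr' n2
  have i3 := mul_le_mul_of_nonneg_right h1 n1
  have i4 : |B.im - B'.im| * ‖A'‖ ≤ ‖B - B'‖ * M :=
    mul_le_mul (by simpa using h2) hA' (norm_nonneg _) n2
  nlinarith [mul_nonneg hM n1, mul_nonneg hM n2]

section Solution

variable {u : Fields}

lemma Fields.IsSolutionOn.restrict (hu : u.IsSolutionOn (Ici 0)) (T : ℝ) :
    u.IsSolutionOn (Ico 0 T) :=
  have hs : Ico 0 T ⊆ Ici 0 := Ico_subset_Ici_self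
  have hp : Ico 0 T ×ˢ univ ⊆ Ici (0 : ℝ) ×ˢ (univ : Set ℝ) := prod_mono_left hs
  ⟨hu.contDiff_R.mono hp, hu.contDiff_W.mono hp, hu.contDiff_q.mono hp, hu.contDiff_a.mono hp,
    fun t ht => hu.eq_R t (hs ht), fun t ht => hu.eq_W t (hs ht), fun t ht => hu.eq_q t (hs ht),
    fun t ht => hu.eq_a t (hs ht)⟩

lemma continuousOn_frame (hu : u.IsSolutionOn (Ico 0 T)) (c : ℝ) :
    ContinuousOn (Function.uncurry (u.frame c)) (Strip T) := by
  have hW := hu.contDiff_W.continuousOn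
  have hWt := (contDiffOn_dt (T := T) hu.contDiff_W).continuousOn
  have hWx := (contDiffOn_dx (T := T) hu.contDiff_W).continuousOn
  have hqt := (contDiffOn_dt (T := T) hu.contDiff_q).continuousOn
  have hqx := (contDiffOn_dx (T := T) hu.contDiff_q).continuousOn
  exact (Complex.continuous_ofReal.comp_continuousOn (hWt.add (continuousOn_const.mul hWx))).add
    ((Complex.continuous_ofReal.comp_continuousOn ((continuousOn_const.mul
      (Real.continuous_exp.comp_continuousOn (continuousOn_const.mul hW))).mul
        (hqt.add (continuousOn_const.mul hqx)))).mul continuousOn_const)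

/-- In the frame, the wave map equations are a transport equation for the derivative along
`∂_t + ∂_x` along the lines `x + t = y`. -/
lemma hasDerivWithinAt_frame_neg (hu : u.IsSolutionOn (Ico 0 T)) {t : ℝ} (ht : t ∈ Ico 0 T)
    (y : ℝ) :
    HasDerivWithinAt (fun s => u.frame 1 s (y + (-1) * s))
      (frameRhs ((dt u.R t (y + (-1) * t) - dx u.R t (y + (-1) * t)) / u.R t (y + (-1) * t))
        ((dt u.R t (y + (-1) * t) + dx u.R t (y + (-1) * t)) / u.R t (y + (-1) * t))
        (u.frame 1 t (y + (-1) * t)) (u.frame (-1) t (y + (-1) * t))) (Ici t) t := by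
  have hW := hasDerivWithinAt_char_neg (T := T) hu.contDiff_W ht y
  have hq := hasDerivWithinAt_char_neg (T := T) hu.contDiff_q ht y
  have hw := hasDerivWithinAt_char (T := T) (hu.contDiff_W.of_le one_le_two) ht y (-1)
  have e₁ := hu.eq_W t ht (y + (-1) * t)
  have e₂ := hu.eq_q t ht (y + (-1) * t)
  have h := hW.ofReal_comp.add ((((hw.const_mul (-2)).exp.const_mul (1 / 2)).mul
    hq).ofReal_comp.mul_const Complex.I)
  have hexp : Real.exp (-4 * u.W t (y + (-1) * t)) = Real.exp (-2 * u.W t (y + (-1) * t)) ^ 2 := by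
    rw [← Real.exp_nat_mul]
    push_cast
    ring_nf
  rw [hexp] at e₁
  simp only [frame_one, frame_neg_one]
  refine h.congr_deriv ?_
  generalize y + (-1) * t = x at *
  have e₁' : dt (dt u.W) t x - dx (dx u.W) t x = -(dt u.R t x / u.R t x * dt u.W t x
      - dx u.R t x / u.R t x * dx u.W t x)
      - (dt u.q t x ^ 2 - dx u.q t x ^ 2) / 2 * Real.exp (-2 * u.W t x) ^ 2 := by
    linarith
  have e₂' : dt (dt u.q) t x - dx (dx u.q) t x = -(dt u.R t x / u.R t x * dt u.q t x
      - dx u.R t x / u.R t x * dx u.q t x)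
      + 4 * dt u.q t x * dt u.W t x - 4 * dx u.q t x * dx u.W t x := by
    linarith
  rw [e₁', e₂', frameRhs_mk]
  congr 1
  · exact congrArg _ (by ring)
  · exact congrArg (fun r : ℝ => (r : ℂ) * Complex.I) (by ring)

/-- The transport equation for the derivative along `∂_t - ∂_x` along the lines `x - t = y`. -/
lemma hasDerivWithinAt_frame_pos (hu : u.IsSolutionOn (Ico 0 T)) {t : ℝ} (ht : t ∈ Ico 0 T)
    (y : ℝ) :
    HasDerivWithinAt (fun s => u.frame (-1) s (y + 1 * s))
      (frameRhs ((dt u.R t (y + 1 * t) + dx u.R t (y + 1 * t)) / u.R t (y + 1 * t))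
        ((dt u.R t (y + 1 * t) - dx u.R t (y + 1 * t)) / u.R t (y + 1 * t))
        (u.frame (-1) t (y + 1 * t)) (u.frame 1 t (y + 1 * t))) (Ici t) t := by
  have hW := hasDerivWithinAt_char_pos (T := T) hu.contDiff_W ht y
  have hq := hasDerivWithinAt_char_pos (T := T) hu.contDiff_q ht y
  have hw := hasDerivWithinAt_char (T := T) (hu.contDiff_W.of_le one_le_two) ht y 1
  have e₁ := hu.eq_W t ht (y + 1 * t)
  have e₂ := hu.eq_q t ht (y + 1 * t)
  have h := hW.ofReal_comp.add ((((hw.const_mul (-2)).exp.const_mul (1 / 2)).mul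
    hq).ofReal_comp.mul_const Complex.I)
  have hexp : Real.exp (-4 * u.W t (y + 1 * t)) = Real.exp (-2 * u.W t (y + 1 * t)) ^ 2 := by
    rw [← Real.exp_nat_mul]
    push_cast
    ring_nf
  rw [hexp] at e₁
  simp only [frame_one, frame_neg_one]
  refine h.congr_deriv ?_
  generalize y + 1 * t = x at *
  have e₁' : dt (dt u.W) t x - dx (dx u.W) t x = -(dt u.R t x / u.R t x * dt u.W t x
      - dx u.R t x / u.R t x * dx u.W t x)
      - (dt u.q t x ^ 2 - dx u.q t x ^ 2) / 2 * Real.exp (-2 * u.W t x) ^ 2 := by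
    linarith
  have e₂' : dt (dt u.q) t x - dx (dx u.q) t x = -(dt u.R t x / u.R t x * dt u.q t x
      - dx u.R t x / u.R t x * dx u.q t x)
      + 4 * dt u.q t x * dt u.W t x - 4 * dx u.q t x * dx u.W t x := by
    linarith
  rw [e₁', e₂', frameRhs_mk]
  congr 1
  · exact congrArg _ (by ring)
  · exact congrArg (fun r : ℝ => (r : ℂ) * Complex.I) (by ring)

end Solution

lemma frame_congr {u v : Fields} {t x : ℝ} (c : ℝ) (hW : ∀ y, u.W t y = v.W t y)
    (hq : ∀ y, u.q t y = v.q t y) (hWt : dt u.W t x = dt v.W t x)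
    (hqt : dt u.q t x = dt v.q t x) : u.frame c t x = v.frame c t x := by
  simp only [Fields.frame, dx_eq_of_eq hW, dx_eq_of_eq hq, hW, hWt, hqt]

/-- Two solutions with the same data agree, when `R ≠ 0` for one of them. The equations are treated
in the order `R`, `(W, q)`, `a`, in which each is a closed equation given the previous ones. -/
theorem solution_unique {u v : Fields} (hu : u.IsSolutionOn (Ico 0 T))
    (hv : v.IsSolutionOn (Ico 0 T)) (hR : ∀ t ∈ Ico 0 T, ∀ x, u.R t x ≠ 0)
    (h0 : v.slice 0 = u.slice 0) {t : ℝ} (ht : t ∈ Ico 0 T) (x : ℝ) :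
    v.R t x = u.R t x ∧ v.W t x = u.W t x ∧ v.q t x = u.q t x ∧ v.a t x = u.a t x := by
  obtain ⟨R0, R1, W0, W1, q0, q1, a0, a1⟩ : v.R 0 = u.R 0 ∧ dt v.R 0 = dt u.R 0 ∧
      v.W 0 = u.W 0 ∧ dt v.W 0 = dt u.W 0 ∧ v.q 0 = u.q 0 ∧ dt v.q 0 = dt u.q 0 ∧
      v.a 0 = u.a 0 ∧ dt v.a 0 = dt u.a 0 := by
    simpa [Fields.slice] using h0
  have eR : ∀ t ∈ Ico 0 T, ∀ x, v.R t x = u.R t x := fun t ht x =>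
    wave_unique hv.contDiff_R hu.contDiff_R
      (fun t ht x => by linarith [hv.eq_R t ht x, hu.eq_R t ht x]) R0 R1 ht x
  have eRt : ∀ t ∈ Ico 0 T, ∀ x, dt v.R t x = dt u.R t x := fun t ht x =>
    dt_eq_of_eqOn (fun s hs => eR s hs x) ht
  have eRx : ∀ t ∈ Ico 0 T, ∀ x, dx v.R t x = dx u.R t x := fun t ht x =>
    dx_eq_of_eq (eR t ht)
  -- The null derivatives of the wave maps agree.
  have eframe : ∀ t ∈ Ico 0 T, ∀ x, v.frame 1 t x = u.frame 1 t x ∧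
      v.frame (-1) t x = u.frame (-1) t x := by
    intro t ht x
    have hsub := triangle_subset_strip (x₀ := x) ht.2
    have cR := hu.contDiff_R.continuousOn.mono hsub
    have cRt := (contDiffOn_dt (T := T) hu.contDiff_R).continuousOn.mono hsub
    have cRx := (contDiffOn_dx (T := T) hu.contDiff_R).continuousOn.mono hsub
    have hne : ∀ z ∈ Triangle t x, Function.uncurry u.R z ≠ 0 := fun z hz =>
      hR z.1 (mem_strip.1 (hsub hz)) z.2
    have bdd := fun {f : ℝ → ℝ → ℂ} (hf : ContinuousOn (Function.uncurry f) (Triangle t x)) =>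
      (isCompact_triangle t x).exists_bound_of_continuousOn hf
    obtain ⟨M₁, b₁⟩ := (isCompact_triangle t x).exists_bound_of_continuousOn
      ((cRt.sub cRx).div cR hne)
    obtain ⟨M₂, b₂⟩ := (isCompact_triangle t x).exists_bound_of_continuousOn
      ((cRt.add cRx).div cR hne)
    have f₁ := fun c => (continuousOn_frame hv c).mono hsub
    have f₂ := fun c => (continuousOn_frame hu c).mono hsub
    obtain ⟨M₃, b₃⟩ := bdd (f₁ (-1))
    obtain ⟨M₄, b₄⟩ := bdd (f₁ 1)
    obtain ⟨M₅, b₅⟩ := bdd (f₂ (-1))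
    obtain ⟨M₆, b₆⟩ := bdd (f₂ 1)
    obtain ⟨M, m₁, m₂, m₃, m₄, m₅, m₆⟩ : ∃ M : ℝ, M₁ ≤ M ∧ M₂ ≤ M ∧ M₃ ≤ M ∧ M₄ ≤ M ∧
        M₅ ≤ M ∧ M₆ ≤ M := by
      refine ⟨max (max M₁ M₂) (max (max M₃ M₄) (max M₅ M₆)), ?_⟩
      simp
    have hM : 0 ≤ M := (norm_nonneg _).trans ((b₁ _ (apex_mem_triangle ht.1)).trans m₁)
    have key := eq_zero_of_char (t₀ := t) (x₀ := x) (C := 3 * M) (by positivity)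
      (f := fun s y => v.frame 1 s y - u.frame 1 s y)
      (g := fun s y => v.frame (-1) s y - u.frame (-1) s y)
      (F := fun s y => frameRhs ((dt u.R s y - dx u.R s y) / u.R s y)
          ((dt u.R s y + dx u.R s y) / u.R s y) (v.frame 1 s y) (v.frame (-1) s y)
        - frameRhs ((dt u.R s y - dx u.R s y) / u.R s y)
          ((dt u.R s y + dx u.R s y) / u.R s y) (u.frame 1 s y) (u.frame (-1) s y))
      (G := fun s y => frameRhs ((dt u.R s y + dx u.R s y) / u.R s y)
          ((dt u.R s y - dx u.R s y) / u.R s y) (v.frame (-1) s y) (v.frame 1 s y)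
        - frameRhs ((dt u.R s y + dx u.R s y) / u.R s y)
          ((dt u.R s y - dx u.R s y) / u.R s y) (u.frame (-1) s y) (u.frame 1 s y))
      ((f₁ 1).sub (f₂ 1)) ((f₁ (-1)).sub (f₂ (-1)))
      (fun y => sub_eq_zero.2 (frame_congr 1 (congrFun W0) (congrFun q0) (congrFun W1 y)
        (congrFun q1 y)))
      (fun y => sub_eq_zero.2 (frame_congr (-1) (congrFun W0) (congrFun q0) (congrFun W1 y)
        (congrFun q1 y)))
      (fun s y hs => by
        have hs' := mem_strip.1 (hsub hs)
        have := hasDerivWithinAt_frame_neg hv hs' y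
        rw [eR s hs', eRt s hs', eRx s hs'] at this
        exact this.sub (hasDerivWithinAt_frame_neg hu hs' y))
      (fun s y hs => by
        have hs' := mem_strip.1 (hsub hs)
        have := hasDerivWithinAt_frame_pos hv hs' y
        rw [eR s hs', eRt s hs', eRx s hs'] at this
        exact this.sub (hasDerivWithinAt_frame_pos hu hs' y))
      (fun s y hs => norm_frameRhs_sub_le ((b₁ _ hs).trans m₁) ((b₂ _ hs).trans m₂)
        ((b₃ _ hs).trans m₃) ((b₆ _ hs).trans m₆))
      (fun s y hs => (norm_frameRhs_sub_le ((b₂ _ hs).trans m₂) ((b₁ _ hs).trans m₁)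
        ((b₄ _ hs).trans m₄) ((b₅ _ hs).trans m₅)).trans_eq (congrArg _ (add_comm _ _)))
      t x (apex_mem_triangle ht.1)
    exact ⟨sub_eq_zero.1 key.1, sub_eq_zero.1 key.2⟩
  have eWt : ∀ t ∈ Ico 0 T, ∀ x, dt v.W t x = dt u.W t x := by
    intro t ht x
    have h1 := congrArg Complex.re (eframe t ht x).1
    have h2 := congrArg Complex.re (eframe t ht x).2
    simp only [frame_re] at h1 h2
    linarith
  have eW : ∀ t ∈ Ico 0 T, ∀ x, v.W t x = u.W t x := fun t ht x =>
    eq_of_dt_eq (hv.contDiff_W.of_le one_le_two) (hu.contDiff_W.of_le one_le_two) x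
      (congrFun W0 x) (fun s hs => eWt s hs x) ht
  have eqt : ∀ t ∈ Ico 0 T, ∀ x, dt v.q t x = dt u.q t x := by
    intro t ht x
    have h1 := congrArg Complex.im (eframe t ht x).1
    have h2 := congrArg Complex.im (eframe t ht x).2
    simp only [frame_im, eW t ht] at h1 h2
    have he := Real.exp_pos (-2 * u.W t x)
    have h3 := mul_left_cancel₀ (by positivity) h1
    have h4 := mul_left_cancel₀ (by positivity) h2
    linarith
  have eq : ∀ t ∈ Ico 0 T, ∀ x, v.q t x = u.q t x := fun t ht x =>
    eq_of_dt_eq (hv.contDiff_q.of_le one_le_two) (hu.contDiff_q.of_le one_le_two) x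
      (congrFun q0 x) (fun s hs => eqt s hs x) ht
  refine ⟨eR t ht x, eW t ht x, eq t ht x,
    wave_unique hv.contDiff_a hu.contDiff_a (fun t ht x => ?_) a0 a1 ht x⟩
  have h1 := hv.eq_a t ht x
  have h2 := hu.eq_a t ht x
  rw [eR t ht, eRt t ht, eRx t ht, eWt t ht, eW t ht, eqt t ht, dx_eq_of_eq (eW t ht),
    dx_eq_of_eq (eq t ht)] at h1
  linarith

end Uniqueness

/-! ### The initial slice is a Cauchy hypersurface -/

/-- A continuous function with positive derivative off a finite set increases: the exceptional
points split the interval. -/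
lemma lt_of_deriv_pos_off_finite {f : ℝ → ℝ} {P : Set ℝ} {a b : ℝ} (hab : a < b)
    (hf : ContinuousOn f (Icc a b)) (hP : (P ∩ Ioo a b).Finite)
    (hd : ∀ s ∈ Ioo a b, s ∉ P → ∃ f', 0 < f' ∧ HasDerivAt f f' s) : f a < f b := by
  generalize hn : (P ∩ Ioo a b).ncard = n
  induction n using Nat.strong_induction_on generalizing a b with
  | _ n ih =>
    by_cases hemp : ∃ p ∈ Ioo a b, p ∈ P
    · obtain ⟨p, hp, hpP⟩ := hemp
      have s₁ : P ∩ Ioo a p ⊂ P ∩ Ioo a b :=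
        ⟨inter_subset_inter_right _ (Ioo_subset_Ioo_right hp.2.le),
          fun h => lt_irrefl p (h ⟨hpP, hp⟩).2.2⟩
      have s₂ : P ∩ Ioo p b ⊂ P ∩ Ioo a b :=
        ⟨inter_subset_inter_right _ (Ioo_subset_Ioo_left hp.1.le),
          fun h => lt_irrefl p (h ⟨hpP, hp⟩).2.1⟩
      have h₁ := ih _ (hn ▸ ncard_lt_ncard s₁ hP) hp.1
        (hf.mono (Icc_subset_Icc_right hp.2.le)) (hP.subset s₁.1)
        (fun s hs => hd s (Ioo_subset_Ioo_right hp.2.le hs)) rfl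
      have h₂ := ih _ (hn ▸ ncard_lt_ncard s₂ hP) hp.2
        (hf.mono (Icc_subset_Icc_left hp.1.le)) (hP.subset s₂.1)
        (fun s hs => hd s (Ioo_subset_Ioo_left hp.1.le hs)) rfl
      exact h₁.trans h₂
    · push Not at hemp
      refine strictMonoOn_of_deriv_pos (convex_Icc a b) hf (fun s hs => ?_)
        (left_mem_Icc.2 hab.le) (right_mem_Icc.2 hab.le) hab
      rw [interior_Icc] at hs
      obtain ⟨f', h0, h⟩ := hd s hs (hemp s hs)
      rwa [h.deriv]

/-- A function on an interval that is increasing near the lower end has a limit there, if it is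
bounded below. -/
lemma exists_tendsto_atBot {I : Set ℝ} (s₀ : I) {h : I → ℝ}
    (hm : ∀ s₁ s₂ : I, s₁ ≤ s₂ → s₂ ≤ s₀ → h s₁ ≤ h s₂) {B : ℝ} (hB : ∀ s ≤ s₀, B ≤ h s) :
    ∃ l, Tendsto h atBot (𝓝 l) := by
  have hmono : Monotone fun s => h (min s s₀) := fun s₁ s₂ h12 =>
    hm _ _ (min_le_min_right _ h12) (min_le_right _ _)
  refine ⟨_, (tendsto_atBot_ciInf hmono ⟨B, ?_⟩).congr' ?_⟩
  · rintro _ ⟨s, rfl⟩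
    exact hB _ (min_le_right _ _)
  · filter_upwards [eventually_le_atBot s₀] with s hs
    simp only [min_eq_left hs]

/-- `g(v, v)` after completing the square. -/
lemma metric_quadratic (u : Fields) (p v : Fin 4 → ℝ) :
    v ⬝ᵥ (u.metric p).mulVec v =
      Real.exp (2 * u.a (p 0) (p 1)) * (v 1 ^ 2 - v 0 ^ 2)
      + u.R (p 0) (p 1) * (Real.exp (2 * u.W (p 0) (p 1)) * v 2 ^ 2
        + Real.exp (-2 * u.W (p 0) (p 1)) * (v 3 - u.q (p 0) (p 1) * v 2) ^ 2) := by
  simp [Fields.metric, dotProduct, Matrix.mulVec, Fin.sum_univ_four]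
  ring

/-- Bound for the components of a future-directed causal vector by its time component. -/
lemma abs_le_of_causal {u : Fields} {p v : Fin 4 → ℝ} {M : ℝ}
    (hR : 0 < u.R (p 0) (p 1)) (hv0 : 0 < v 0) (hv : v ⬝ᵥ (u.metric p).mulVec v ≤ 0) :
    |v 1| ≤ v 0 ∧
    (Real.exp (2 * u.a (p 0) (p 1)) / (u.R (p 0) (p 1) * Real.exp (2 * u.W (p 0) (p 1))) ≤ M →
      Real.exp (2 * u.a (p 0) (p 1)) / (u.R (p 0) (p 1) * Real.exp (-2 * u.W (p 0) (p 1))) ≤ M →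
      |u.q (p 0) (p 1)| ≤ M → ∀ j, |v j| ≤ ((M + 1) + (M + 1) * M) * v 0) := by
  rw [metric_quadratic] at hv
  generalize u.R (p 0) (p 1) = R at *
  generalize u.q (p 0) (p 1) = q at *
  have hE := Real.exp_pos (2 * u.a (p 0) (p 1))
  generalize Real.exp (2 * u.a (p 0) (p 1)) = E at *
  have hw := Real.exp_pos (2 * u.W (p 0) (p 1))
  generalize Real.exp (2 * u.W (p 0) (p 1)) = w at *
  have hw' := Real.exp_pos (-2 * u.W (p 0) (p 1))
  generalize Real.exp (-2 * u.W (p 0) (p 1)) = w' at *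
  have t₁ : 0 ≤ R * w * v 2 ^ 2 := by positivity
  have t₂ : 0 ≤ R * w' * (v 3 - q * v 2) ^ 2 := by positivity
  have t₃ : 0 ≤ E * v 1 ^ 2 := by positivity
  have h1 : |v 1| ≤ v 0 := by
    refine abs_le_of_sq_le_sq ?_ hv0.le
    have : E * v 1 ^ 2 ≤ E * v 0 ^ 2 := by nlinarith
    exact le_of_mul_le_mul_left this hE
  refine ⟨h1, fun hM₁ hM₂ hq j => ?_⟩
  have hM0 : 0 ≤ M := (abs_nonneg q).trans hq
  have hMM : M ≤ (M + 1) ^ 2 := by nlinarith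
  have h2 : |v 2| ≤ (M + 1) * v 0 := by
    refine abs_le_of_sq_le_sq ?_ (by positivity)
    rw [div_le_iff₀ (by positivity)] at hM₁
    have h4 : R * w * v 2 ^ 2 ≤ R * w * (M * v 0 ^ 2) := by
      nlinarith [mul_le_mul_of_nonneg_right hM₁ (sq_nonneg (v 0))]
    have h5 := le_of_mul_le_mul_left h4 (by positivity)
    nlinarith [mul_le_mul_of_nonneg_right hMM (sq_nonneg (v 0))]
  have h3 : |v 3 - q * v 2| ≤ (M + 1) * v 0 := by
    refine abs_le_of_sq_le_sq ?_ (by positivity)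
    rw [div_le_iff₀ (by positivity)] at hM₂
    have h4 : R * w' * (v 3 - q * v 2) ^ 2 ≤ R * w' * (M * v 0 ^ 2) := by
      nlinarith [mul_le_mul_of_nonneg_right hM₂ (sq_nonneg (v 0))]
    have h5 := le_of_mul_le_mul_left h4 (by positivity)
    nlinarith [mul_le_mul_of_nonneg_right hMM (sq_nonneg (v 0))]
  have h4 : |q * v 2| ≤ (M + 1) * M * v 0 := by
    rw [abs_mul]
    calc |q| * |v 2| ≤ M * ((M + 1) * v 0) := mul_le_mul hq h2 (abs_nonneg _) hM0
      _ = _ := by ring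
  have h5 : |v 3| ≤ |v 3 - q * v 2| + |q * v 2| := by
    have := abs_add_le (v 3 - q * v 2) (q * v 2)
    simpa using this
  have hpos : 0 ≤ (M + 1) * M * v 0 := by positivity
  have hpos' : 0 ≤ M * v 0 := by positivity
  fin_cases j
  · simp only [Fin.zero_eta, Fin.isValue, abs_of_pos hv0]
    linarith
  · simp only [Fin.mk_one, Fin.isValue]
    linarith
  · simp only [Fin.reduceFinMk]
    linarith
  · simp only [Fin.reduceFinMk]
    linarith

/-- An inextendible causal curve meets `t = 0` because otherwise it has a past endpoint: along the
curve `t` increases and `x` is a Lipschitz function of `t`, so that towards the past the curve stays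
over a compact set of `(t, x)`. There the metric on the tori is bounded below, so that all
coordinates are Lipschitz functions of `t`, and converge. Since `t` increases strictly, the curve
meets `t = 0` only once. -/
theorem initialSliceIsCauchy {u : Fields}
    (cR : ContinuousOn (Function.uncurry u.R) (Ici 0 ×ˢ univ))
    (cW : ContinuousOn (Function.uncurry u.W) (Ici 0 ×ˢ univ))
    (cq : ContinuousOn (Function.uncurry u.q) (Ici 0 ×ˢ univ))
    (ca : ContinuousOn (Function.uncurry u.a) (Ici 0 ×ˢ univ))
    (hR : ∀ t, 0 ≤ t → ∀ x, 0 < u.R t x) : InitialSliceIsCauchy u.metric := by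
  intro I γ ⟨hI, c, hlies, hc, P, hP, hd⟩ ⟨hfut, hpast⟩
  -- The empty curve is excluded: its future end filter is `⊥`, which converges to every point.
  have hne : Nonempty I := by
    by_contra hemp
    rw [not_nonempty_iff] at hemp
    refine hfut (⟨0, self_mem_Ici⟩, 0, 0, 0) ?_
    rw [Filter.filter_eq_bot_of_isEmpty (atTop : Filter I)]
    exact tendsto_bot
  have ht0 : ∀ s : I, 0 ≤ c s 0 := fun s => by
    rw [(hlies s).1]
    exact (γ s).1.2
  -- Increasing combinations of the coordinates along the curve.
  have mono : ∀ (N : ℝ) (ε : ℝ) (j : Fin 4) (s₁ s₂ : ℝ), s₁ ∈ I → s₂ ∈ I → s₁ < s₂ →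
      (∀ s ∈ Ioo s₁ s₂, ∀ v : Fin 4 → ℝ, 0 < v 0 → v ⬝ᵥ (u.metric (c s)).mulVec v ≤ 0 →
        0 < N * v 0 + ε * v j) → N * c s₁ 0 + ε * c s₁ j < N * c s₂ 0 + ε * c s₂ j := by
    intro N ε j s₁ s₂ h₁ h₂ h12 hv
    have hsub : Icc s₁ s₂ ⊆ I := hI.out h₁ h₂
    have hcc : ∀ j, ContinuousOn (fun s => c s j) (Icc s₁ s₂) := fun j =>
      (continuous_apply j).comp_continuousOn (hc.mono hsub)
    refine lt_of_deriv_pos_off_finite (f := fun s => N * c s 0 + ε * c s j) (P := P) h12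
      ((continuousOn_const.mul (hcc 0)).add (continuousOn_const.mul (hcc j)))
      ((hP s₁ h₁ s₂ h₂).subset (inter_subset_inter_right _ Ioo_subset_Icc_self))
      fun s hs hsP => ?_
    obtain ⟨v, hv1, -, hv2, hv3⟩ := hd s (hsub (Ioo_subset_Icc_self hs)) hsP
    have hda : HasDerivAt c v s := hv1.hasDerivAt (mem_of_superset (Icc_mem_nhds hs.1 hs.2) hsub)
    have hdj := hasDerivAt_pi.1 hda
    exact ⟨_, hv s hs v hv3 hv2, ((hdj 0).const_mul N).add ((hdj j).const_mul ε)⟩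
  have tmono : ∀ s₁ s₂ : I, s₁ < s₂ → c s₁ 0 < c s₂ 0 := fun s₁ s₂ h => by
    simpa using mono 1 0 0 s₁ s₂ s₁.2 s₂.2 h fun s _ v hv _ => by simpa using hv
  have hex : ∃ s : I, c s 0 = 0 := by
    by_contra hcon
    push Not at hcon
    obtain ⟨s₀⟩ := hne
    have tle : ∀ s ≤ s₀, c s 0 ≤ c s₀ 0 := fun s hs => by
      rcases hs.lt_or_eq with h | h
      · exact (tmono s s₀ h).le
      · rw [h]
    have hpos : ∀ s : I, 0 < u.R (c s 0) (c s 1) := fun s => hR _ (ht0 s) _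
    have xle : ∀ s ≤ s₀, |c s 1 - c s₀ 1| ≤ 2 * c s₀ 0 := by
      intro s hs
      rcases hs.lt_or_eq with h | h
      · have hsub : Icc (s : ℝ) s₀ ⊆ I := hI.out s.2 s₀.2
        have hv : ∀ r ∈ Ioo (s : ℝ) s₀, ∀ v : Fin 4 → ℝ, 0 < v 0 →
            v ⬝ᵥ (u.metric (c r)).mulVec v ≤ 0 → |v 1| ≤ v 0 := fun r hr v hv0 hv =>
          (abs_le_of_causal (M := 0) (hpos ⟨r, hsub (Ioo_subset_Icc_self hr)⟩) hv0 hv).1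
        have m₁ := mono 2 1 1 s s₀ s.2 s₀.2 h fun r hr v hv0 hvv => by
          linarith [neg_abs_le (v 1), hv r hr v hv0 hvv]
        have m₂ := mono 2 (-1) 1 s s₀ s.2 s₀.2 h fun r hr v hv0 hvv => by
          linarith [le_abs_self (v 1), hv r hr v hv0 hvv]
        have := ht0 s
        exact abs_le.2 ⟨by linarith, by linarith⟩
      · simp [h, ht0 s₀]
    -- Bounds on the compact region to which the curve is confined before `s₀`.
    set K : Set (ℝ × ℝ) := Icc 0 (c s₀ 0) ×ˢ Icc (c s₀ 1 - 2 * c s₀ 0) (c s₀ 1 + 2 * c s₀ 0)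
    have hK : IsCompact K := isCompact_Icc.prod isCompact_Icc
    have hKsub : K ⊆ Ici 0 ×ˢ univ := prod_mono Icc_subset_Ici_self (subset_univ _)
    have hcK : ∀ s ≤ s₀, (c s 0, c s 1) ∈ K := fun s hs => by
      have := abs_le.1 (xle s hs)
      exact ⟨⟨ht0 s, tle s hs⟩, ⟨by linarith, by linarith⟩⟩
    have eE := Real.continuous_exp.comp_continuousOn
      ((continuousOn_const (c := (2 : ℝ))).mul (ca.mono hKsub))
    have ew := fun k : ℝ => Real.continuous_exp.comp_continuousOn
      ((continuousOn_const (c := k)).mul (cW.mono hKsub))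
    have hne : ∀ k : ℝ, ∀ z ∈ K, u.R z.1 z.2 * Real.exp (k * u.W z.1 z.2) ≠ 0 := fun k z hz =>
      (mul_pos (hR z.1 hz.1.1 z.2) (Real.exp_pos _)).ne'
    obtain ⟨M₁, b₁⟩ := hK.exists_bound_of_continuousOn
      (eE.div ((cR.mono hKsub).mul (ew 2)) (hne 2))
    obtain ⟨M₂, b₂⟩ := hK.exists_bound_of_continuousOn
      (eE.div ((cR.mono hKsub).mul (ew (-2))) (hne (-2)))
    obtain ⟨M₃, b₃⟩ := hK.exists_bound_of_continuousOn (cq.mono hKsub)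
    obtain ⟨M, m₁, m₂, m₃⟩ : ∃ M : ℝ, M₁ ≤ M ∧ M₂ ≤ M ∧ M₃ ≤ M :=
      ⟨max M₁ (max M₂ M₃), by simp⟩
    set N := ((M + 1) + (M + 1) * M) + 1 with hN
    have hv : ∀ (s : I), s ≤ s₀ → ∀ j, ∀ v : Fin 4 → ℝ, 0 < v 0 →
        v ⬝ᵥ (u.metric (c s)).mulVec v ≤ 0 → |v j| < N * v 0 := by
      intro s hs j v hv0 hv
      have := (abs_le_of_causal (M := M) (hpos s) hv0 hv).2
        ((le_abs_self _).trans ((b₁ _ (hcK s hs)).trans m₁))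
        ((le_abs_self _).trans ((b₂ _ (hcK s hs)).trans m₂)) ((b₃ _ (hcK s hs)).trans m₃) j
      rw [hN]
      linarith
    have hlip : ∀ (ε : ℝ), |ε| = 1 → ∀ j, ∀ s₁ s₂ : I, s₁ ≤ s₂ → s₂ ≤ s₀ →
        N * c s₁ 0 + ε * c s₁ j ≤ N * c s₂ 0 + ε * c s₂ j := by
      intro ε hε j s₁ s₂ h12 h20
      rcases h12.lt_or_eq with h | h
      · refine (mono N ε j s₁ s₂ s₁.2 s₂.2 h fun r hr v hv0 hvv => ?_).le
        have hrI : r ∈ I := hI.out s₁.2 s₂.2 (Ioo_subset_Icc_self hr)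
        have h1 := hv ⟨r, hrI⟩ (hr.2.le.trans h20) j v hv0 hvv
        have h2 := neg_abs_le (ε * v j)
        rw [abs_mul, hε, one_mul] at h2
        linarith
      · rw [h]
    have hN0 : 0 ≤ N := by
      have hM0 : 0 ≤ M := (norm_nonneg _).trans ((b₃ _ (hcK s₀ le_rfl)).trans m₃)
      positivity
    -- `N t + x^j` and `N t - x^j` increase along the curve and are bounded, so `x^j` converges.
    have hlim : ∀ j, ∃ l, Tendsto (fun s : I => c s j) atBot (𝓝 l) := by
      intro j
      have hbd : ∀ s ≤ s₀, |c s j| ≤ |c s₀ j| + N * c s₀ 0 := by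
        intro s hs
        have h1 := hlip 1 (by simp) j s s₀ hs le_rfl
        have h2 := hlip (-1) (by simp) j s s₀ hs le_rfl
        have h3 := mul_nonneg hN0 (ht0 s)
        have h4 := le_abs_self (c s₀ j)
        have h5 := neg_abs_le (c s₀ j)
        exact abs_le.2 ⟨by linarith, by linarith⟩
      have hlim' : ∀ ε : ℝ, |ε| = 1 →
          ∃ l, Tendsto (fun s : I => N * c s 0 + ε * c s j) atBot (𝓝 l) := by
        intro ε hε
        refine exists_tendsto_atBot s₀ (hlip ε hε j) (B := -(|c s₀ j| + N * c s₀ 0))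
          fun s hs => ?_
        have h1 := neg_abs_le (ε * c s j)
        rw [abs_mul, hε, one_mul] at h1
        have h3 := mul_nonneg hN0 (ht0 s)
        linarith [hbd s hs]
      obtain ⟨l₁, h₁⟩ := hlim' 1 (by simp)
      obtain ⟨l₂, h₂⟩ := hlim' (-1) (by simp)
      refine ⟨(l₁ - l₂) / 2, ((h₁.sub h₂).div_const 2).congr fun s => ?_⟩
      ring
    choose l hl using hlim
    have hne' : (atBot : Filter I).NeBot := by
      have : Nonempty I := ⟨s₀⟩
      infer_instance
    have hl0 : 0 ≤ l 0 := ge_of_tendsto (hl 0) (Eventually.of_forall ht0)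
    have hγ : ∀ s : I, γ s = (⟨c s 0, ht0 s⟩, c s 1, ((c s 2 : ℝ) : AddCircle (2 * Real.pi)),
        ((c s 3 : ℝ) : AddCircle (2 * Real.pi))) := fun s => by
      obtain ⟨h0, h1, h2, h3⟩ := hlies s
      exact Prod.ext (Subtype.ext h0.symm) (Prod.ext h1.symm (Prod.ext h2.symm h3.symm))
    have htend : Tendsto γ atBot (𝓝 (⟨l 0, hl0⟩, l 1, ((l 2 : ℝ) : AddCircle (2 * Real.pi)),
        ((l 3 : ℝ) : AddCircle (2 * Real.pi)))) := by
      rw [funext hγ]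
      refine (tendsto_subtype_rng.2 (hl 0)).prodMk_nhds ((hl 1).prodMk_nhds
        (Tendsto.prodMk_nhds ?_ ?_))
      · exact ((AddCircle.continuous_mk' _).tendsto _).comp (hl 2)
      · exact ((AddCircle.continuous_mk' _).tendsto _).comp (hl 3)
    obtain ⟨hp0, s, hs⟩ := hpast _ htend
    refine hcon s ?_
    rw [(hlies s).1, hs]
    exact hp0
  obtain ⟨s, hs⟩ := hex
  refine ⟨s, (hlies s).1.symm.trans hs, fun r hr => ?_⟩
  have hr' : c r 0 = 0 := by rw [(hlies r).1]; exact hr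
  rcases lt_trichotomy r s with h | h | h
  · exact absurd (tmono r s h) (by rw [hs, hr']; exact lt_irrefl _)
  · exact h
  · exact absurd (tmono s r h) (by rw [hs, hr']; exact lt_irrefl _)

/-! ### The Ricci tensor of the metric -/

section Pd

/-- The derivative in the `d`-th coordinate of a function of `(t, x)`, seen as a function on the
cover. -/
def coordDeriv (d : Fin 4) (F : ℝ → ℝ → ℝ) : ℝ → ℝ → ℝ := ![dt F, dx F, 0, 0] d

lemma pd_congr {f h : (Fin 4 → ℝ) → ℝ} (hfh : ∀ y ∈ Cover, f y = h y) (d : Fin 4)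
    {p : Fin 4 → ℝ} (hp : p ∈ Cover) : pd d f p = pd d h p :=
  derivWithin_congr (fun _ hs => hfh _ hs) (by simpa using hfh p hp)

/-- On the cover, the one-sided derivatives `pd` of a function of `(t, x)` are `dt` and `dx`. -/
lemma pd_lift (F : ℝ → ℝ → ℝ) (d : Fin 4) {p : Fin 4 → ℝ} (hp : p ∈ Cover) :
    pd d (fun y => F (y 0) (y 1)) p = coordDeriv d F (p 0) (p 1) := by
  have hp0 : 0 ≤ p 0 := hp
  fin_cases d
  · simp [pd, coordDeriv, Cover]
    rfl
  · simp [pd, coordDeriv, Cover, hp0]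
    rfl
  · simp [pd, coordDeriv, Cover]
  · simp [pd, coordDeriv, Cover]

@[simp] lemma dt_zero (t x : ℝ) : dt 0 t x = 0 := by simp [dt]

@[simp] lemma dx_zero (t x : ℝ) : dx 0 t x = 0 := by simp [dx]

end Pd

namespace Fields

variable (u : Fields)

/-- The component `g_{ij}` as a function of `(t, x)`. -/
def comp (i j : Fin 4) (t x : ℝ) : ℝ := u.metric ![t, x, 0, 0] i j

/-- The derivative of the component `g_{θ₁θ₁}`, for `D` one of `dt`, `dx`. -/
def d11 (D : (ℝ → ℝ → ℝ) → ℝ → ℝ → ℝ) (t x : ℝ) : ℝ :=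
  D u.R t x * (Real.exp (2 * u.W t x) + u.q t x ^ 2 * Real.exp (-2 * u.W t x))
    + u.R t x * (2 * D u.W t x * Real.exp (2 * u.W t x)
      + 2 * u.q t x * D u.q t x * Real.exp (-2 * u.W t x)
      - 2 * D u.W t x * u.q t x ^ 2 * Real.exp (-2 * u.W t x))

/-- The derivative of the component `g_{θ₁θ₂}`. -/
def d12 (D : (ℝ → ℝ → ℝ) → ℝ → ℝ → ℝ) (t x : ℝ) : ℝ :=
  -(D u.R t x * u.q t x + u.R t x * D u.q t x - 2 * u.R t x * u.q t x * D u.W t x)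
    * Real.exp (-2 * u.W t x)

/-- The derivative of the component `g_{θ₂θ₂}`. -/
def d22 (D : (ℝ → ℝ → ℝ) → ℝ → ℝ → ℝ) (t x : ℝ) : ℝ :=
  (D u.R t x - 2 * u.R t x * D u.W t x) * Real.exp (-2 * u.W t x)

/-- The derivative of the matrix `g`. -/
def dMetric (D : (ℝ → ℝ → ℝ) → ℝ → ℝ → ℝ) (t x : ℝ) : Matrix (Fin 4) (Fin 4) ℝ :=
  !![-(2 * D u.a t x * Real.exp (2 * u.a t x)), 0, 0, 0;
     0, 2 * D u.a t x * Real.exp (2 * u.a t x), 0, 0;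
     0, 0, u.d11 D t x, u.d12 D t x;
     0, 0, u.d12 D t x, u.d22 D t x]

/-- The Christoffel symbols `Γ^t_{AB}` (for `c = 1`) and `Γ^x_{AB}` (for `c = -1`), where `k` is
the derivative of `g_{AB}`. -/
def lowerConn (c : ℝ) (k : ℝ → ℝ → ℝ) (t x : ℝ) : ℝ :=
  c / 2 * Real.exp (-2 * u.a t x) * k t x

/-- `Γ^{θ₁}_{Dθ₁}`. -/
def c11 (D : (ℝ → ℝ → ℝ) → ℝ → ℝ → ℝ) (t x : ℝ) : ℝ :=
  (D u.R t x / u.R t x + 2 * D u.W t x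
    + u.q t x * D u.q t x * Real.exp (-2 * u.W t x) ^ 2) / 2

/-- `Γ^{θ₁}_{Dθ₂}`. -/
def c12 (D : (ℝ → ℝ → ℝ) → ℝ → ℝ → ℝ) (t x : ℝ) : ℝ :=
  -(D u.q t x * Real.exp (-2 * u.W t x) ^ 2) / 2

/-- `Γ^{θ₂}_{Dθ₁}`. -/
def c21 (D : (ℝ → ℝ → ℝ) → ℝ → ℝ → ℝ) (t x : ℝ) : ℝ :=
  (4 * D u.W t x * u.q t x + u.q t x ^ 2 * D u.q t x * Real.exp (-2 * u.W t x) ^ 2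
    - D u.q t x) / 2

/-- `Γ^{θ₂}_{Dθ₂}`. -/
def c22 (D : (ℝ → ℝ → ℝ) → ℝ → ℝ → ℝ) (t x : ℝ) : ℝ :=
  (D u.R t x / u.R t x - 2 * D u.W t x
    - u.q t x * D u.q t x * Real.exp (-2 * u.W t x) ^ 2) / 2

/-- The table of Christoffel symbols `Γ^k_{ij}` as functions of `(t, x)`; the matrices are listed by
`k`. -/
def conn : Fin 4 → Matrix (Fin 4) (Fin 4) (ℝ → ℝ → ℝ) :=
  ![!![dt u.a, dx u.a, 0, 0;
       dx u.a, dt u.a, 0, 0;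
       0, 0, u.lowerConn 1 (u.d11 dt), u.lowerConn 1 (u.d12 dt);
       0, 0, u.lowerConn 1 (u.d12 dt), u.lowerConn 1 (u.d22 dt)],
    !![dx u.a, dt u.a, 0, 0;
       dt u.a, dx u.a, 0, 0;
       0, 0, u.lowerConn (-1) (u.d11 dx), u.lowerConn (-1) (u.d12 dx);
       0, 0, u.lowerConn (-1) (u.d12 dx), u.lowerConn (-1) (u.d22 dx)],
    !![0, 0, u.c11 dt, u.c12 dt;
       0, 0, u.c11 dx, u.c12 dx;
       u.c11 dt, u.c11 dx, 0, 0;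
       u.c12 dt, u.c12 dx, 0, 0],
    !![0, 0, u.c21 dt, u.c22 dt;
       0, 0, u.c21 dx, u.c22 dx;
       u.c21 dt, u.c21 dx, 0, 0;
       u.c22 dt, u.c22 dx, 0, 0] ]

lemma metric_inv {p : Fin 4 → ℝ} (hR : u.R (p 0) (p 1) ≠ 0) :
    (u.metric p)⁻¹ =
      !![-Real.exp (-2 * u.a (p 0) (p 1)), 0, 0, 0;
         0, Real.exp (-2 * u.a (p 0) (p 1)), 0, 0;
         0, 0, Real.exp (-2 * u.W (p 0) (p 1)) / u.R (p 0) (p 1),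
           u.q (p 0) (p 1) * Real.exp (-2 * u.W (p 0) (p 1)) / u.R (p 0) (p 1);
         0, 0, u.q (p 0) (p 1) * Real.exp (-2 * u.W (p 0) (p 1)) / u.R (p 0) (p 1),
           (Real.exp (2 * u.W (p 0) (p 1)) + u.q (p 0) (p 1) ^ 2
             * Real.exp (-2 * u.W (p 0) (p 1))) / u.R (p 0) (p 1)] := by
  apply Matrix.inv_eq_right_inv
  simp only [metric, neg_mul, Real.exp_neg]
  have h1 := Real.exp_ne_zero (2 * u.a (p 0) (p 1))
  have h2 := Real.exp_ne_zero (2 * u.W (p 0) (p 1))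
  ext i j
  fin_cases i <;> fin_cases j <;> simp [Matrix.mul_apply, Fin.sum_univ_four] <;> field_simp <;>
    ring

/-- Derivatives at `s` of the fields and of their derivatives under `D`, along the curve
`(γ₁, γ₂)` in the parameter set `S`. -/
structure JetAlong (D : (ℝ → ℝ → ℝ) → ℝ → ℝ → ℝ) (γ₁ γ₂ : ℝ → ℝ) (S : Set ℝ) (s : ℝ)
    (R' W' q' a' R'' W'' q'' : ℝ) : Prop where
  R : HasDerivWithinAt (fun r => u.R (γ₁ r) (γ₂ r)) R' S s
  W : HasDerivWithinAt (fun r => u.W (γ₁ r) (γ₂ r)) W' S s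
  q : HasDerivWithinAt (fun r => u.q (γ₁ r) (γ₂ r)) q' S s
  a : HasDerivWithinAt (fun r => u.a (γ₁ r) (γ₂ r)) a' S s
  DR : HasDerivWithinAt (fun r => D u.R (γ₁ r) (γ₂ r)) R'' S s
  DW : HasDerivWithinAt (fun r => D u.W (γ₁ r) (γ₂ r)) W'' S s
  Dq : HasDerivWithinAt (fun r => D u.q (γ₁ r) (γ₂ r)) q'' S s

namespace JetAlong

variable {u} {D : (ℝ → ℝ → ℝ) → ℝ → ℝ → ℝ} {γ₁ γ₂ : ℝ → ℝ} {S : Set ℝ} {s : ℝ}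
  {R' W' q' a' R'' W'' q'' : ℝ}

lemma exp_W (h : u.JetAlong D γ₁ γ₂ S s R' W' q' a' R'' W'' q'') (k : ℝ) :
    HasDerivWithinAt (fun r => Real.exp (k * u.W (γ₁ r) (γ₂ r)))
      (Real.exp (k * u.W (γ₁ s) (γ₂ s)) * (k * W')) S s :=
  (h.W.const_mul k).exp

lemma exp_a (h : u.JetAlong D γ₁ γ₂ S s R' W' q' a' R'' W'' q'') (k : ℝ) :
    HasDerivWithinAt (fun r => Real.exp (k * u.a (γ₁ r) (γ₂ r)))
      (Real.exp (k * u.a (γ₁ s) (γ₂ s)) * (k * a')) S s :=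
  (h.a.const_mul k).exp

/-- The components of the metric have the derivatives `dMetric`. -/
lemma comp (h : u.JetAlong D γ₁ γ₂ S s (D u.R (γ₁ s) (γ₂ s)) (D u.W (γ₁ s) (γ₂ s))
      (D u.q (γ₁ s) (γ₂ s)) (D u.a (γ₁ s) (γ₂ s)) R'' W'' q'') (i j : Fin 4) :
    HasDerivWithinAt (fun r => u.comp i j (γ₁ r) (γ₂ r)) (u.dMetric D (γ₁ s) (γ₂ s) i j) S s := by
  have ha : HasDerivWithinAt (fun r => Real.exp (2 * u.a (γ₁ r) (γ₂ r)))
      (2 * D u.a (γ₁ s) (γ₂ s) * Real.exp (2 * u.a (γ₁ s) (γ₂ s))) S s :=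
    (h.exp_a 2).congr_deriv (by ring)
  have h11 : HasDerivWithinAt (fun r => u.R (γ₁ r) (γ₂ r) * (Real.exp (2 * u.W (γ₁ r) (γ₂ r))
      + u.q (γ₁ r) (γ₂ r) ^ 2 * Real.exp (-2 * u.W (γ₁ r) (γ₂ r))))
      (u.d11 D (γ₁ s) (γ₂ s)) S s :=
    (h.R.mul ((h.exp_W 2).add ((h.q.pow 2).mul (h.exp_W (-2))))).congr_deriv (by
      simp [d11, -mul_eq_mul_left_iff]; ring)
  have h12 : HasDerivWithinAt (fun r => -(u.R (γ₁ r) (γ₂ r) * u.q (γ₁ r) (γ₂ r)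
      * Real.exp (-2 * u.W (γ₁ r) (γ₂ r)))) (u.d12 D (γ₁ s) (γ₂ s)) S s :=
    ((h.R.mul h.q).mul (h.exp_W (-2))).neg.congr_deriv (by simp [d12]; ring)
  have h22 : HasDerivWithinAt (fun r => u.R (γ₁ r) (γ₂ r)
      * Real.exp (-2 * u.W (γ₁ r) (γ₂ r))) (u.d22 D (γ₁ s) (γ₂ s)) S s :=
    (h.R.mul (h.exp_W (-2))).congr_deriv (by simp [d22]; ring)
  fin_cases i <;> fin_cases j <;> first
    | exact hasDerivWithinAt_const _ _ _
    | exact ha.neg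
    | exact ha
    | exact h11
    | exact h12
    | exact h22

lemma lowerConn_d11 (h : u.JetAlong D γ₁ γ₂ S s R' W' q' a' R'' W'' q'') (c : ℝ) :
    HasDerivWithinAt (fun r => u.lowerConn c (u.d11 D) (γ₁ r) (γ₂ r))
      (c / 2 * Real.exp (-2 * u.a (γ₁ s) (γ₂ s)) * (-2 * a' * u.d11 D (γ₁ s) (γ₂ s)
        + R'' * (Real.exp (2 * u.W (γ₁ s) (γ₂ s))
          + u.q (γ₁ s) (γ₂ s) ^ 2 * Real.exp (-2 * u.W (γ₁ s) (γ₂ s)))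
        + D u.R (γ₁ s) (γ₂ s) * (2 * W' * Real.exp (2 * u.W (γ₁ s) (γ₂ s))
          + (2 * u.q (γ₁ s) (γ₂ s) * q' - 2 * W' * u.q (γ₁ s) (γ₂ s) ^ 2)
            * Real.exp (-2 * u.W (γ₁ s) (γ₂ s)))
        + R' * (2 * D u.W (γ₁ s) (γ₂ s) * Real.exp (2 * u.W (γ₁ s) (γ₂ s))
          + 2 * u.q (γ₁ s) (γ₂ s) * D u.q (γ₁ s) (γ₂ s) * Real.exp (-2 * u.W (γ₁ s) (γ₂ s))
          - 2 * D u.W (γ₁ s) (γ₂ s) * u.q (γ₁ s) (γ₂ s) ^ 2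
            * Real.exp (-2 * u.W (γ₁ s) (γ₂ s)))
        + u.R (γ₁ s) (γ₂ s) * ((2 * W'' + 4 * D u.W (γ₁ s) (γ₂ s) * W')
            * Real.exp (2 * u.W (γ₁ s) (γ₂ s))
          + (2 * q' * D u.q (γ₁ s) (γ₂ s) + 2 * u.q (γ₁ s) (γ₂ s) * q''
            - 4 * u.q (γ₁ s) (γ₂ s) * D u.q (γ₁ s) (γ₂ s) * W'
            - 2 * W'' * u.q (γ₁ s) (γ₂ s) ^ 2
            - 4 * D u.W (γ₁ s) (γ₂ s) * u.q (γ₁ s) (γ₂ s) * q'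
            + 4 * D u.W (γ₁ s) (γ₂ s) * u.q (γ₁ s) (γ₂ s) ^ 2 * W')
            * Real.exp (-2 * u.W (γ₁ s) (γ₂ s))))) S s :=
  (((h.exp_a (-2)).const_mul (c / 2)).mul
    ((h.DR.mul ((h.exp_W 2).add ((h.q.pow 2).mul (h.exp_W (-2))))).add
      (h.R.mul ((((h.DW.const_mul 2).mul (h.exp_W 2)).add
        (((h.q.const_mul 2).mul h.Dq).mul (h.exp_W (-2)))).sub
        (((h.DW.const_mul 2).mul (h.q.pow 2)).mul (h.exp_W (-2))))))).congr_deriv (by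
    simp [d11]; ring)

lemma lowerConn_d12 (h : u.JetAlong D γ₁ γ₂ S s R' W' q' a' R'' W'' q'') (c : ℝ) :
    HasDerivWithinAt (fun r => u.lowerConn c (u.d12 D) (γ₁ r) (γ₂ r))
      (c / 2 * Real.exp (-2 * u.a (γ₁ s) (γ₂ s)) * (-2 * a' * u.d12 D (γ₁ s) (γ₂ s)
        - 2 * W' * u.d12 D (γ₁ s) (γ₂ s)
        - (R'' * u.q (γ₁ s) (γ₂ s) + D u.R (γ₁ s) (γ₂ s) * q' + R' * D u.q (γ₁ s) (γ₂ s)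
          + u.R (γ₁ s) (γ₂ s) * q'' - 2 * R' * u.q (γ₁ s) (γ₂ s) * D u.W (γ₁ s) (γ₂ s)
          - 2 * u.R (γ₁ s) (γ₂ s) * q' * D u.W (γ₁ s) (γ₂ s)
          - 2 * u.R (γ₁ s) (γ₂ s) * u.q (γ₁ s) (γ₂ s) * W'')
            * Real.exp (-2 * u.W (γ₁ s) (γ₂ s)))) S s :=
  (((h.exp_a (-2)).const_mul (c / 2)).mul
    ((((h.DR.mul h.q).add (h.R.mul h.Dq)).sub
      (((h.R.const_mul 2).mul h.q).mul h.DW)).neg.mul (h.exp_W (-2)))).congr_deriv (by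
    simp [d12]; ring)

lemma lowerConn_d22 (h : u.JetAlong D γ₁ γ₂ S s R' W' q' a' R'' W'' q'') (c : ℝ) :
    HasDerivWithinAt (fun r => u.lowerConn c (u.d22 D) (γ₁ r) (γ₂ r))
      (c / 2 * Real.exp (-2 * u.a (γ₁ s) (γ₂ s)) * (-2 * a' * u.d22 D (γ₁ s) (γ₂ s)
        - 2 * W' * u.d22 D (γ₁ s) (γ₂ s)
        + (R'' - 2 * R' * D u.W (γ₁ s) (γ₂ s) - 2 * u.R (γ₁ s) (γ₂ s) * W'')
            * Real.exp (-2 * u.W (γ₁ s) (γ₂ s)))) S s :=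
  (((h.exp_a (-2)).const_mul (c / 2)).mul
    ((h.DR.sub ((h.R.const_mul 2).mul h.DW)).mul (h.exp_W (-2)))).congr_deriv (by
    simp [d22]; ring)

lemma c11 (h : u.JetAlong D γ₁ γ₂ S s R' W' q' a' R'' W'' q'')
    (hR : u.R (γ₁ s) (γ₂ s) ≠ 0) :
    HasDerivWithinAt (fun r => u.c11 D (γ₁ r) (γ₂ r))
      (((R'' * u.R (γ₁ s) (γ₂ s) - D u.R (γ₁ s) (γ₂ s) * R') / u.R (γ₁ s) (γ₂ s) ^ 2 + 2 * W''
        + (q' * D u.q (γ₁ s) (γ₂ s) + u.q (γ₁ s) (γ₂ s) * q''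
          - 4 * u.q (γ₁ s) (γ₂ s) * D u.q (γ₁ s) (γ₂ s) * W')
            * Real.exp (-2 * u.W (γ₁ s) (γ₂ s)) ^ 2) / 2) S s :=
  ((((h.DR.div h.R hR).add (h.DW.const_mul 2)).add
    ((h.q.mul h.Dq).mul ((h.exp_W (-2)).pow 2))).div_const 2).congr_deriv (by simp; ring)

lemma c22 (h : u.JetAlong D γ₁ γ₂ S s R' W' q' a' R'' W'' q'')
    (hR : u.R (γ₁ s) (γ₂ s) ≠ 0) :
    HasDerivWithinAt (fun r => u.c22 D (γ₁ r) (γ₂ r))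
      (((R'' * u.R (γ₁ s) (γ₂ s) - D u.R (γ₁ s) (γ₂ s) * R') / u.R (γ₁ s) (γ₂ s) ^ 2 - 2 * W''
        - (q' * D u.q (γ₁ s) (γ₂ s) + u.q (γ₁ s) (γ₂ s) * q''
          - 4 * u.q (γ₁ s) (γ₂ s) * D u.q (γ₁ s) (γ₂ s) * W')
            * Real.exp (-2 * u.W (γ₁ s) (γ₂ s)) ^ 2) / 2) S s :=
  ((((h.DR.div h.R hR).sub (h.DW.const_mul 2)).sub
    ((h.q.mul h.Dq).mul ((h.exp_W (-2)).pow 2))).div_const 2).congr_deriv (by simp; ring)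

end JetAlong

end Fields

section Ricci

variable {u : Fields} {T : ℝ} {f : ℝ → ℝ → ℝ} {t x : ℝ}

lemma dt_eq_of_hasDerivWithinAt {f' : ℝ} (ht : 0 ≤ t)
    (h : HasDerivWithinAt (fun s => f s x) f' (Ici 0) t) : dt f t x = f' :=
  h.derivWithin (uniqueDiffOn_Ici 0 t ht)

lemma dx_eq_of_hasDerivWithinAt {f' : ℝ}
    (h : HasDerivWithinAt (fun y => f t y) f' univ x) : dx f t x = f' :=
  (hasDerivWithinAt_univ.1 h).deriv

namespace Fields

/-- The derivatives in `t` of the fields and of their first derivatives (`D` is `dt` or `dx`). -/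
lemma IsSolutionOn.jet_dt (hu : u.IsSolutionOn (Ico 0 T)) (ht : t ∈ Ico 0 T) (x : ℝ)
    {D : (ℝ → ℝ → ℝ) → ℝ → ℝ → ℝ}
    (hD : ∀ {f : ℝ → ℝ → ℝ}, ContDiffOn ℝ 2 (Function.uncurry f) (Strip T) →
      ContDiffOn ℝ 1 (Function.uncurry (D f)) (Strip T)) :
    u.JetAlong D (fun s => s) (fun _ => x) (Ici 0) t (dt u.R t x) (dt u.W t x) (dt u.q t x)
      (dt u.a t x) (dt (D u.R) t x) (dt (D u.W) t x) (dt (D u.q) t x) where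
  R := hasDerivWithinAt_dt (hu.contDiff_R.of_le one_le_two) ht x
  W := hasDerivWithinAt_dt (hu.contDiff_W.of_le one_le_two) ht x
  q := hasDerivWithinAt_dt (hu.contDiff_q.of_le one_le_two) ht x
  a := hasDerivWithinAt_dt (hu.contDiff_a.of_le one_le_two) ht x
  DR := hasDerivWithinAt_dt (hD hu.contDiff_R) ht x
  DW := hasDerivWithinAt_dt (hD hu.contDiff_W) ht x
  Dq := hasDerivWithinAt_dt (hD hu.contDiff_q) ht x

/-- The derivatives in `x` of the fields and of their first derivatives (`D` is `dt` or `dx`). -/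
lemma IsSolutionOn.jet_dx (hu : u.IsSolutionOn (Ico 0 T)) (ht : t ∈ Ico 0 T) (x : ℝ)
    {D : (ℝ → ℝ → ℝ) → ℝ → ℝ → ℝ}
    (hD : ∀ {f : ℝ → ℝ → ℝ}, ContDiffOn ℝ 2 (Function.uncurry f) (Strip T) →
      ContDiffOn ℝ 1 (Function.uncurry (D f)) (Strip T)) :
    u.JetAlong D (fun _ => t) (fun y => y) univ x (dx u.R t x) (dx u.W t x) (dx u.q t x)
      (dx u.a t x) (dx (D u.R) t x) (dx (D u.W) t x) (dx (D u.q) t x) where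
  R := (hasDerivAt_dx (hu.contDiff_R.of_le one_le_two) ht x).hasDerivWithinAt
  W := (hasDerivAt_dx (hu.contDiff_W.of_le one_le_two) ht x).hasDerivWithinAt
  q := (hasDerivAt_dx (hu.contDiff_q.of_le one_le_two) ht x).hasDerivWithinAt
  a := (hasDerivAt_dx (hu.contDiff_a.of_le one_le_two) ht x).hasDerivWithinAt
  DR := (hasDerivAt_dx (hD hu.contDiff_R) ht x).hasDerivWithinAt
  DW := (hasDerivAt_dx (hD hu.contDiff_W) ht x).hasDerivWithinAt
  Dq := (hasDerivAt_dx (hD hu.contDiff_q) ht x).hasDerivWithinAt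

lemma pd_metric (hu : u.IsSolutionOn (Ici 0)) {p : Fin 4 → ℝ} (hp : p ∈ Cover)
    (d i j : Fin 4) :
    pd d (fun y => u.metric y i j) p
      = ![u.dMetric dt (p 0) (p 1) i j, u.dMetric dx (p 0) (p 1) i j, 0, 0] d := by
  have ht : p 0 ∈ Ico 0 (p 0 + 1) := ⟨hp, lt_add_one _⟩
  have hv := hu.restrict (p 0 + 1)
  refine (pd_lift (u.comp i j) d hp).trans ?_
  fin_cases d
  · exact dt_eq_of_hasDerivWithinAt hp ((hv.jet_dt ht (p 1) contDiffOn_dt).comp i j)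
  · exact dx_eq_of_hasDerivWithinAt ((hv.jet_dx ht (p 1) contDiffOn_dx).comp i j)
  · rfl
  · rfl

set_option maxHeartbeats 1600000 in
lemma christoffel_metric (hu : u.IsSolutionOn (Ici 0)) {p : Fin 4 → ℝ} (hp : p ∈ Cover)
    (hR : u.R (p 0) (p 1) ≠ 0) (k i j : Fin 4) :
    christoffel u.metric k i j p = u.conn k i j (p 0) (p 1) := by
  simp only [christoffel, pd_metric hu hp, u.metric_inv hR, Fin.sum_univ_four]
  have e1 : Real.exp (2 * u.a (p 0) (p 1)) = (Real.exp (-2 * u.a (p 0) (p 1)))⁻¹ := by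
    rw [← Real.exp_neg]; ring_nf
  have e2 : Real.exp (2 * u.W (p 0) (p 1)) = (Real.exp (-2 * u.W (p 0) (p 1)))⁻¹ := by
    rw [← Real.exp_neg]; ring_nf
  have h1 := Real.exp_ne_zero (-2 * u.a (p 0) (p 1))
  have h2 := Real.exp_ne_zero (-2 * u.W (p 0) (p 1))
  fin_cases k <;> fin_cases i <;> fin_cases j <;>
    simp [dMetric, conn, d11, d12, d22, lowerConn, c11, c12, c21, c22, e1, e2,
      -mul_eq_mul_left_iff, -mul_eq_mul_right_iff, -neg_mul] <;>
    generalize Real.exp (-2 * u.a (p 0) (p 1)) = b at * <;>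
    generalize Real.exp (-2 * u.W (p 0) (p 1)) = e at * <;>
    field_simp <;> ring

end Fields
end Ricci

namespace Fields

variable {u : Fields}

/-- The Ricci tensor in terms of the table of Christoffel symbols. -/
lemma ricci_metric (hu : u.IsSolutionOn (Ici 0)) (hR : ∀ t, 0 ≤ t → ∀ x, 0 < u.R t x)
    {p : Fin 4 → ℝ} (hp : p ∈ Cover) (i j : Fin 4) :
    ricci u.metric i j p =
      ∑ k, (coordDeriv k (u.conn k i j) (p 0) (p 1) - coordDeriv j (u.conn k i k) (p 0) (p 1))
        + ∑ k, ∑ l, (u.conn k k l (p 0) (p 1) * u.conn l i j (p 0) (p 1)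
          - u.conn k j l (p 0) (p 1) * u.conn l i k (p 0) (p 1)) := by
  have h : ∀ y ∈ Cover, ∀ k i j, christoffel u.metric k i j y = u.conn k i j (y 0) (y 1) :=
    fun y hy k i j => christoffel_metric hu hy (hR _ hy _).ne' k i j
  have h' : ∀ d k i j, pd d (christoffel u.metric k i j) p
      = coordDeriv d (u.conn k i j) (p 0) (p 1) := fun d k i j =>
    (pd_congr (fun y hy => h y hy k i j) d hp).trans (pd_lift _ d hp)
  simp only [ricci, h', h p hp]

/-- The metric of a solution is Ricci flat: in the `(t, x)` block the Ricci tensor consists of the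
constraint equations and the equations for `a` and `R`, in the `(θ₁, θ₂)` block of combinations of
the equations for `R`, `W`, `q`, and the mixed components vanish identically. -/
lemma ricci_eq_zero (hu : u.IsSolutionOn (Ici 0)) (hR : ∀ t, 0 ≤ t → ∀ x, 0 < u.R t x)
    (hc : ∀ t, 0 ≤ t → (u.slice t).Constraints) {p : Fin 4 → ℝ} (hp : p ∈ Cover) (i j : Fin 4) :
    ricci u.metric i j p = 0 := by
  rw [ricci_metric hu hR hp]
  have hv := hu.restrict (p 0 + 1)
  have hp0 : 0 ≤ p 0 := hp
  have hRp := hR _ hp0 (p 1)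
  obtain ⟨C1, C2⟩ := hc _ hp0 (p 1)
  have eqR := hu.eq_R _ hp0 (p 1)
  have eqW := hu.eq_W _ hp0 (p 1)
  have eqq := hu.eq_q _ hp0 (p 1)
  have eqa := hu.eq_a _ hp0 (p 1)
  generalize p 0 = t at *
  generalize p 1 = x at *
  have ht : t ∈ Ico 0 (t + 1) := ⟨hp0, lt_add_one _⟩
  have jtt := hv.jet_dt ht x contDiffOn_dt
  have jtx := hv.jet_dt ht x contDiffOn_dx
  have jxt := hv.jet_dx ht x contDiffOn_dt
  have jxx := hv.jet_dx ht x contDiffOn_dx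
  have l11t := dt_eq_of_hasDerivWithinAt hp0 (jtt.lowerConn_d11 1)
  have l12t := dt_eq_of_hasDerivWithinAt hp0 (jtt.lowerConn_d12 1)
  have l22t := dt_eq_of_hasDerivWithinAt hp0 (jtt.lowerConn_d22 1)
  have l11x := dx_eq_of_hasDerivWithinAt (jxx.lowerConn_d11 (-1))
  have l12x := dx_eq_of_hasDerivWithinAt (jxx.lowerConn_d12 (-1))
  have l22x := dx_eq_of_hasDerivWithinAt (jxx.lowerConn_d22 (-1))
  have c11tt := dt_eq_of_hasDerivWithinAt hp0 (jtt.c11 hRp.ne')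
  have c22tt := dt_eq_of_hasDerivWithinAt hp0 (jtt.c22 hRp.ne')
  have c11tx := dt_eq_of_hasDerivWithinAt hp0 (jtx.c11 hRp.ne')
  have c22tx := dt_eq_of_hasDerivWithinAt hp0 (jtx.c22 hRp.ne')
  have c11xt := dx_eq_of_hasDerivWithinAt (jxt.c11 hRp.ne')
  have c22xt := dx_eq_of_hasDerivWithinAt (jxt.c22 hRp.ne')
  have c11xx := dx_eq_of_hasDerivWithinAt (jxx.c11 hRp.ne')
  have c22xx := dx_eq_of_hasDerivWithinAt (jxx.c22 hRp.ne')
  have sR := dx_dt_comm hv.contDiff_R ht x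
  have sa := dx_dt_comm hv.contDiff_a ht x
  simp only [slice, show deriv (dt u.R t) x = dx (dt u.R) t x from rfl,
    show deriv (deriv (u.R t)) x = dx (dx u.R) t x from rfl,
    show ∀ f : ℝ → ℝ → ℝ, deriv (f t) x = dx f t x from fun _ => rfl] at C1 C2
  have e4 : Real.exp (-4 * u.W t x) = Real.exp (-2 * u.W t x) ^ 2 := by
    rw [sq, ← Real.exp_add]; ring_nf
  have e2 : Real.exp (2 * u.W t x) = (Real.exp (-2 * u.W t x))⁻¹ := by
    rw [← Real.exp_neg]; ring_nf
  have h1 := Real.exp_ne_zero (-2 * u.a t x)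
  have h2 := Real.exp_ne_zero (-2 * u.W t x)
  simp only [e4, sR] at C1 C2 eqW eqq eqa
  have hs : ∀ k, coordDeriv 0 k t x = dt k t x ∧ coordDeriv 1 k t x = dx k t x ∧
      coordDeriv 2 k t x = 0 ∧ coordDeriv 3 k t x = 0 := fun k => ⟨rfl, rfl, rfl, rfl⟩
  fin_cases i <;> fin_cases j <;>
    simp only [Fin.sum_univ_four, conn, hs, Fin.zero_eta, Fin.mk_one, Fin.reduceFinMk,
      Matrix.of_apply, Matrix.cons_val, Pi.zero_apply, dt_zero, dx_zero, mul_zero, zero_mul,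
      add_zero, zero_add, sub_zero, zero_sub, sub_self, l11t, l12t, l22t, l11x, l12x, l22x, c11tt,
      c22tt, c11tx, c22tx, c11xt, c22xt, c11xx, c22xx, sa, sR, lowerConn, d11, d12, d22, c11, c12,
      c21, c22, e2]
  all_goals
    clear l11t l12t l22t l11x l12x l22x c11tt c22tt c11tx c22tx c11xt c22xt c11xx c22xx hs jtt jtx
      jxt jxx
    generalize Real.exp (-2 * u.a t x) = b at *
    generalize Real.exp (-2 * u.W t x) = e at *
    have hR0 := hRp.ne'
    generalize u.R t x = r at *
  · linear_combination (norm := (field_simp; ring)) C1 - eqa + eqR / r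
  · linear_combination (norm := (field_simp; ring)) C2
  · norm_num
  · norm_num
  · linear_combination (norm := (field_simp; ring)) C2
  · linear_combination (norm := (field_simp; ring)) C1 + eqa
  · norm_num
  · norm_num
  · norm_num
  · norm_num
  · linear_combination (norm := (field_simp; ring)) b / 2 * (-(e⁻¹ + u.q t x ^ 2 * e) * eqR
      + r * (2 * e⁻¹ - 2 * u.q t x ^ 2 * e) * eqW + 2 * r * u.q t x * e * eqq)
  · linear_combination (norm := (field_simp; ring)) -b / 2 * e * (-u.q t x * eqR + r * eqq
      - 2 * r * u.q t x * eqW)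
  · norm_num
  · norm_num
  · linear_combination (norm := (field_simp; ring)) -b / 2 * e * (-u.q t x * eqR + r * eqq
      - 2 * r * u.q t x * eqW)
  · linear_combination (norm := (field_simp; ring)) b / 2 * e * (-eqR - 2 * r * eqW)

end Fields

/-! ### The development of the data -/

namespace Fields

variable {u : Fields}

lemma contDiffOn_metric (hu : u.IsSolutionOn (Ici 0)) (i j : Fin 4) :
    ContDiffOn ℝ 2 (fun p => u.metric p i j) Cover := by
  have h : ∀ {f : ℝ → ℝ → ℝ}, ContDiffOn ℝ 2 (Function.uncurry f) (Ici 0 ×ˢ univ) →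
      ContDiffOn ℝ 2 (fun p : Fin 4 → ℝ => f (p 0) (p 1)) Cover := fun hf =>
    hf.comp (g := Function.uncurry _) (f := fun p : Fin 4 → ℝ => (p 0, p 1))
      ((contDiff_apply ℝ ℝ (0 : Fin 4)).prodMk (contDiff_apply ℝ ℝ (1 : Fin 4))).contDiffOn
      (fun p hp => ⟨hp, mem_univ _⟩)
  have hR := h hu.contDiff_R
  have hW := h hu.contDiff_W
  have hq := h hu.contDiff_q
  have ha := (contDiffOn_const (c := (2 : ℝ))).mul (h hu.contDiff_a) |>.exp
  have h2 := (contDiffOn_const (c := (2 : ℝ))).mul hW |>.exp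
  have h3 := (contDiffOn_const (c := (-2 : ℝ))).mul hW |>.exp
  fin_cases i <;> fin_cases j <;> first
    | exact contDiffOn_const
    | exact ha
    | exact ha.neg
    | exact hR.mul (h2.add ((hq.pow 2).mul h3))
    | exact ((hR.mul hq).mul h3).neg
    | exact hR.mul h3

lemma metric_lorentzian {p : Fin 4 → ℝ} (hR : 0 < u.R (p 0) (p 1)) :
    ∃ P : Matrix (Fin 4) (Fin 4) ℝ, IsUnit P.det ∧
      P.transpose * u.metric p * P = Matrix.diagonal ![-1, 1, 1, 1] := by
  have key : ∃ P : Matrix (Fin 4) (Fin 4) ℝ,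
      P.transpose * u.metric p * P = Matrix.diagonal ![-1, 1, 1, 1] := by
    have e1 : Real.exp (2 * u.a (p 0) (p 1)) = (Real.exp (-u.a (p 0) (p 1)) ^ 2)⁻¹ := by
      rw [← Real.exp_nat_mul, ← Real.exp_neg]; push_cast; ring_nf
    have e2 : Real.exp (2 * u.W (p 0) (p 1)) = (Real.exp (-u.W (p 0) (p 1)) ^ 2)⁻¹ := by
      rw [← Real.exp_nat_mul, ← Real.exp_neg]; push_cast; ring_nf
    have e3 : Real.exp (-2 * u.W (p 0) (p 1)) = Real.exp (-u.W (p 0) (p 1)) ^ 2 := by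
      rw [← Real.exp_nat_mul]; push_cast; ring_nf
    have h1 := Real.exp_ne_zero (-u.a (p 0) (p 1))
    have h2 := Real.exp_ne_zero (-u.W (p 0) (p 1))
    have h3 := Real.sq_sqrt hR.le
    have h4 := (Real.sqrt_pos.2 hR).ne'
    -- The columns are an orthonormal frame.
    refine ⟨!![Real.exp (-u.a (p 0) (p 1)), 0, 0, 0;
      0, Real.exp (-u.a (p 0) (p 1)), 0, 0;
      0, 0, Real.exp (-u.W (p 0) (p 1)) / √(u.R (p 0) (p 1)), 0;
      0, 0, u.q (p 0) (p 1) * Real.exp (-u.W (p 0) (p 1)) / √(u.R (p 0) (p 1)),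
        (Real.exp (-u.W (p 0) (p 1)))⁻¹ / √(u.R (p 0) (p 1))], ?_⟩
    simp only [metric, e1, e2, e3]
    generalize Real.exp (-u.a (p 0) (p 1)) = b at *
    generalize Real.exp (-u.W (p 0) (p 1)) = e at *
    generalize √(u.R (p 0) (p 1)) = r at *
    rw [← h3]
    ext i j
    fin_cases i <;> fin_cases j <;>
      simp [Matrix.mul_apply, Fin.sum_univ_four, Matrix.diagonal, -mul_eq_zero,
        -div_eq_zero_iff] <;>
      field_simp <;> ring
  -- Taking determinants in `Pᵀ g P = diag(-1, 1, 1, 1)` shows `det P ≠ 0`.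
  obtain ⟨P, hP⟩ := key
  refine ⟨P, ?_, hP⟩
  have := congrArg Matrix.det hP
  rw [Matrix.det_mul, Matrix.det_mul, Matrix.det_diagonal] at this
  refine isUnit_iff_ne_zero.2 fun h0 => ?_
  simp [h0, Fin.prod_univ_four] at this

lemma firstForm_posDef (t : ℝ) (hR : ∀ x, 0 < u.R t x) (y : Fin 3 → ℝ) :
    ((u.slice t).firstForm y).PosDef := by
  refine Matrix.PosDef.of_dotProduct_mulVec_pos ?_ fun v hv => ?_
  · ext i j
    fin_cases i <;> fin_cases j <;> simp [SliceData.firstForm]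
  · have hRy := hR (y 0)
    have e : star v ⬝ᵥ ((u.slice t).firstForm y).mulVec v =
        Real.exp (2 * u.a t (y 0)) * v 0 ^ 2
        + u.R t (y 0) * (Real.exp (2 * u.W t (y 0)) * v 1 ^ 2
          + Real.exp (-2 * u.W t (y 0)) * (v 2 - u.q t (y 0) * v 1) ^ 2) := by
      simp [SliceData.firstForm, slice, dotProduct, Matrix.mulVec, Fin.sum_univ_three]
      ring
    rw [e]
    by_contra! hle
    have h0 : v 0 = 0 := by
      by_contra h
      have : 0 < Real.exp (2 * u.a t (y 0)) * v 0 ^ 2 := by positivity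
      have : 0 ≤ u.R t (y 0) * (Real.exp (2 * u.W t (y 0)) * v 1 ^ 2
          + Real.exp (-2 * u.W t (y 0)) * (v 2 - u.q t (y 0) * v 1) ^ 2) := by positivity
      linarith
    have h1 : v 1 = 0 := by
      by_contra h
      have : 0 < u.R t (y 0) * (Real.exp (2 * u.W t (y 0)) * v 1 ^ 2
          + Real.exp (-2 * u.W t (y 0)) * (v 2 - u.q t (y 0) * v 1) ^ 2) := by positivity
      have : 0 ≤ Real.exp (2 * u.a t (y 0)) * v 0 ^ 2 := by positivity
      linarith
    have h2 : v 2 = 0 := by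
      by_contra h
      have : 0 < u.R t (y 0) * (Real.exp (-2 * u.W t (y 0)) * v 2 ^ 2) := by positivity
      simp [h0, h1] at hle
      simp at this
      linarith
    apply hv
    ext i
    fin_cases i <;> assumption

/-- The lapse of the metric is `e^a`, and `Γ^t_{ij} = ½ e^{-2a} ∂_t g_{ij}` on the slices. -/
lemma secondForm_metric (hu : u.IsSolutionOn (Ici 0)) (hR : ∀ x, 0 < u.R 0 x)
    (y : Fin 3 → ℝ) : secondForm u.metric y = (u.slice 0).secondForm y := by
  have hp : onSlice y ∈ Cover := le_refl (0 : ℝ)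
  have h0 : onSlice y 0 = 0 := rfl
  have h1 : onSlice y 1 = y 0 := rfl
  have hRp : u.R (onSlice y 0) (onSlice y 1) ≠ 0 := (hR (y 0)).ne'
  have hl : 1 / √(-((u.metric (onSlice y))⁻¹ 0 0)) = (Real.exp (-u.a 0 (y 0)))⁻¹ := by
    have : -((u.metric (onSlice y))⁻¹ 0 0) = Real.exp (-u.a 0 (y 0)) ^ 2 := by
      rw [u.metric_inv hRp, ← Real.exp_nat_mul]
      simp [h0, h1]
    rw [this, Real.sqrt_sq (Real.exp_pos _).le, one_div]
  have e1 : Real.exp (2 * u.a 0 (y 0)) = (Real.exp (-u.a 0 (y 0)) ^ 2)⁻¹ := by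
    rw [← Real.exp_nat_mul, ← Real.exp_neg]; push_cast; ring_nf
  have e2 : Real.exp (-2 * u.a 0 (y 0)) = Real.exp (-u.a 0 (y 0)) ^ 2 := by
    rw [← Real.exp_nat_mul]; push_cast; ring_nf
  have hne := Real.exp_ne_zero (-u.a 0 (y 0))
  ext i j
  simp only [secondForm, hl, christoffel_metric hu hp hRp, h0, h1, Matrix.of_apply,
    SliceData.secondForm, slice, e1]
  fin_cases i <;> fin_cases j <;>
    simp [conn, lowerConn, d11, d12, d22, e2, -neg_mul, -mul_eq_mul_left_iff,
      -mul_eq_mul_right_iff] <;>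
    generalize Real.exp (-u.a 0 (y 0)) = b at * <;> field_simp

/-- The metric of a global solution with `R > 0` that satisfies the constraint equations is a
vacuum Cauchy development of the data induced on `t = 0`. -/
theorem isVacuumCauchyDevelopment (hu : u.IsSolutionOn (Ici 0))
    (hR : ∀ t, 0 ≤ t → ∀ x, 0 < u.R t x) (hc : ∀ t, 0 ≤ t → (u.slice t).Constraints) :
    IsVacuumCauchyDevelopment u.metric (u.slice 0).firstForm (u.slice 0).secondForm where
  contDiff := contDiffOn_metric hu
  periodic p _ := by simp [metric]
  lorentzian p hp := metric_lorentzian (hR _ hp _)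
  timeOriented p _ := neg_lt_zero.2 (Real.exp_pos _)
  vacuum p hp := ricci_eq_zero hu hR hc hp
  riemannian := firstForm_posDef 0 (hR 0 le_rfl)
  induced_metric y i j := by
    fin_cases i <;> fin_cases j <;> rfl
  induced_secondForm := secondForm_metric hu (hR 0 le_rfl)
  cauchy := initialSliceIsCauchy hu.contDiff_R.continuousOn hu.contDiff_W.continuousOn
    hu.contDiff_q.continuousOn hu.contDiff_a.continuousOn hR

end Fields

end TorusSymmetric

end

theorem mainTheorem5 (R₀ : ℝ) (hR₀ : 0 < R₀) (D : TorusSymmetric.SliceData)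
    (hm0 : TorusSymmetric.m0 R₀ D < ENNReal.ofReal (2 * R₀ / 3))
    (hR : ContDiff ℝ 2 D.R) (hRt : ContDiff ℝ 1 D.Rt)
    (hW : ContDiff ℝ 2 D.W) (hWt : ContDiff ℝ 1 D.Wt)
    (hq : ContDiff ℝ 2 D.q) (hqt : ContDiff ℝ 1 D.qt)
    (ha : ContDiff ℝ 2 D.a) (hat : ContDiff ℝ 1 D.a_t)
    (hconstr : D.Constraints) :
    ∃ u : TorusSymmetric.Fields,
      u.IsSolutionOn (Set.Ici 0) ∧ u.slice 0 = D ∧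
      (∀ (T : ℝ) (v : TorusSymmetric.Fields), 0 < T →
        v.IsSolutionOn (Set.Ico 0 T) → v.slice 0 = D →
        ∀ t ∈ Set.Ico 0 T, ∀ x,
          v.R t x = u.R t x ∧ v.W t x = u.W t x ∧ v.q t x = u.q t x ∧ v.a t x = u.a t x) ∧
      (∀ t, 0 ≤ t → ∀ x, 0 < u.R t x) ∧
      (∀ t, 0 ≤ t → (u.slice t).Constraints) ∧
      TorusSymmetric.IsVacuumCauchyDevelopment u.metric D.firstForm D.secondForm := by
  obtain ⟨u, hu, rfl, hpos, hc⟩ :=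
    TorusSymmetric.exists_global_solution hR₀ hm0 hR hRt hW hWt hq hqt ha hat hconstr
  exact ⟨u, hu, rfl, fun T v _ hv h0 t ht x =>
    TorusSymmetric.solution_unique (hu.restrict T) hv (fun s hs y => (hpos s hs.1 y).ne') h0 ht x,
    hpos, hc, TorusSymmetric.Fields.isVacuumCauchyDevelopment hu hpos hc⟩
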